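/- **Setting.** Let $d\ge 1$, $\mathbb D=\{1,\dots,d\}$, $\mathbb F=\mathbb Z_+\times\mathbb D$, and let $\boldsymbol e$ be the column vector of ones. Let $\{\boldsymbol A(k);k\in\mathbb Z\}$ and $\{\boldsymbol B(k);k\in\mathbb Z_+\}$ be $d\times d$ matrices, $\underline{\boldsymbol A}(-k)=\sum_{\ell\le -k}\boldsymbol A(\ell)$, and let $\boldsymbol P$ be the matrix on $\mathbb F$ with blocks $\boldsymbol P(0;\ell)=\boldsymbol B(\ell)$, $\boldsymbol P(k;0)=\underline{\boldsymbol A}(-k)$ and $\boldsymbol P(k;\ell)=\boldsymbol A(\ell-k)$ for $k,\ell\ge1$. Assume that $\boldsymbol P$ is stochastic, irreducible and block monotone, i.e. $\sum_{m\ge\ell}\boldsymbol P(k;m)\le\sum_{m\ge\ell}\boldsymbol P(k+1;m)$ for all $k,\ell\in\mathbb Z_+$, and that $\boldsymbol A=\sum_{k\in\mathbb Z}\boldsymbol A(k)$ is an irreducible stochastic matrix, with stationary probability vector $\boldsymbol\varpi$. Assume $\sigma=\boldsymbol\varpi\sum_{k\in\mathbb Z}k\boldsymbol A(k)\boldsymbol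 e<0$. For $N\in\mathbb N$ let $\boldsymbol A_N(k)=\boldsymbol O$ for $k<-N$, $\boldsymbol A_N(-N)=\underline{\boldsymbol A}(-N)$, $\boldsymbol A_N(k)=\boldsymbol A(k)$ for $k>-N$; let $\boldsymbol P_N$ be the stochastic matrix built as $\boldsymbol P$ above with $\boldsymbol A_N$ in place of $\boldsymbol A$ (and the same $\boldsymbol B$), and let $\boldsymbol A_N^{*M}$ be the $M$-fold convolution of $\boldsymbol A_N$. Fix $N,M\in\mathbb N$ with $\sigma_N=\boldsymbol\varpi\sum_k k\boldsymbol A_N(k)\boldsymbol e<0$ and $\sum_{\ell\ge -L}\ell\boldsymbol A_N^{*M}(\ell)\boldsymbol e<\boldsymbol 0$, where $L=MN$. **Moment conditions.** Let $\alpha\in[0,1)$ and let $V:[0,\infty)\to[1,\infty)$ be increasing, convex and log-concave, such that (i) $\lim_{x\to\infty}(\log V(x))/x=\log r_{A_+}$, where $r_{A_+}=\sup\{z\ge1:\sum_{\ell\ge0}z^\ell\boldsymbol A(\ell)\text{ is finite}\}$; (ii) $V$ is twice differentiable on $(0,\infty)$; (iii) $V'(0):=\lim_{x\downarrow0}V'(x)>0$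 and $\lim_{x\to\infty}V'(x)=\infty$; (iv) $V''/V'$ is nonincreasing on $(0,\infty)$; (v) $\limsup_{\delta\downarrow0}\lim_{x\to\infty}V'(x+\delta x^{1-\alpha})/V'(x)=1$; and, for every $\delta>0$, $$\lim_{k\to\infty}\frac1{V'(k)}\sum_{\ell=\lfloor\delta k^{1-\alpha}\rfloor+1}^\infty V(k+\ell)\boldsymbol A_N^{*M}(\ell)\boldsymbol e=\boldsymbol 0$$ (the sums being finite for all large $k$). **Constants.** Fix $\kappa>0$ and $\varepsilon\in(0,1)$ with $(1-\varepsilon)\sum_{\ell\ge-L}\ell\boldsymbol A_N^{*M}(\ell)\boldsymbol e+2\varepsilon\sum_{\ell\ge0}\ell\boldsymbol A_N^{*M}(\ell)\boldsymbol e\le-2\kappa\boldsymbol e$; $\delta_0>0$ and an integer $K_0\ge L$ with $V'(k+\delta_0k^{1-\alpha})\le(1+\varepsilon)V'(k)$ and $V'(k-L)\ge(1-\varepsilon)V'(k)$ for all integers $k\ge K_0+1$; and an integer $K\ge K_0$ with $\frac1{V'(k)}\sum_{\ell\ge\lfloor\delta_0k^{1-\alpha}\rfloor+1}V(k+\ell)\boldsymbol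 A_N^{*M}(\ell)\boldsymbol e\le\kappa\boldsymbol e$ for all integers $k\ge K+1$. Let $\phi(t)=\kappa V'(V^{-1}(t))$, $t\ge1$; if $V(0)>1$, so that this formula defines $\phi$ only on $[V(0),\infty)$, let $\phi$ be any extension of it to $[1,\infty)$ that is positive, nondecreasing and concave. Put $H_\phi(x)=\int_1^x dy/\phi(y)$ for $x\ge1$, $r_\phi(x)=\phi(H_\phi^{-1}(x))$ for $x\ge0$, $c_{\phi,B}(x)=\frac{\phi(1)}{\phi(B+1)}x$, and for $J\in\mathbb Z_+$ $$b_J=\inf\Big\{x\ge0:\ x\boldsymbol e\ge\sum_{\ell=0}^\infty\boldsymbol P_N^M(k;\ell)V(\ell)\boldsymbol e-V(k)\boldsymbol e+\phi(V(k))\boldsymbol e,\ k=0,\dots,J\Big\},\qquad b=b_K .$$ For $n\in\mathbb N$ let ${}_{(n)}\boldsymbol P$ be the last-column-block-augmented truncation of $\boldsymbol P$: its blocks in column $\ell$ are $\boldsymbol P(k;\ell)$ for $\ell<n$, $\sum_{m\ge n}\boldsymbol P(k;m)$ for $\ell=n$, and $\boldsymbol O$ for $\ell>n$. Let ${}_{(n)}\boldsymbol\pi$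 be any stationary probability vector of ${}_{(n)}\boldsymbol P$, and let $\|\cdot\|$ be the sum of the absolute values of the entries. **Theorem.** Under these conditions $\boldsymbol P$ has a unique stationary probability vector $\boldsymbol\pi$, and the following hold. (a) If $\boldsymbol P^M(K;0)\boldsymbol e>\boldsymbol0$ and $B\in(0,\infty)$ satisfies $B\boldsymbol P^M(K;0)\boldsymbol e\ge b\boldsymbol e$, then for all $m,n\in\mathbb N$ $$\|{}_{(n)}\boldsymbol\pi-\boldsymbol\pi\|\le\frac{8\{c_{\phi,B}(1)\}^{-1}}{r_\phi(c_{\phi,B}(m-1))}(V(1)+B)+\frac{2mMbd}{\kappa V'(n)} .$$ (b) If the drift inequality $\sum_{\ell\ge0}\boldsymbol P_N^M(k;\ell)V(\ell)\boldsymbol e-V(k)\boldsymbol e\le-\kappa V'(k)\boldsymbol e$ holds for all $k\ge1$ (the case "$K=0$"), then for all $m,n\in\mathbb N$ $$\|{}_{(n)}\boldsymbol\pi-\boldsymbol\pi\|\le\frac{8}{r_\phi(m-1)}V(1)+\frac{2mMb_0d}{\kappa V'(n)} .$$ -/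

import Mathlib

open Set Filter Topology Matrix

noncomputable section

namespace BlockChain

/-- Row-stochastic (possibly infinite) matrix. -/
def IsStochastic {S : Type*} (P : Matrix S S ℝ) : Prop :=
  (∀ x y, 0 ≤ P x y) ∧ ∀ x, HasSum (P x) 1

/-- Powers of a (possibly infinite) matrix; for stochastic matrices every series converges. -/
def matPow {S : Type*} [DecidableEq S] (P : Matrix S S ℝ) : ℕ → Matrix S S ℝ
  | 0 => 1
  | m + 1 => fun x y => ∑' z, matPow P m x z * P z y

/-- Irreducibility: every state can be reached from every state. -/
def IsIrreducibleChain {S : Type*} [DecidableEq S] (P : Matrix S S ℝ) : Prop :=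
  ∀ x y, ∃ m, 0 < matPow P m x y

/-- `π` is a stationary probability vector of `P`. -/
def IsStationary {S : Type*} (P : Matrix S S ℝ) (π : S → ℝ) : Prop :=
  (∀ x, 0 ≤ π x) ∧ HasSum π 1 ∧ ∀ y, HasSum (fun x => π x * P x y) (π y)

/-- The total variation distance in the normalization `∑ |μ x - ν x|`. -/
def tvDist {S : Type*} (μ ν : S → ℝ) : ℝ := ∑' x, |μ x - ν x|

/-- Block monotonicity with block size `d`: the tail sums of block rows, taken entrywise,
are nondecreasing in the level of the block row. -/
def BlockMonotone {d : ℕ} (P : Matrix (ℕ × Fin d) (ℕ × Fin d) ℝ) : Prop :=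
  ∀ (k l : ℕ) (i j : Fin d),
    ∑' m : ℕ, P (k, i) (l + m, j) ≤ ∑' m : ℕ, P (k + 1, i) (l + m, j)

/-- The last-column-block-augmented northwest-corner truncation at level `n`. -/
def lcTrunc {d : ℕ} (P : Matrix (ℕ × Fin d) (ℕ × Fin d) ℝ) (n : ℕ) :
    Matrix (ℕ × Fin d) (ℕ × Fin d) ℝ := fun x y =>
  if y.1 < n then P x y
  else if y.1 = n then ∑' m : ℕ, P x (n + m, y.2)
  else 0

/-- `lowerTail A k = ∑_{l ≤ -k} A l`, entrywise. -/
def lowerTail {d : ℕ} (A : ℤ → Matrix (Fin d) (Fin d) ℝ) (k : ℕ) :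
    Matrix (Fin d) (Fin d) ℝ := fun i j => ∑' m : ℕ, A (-(k : ℤ) - m) i j

/-- The block-structured matrix whose top block row is `B₀ 0, B₀ 1, B₀ 2, …` and whose block row
`k ≥ 1` is `∑_{l ≤ -k} A l, A (1 - k), A (2 - k), …`. -/
def gig1 {d : ℕ} (A : ℤ → Matrix (Fin d) (Fin d) ℝ) (B₀ : ℕ → Matrix (Fin d) (Fin d) ℝ) :
    Matrix (ℕ × Fin d) (ℕ × Fin d) ℝ := fun x y =>
  if x.1 = 0 then B₀ y.1 x.2 y.2
  else if y.1 = 0 then lowerTail A x.1 x.2 y.2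
  else A ((y.1 : ℤ) - (x.1 : ℤ)) x.2 y.2

/-- The sum `∑_{k ∈ ℤ} A k`, entrywise. -/
def blockTotal {d : ℕ} (A : ℤ → Matrix (Fin d) (Fin d) ℝ) : Matrix (Fin d) (Fin d) ℝ :=
  fun i j => ∑' k : ℤ, A k i j

/-- The family `A` with all the jumps below `-N` moved to `-N`. -/
def truncBelow {d : ℕ} (A : ℤ → Matrix (Fin d) (Fin d) ℝ) (N : ℕ) :
    ℤ → Matrix (Fin d) (Fin d) ℝ := fun k =>
  if k < -(N : ℤ) then 0 else if k = -(N : ℤ) then lowerTail A N else A k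

/-- The `M`-fold convolution of a matrix sequence indexed by `ℤ`. -/
def convPow {d : ℕ} (A : ℤ → Matrix (Fin d) (Fin d) ℝ) : ℕ → ℤ → Matrix (Fin d) (Fin d) ℝ
  | 0 => fun k => if k = 0 then 1 else 0
  | M + 1 => fun k i j => ∑' l : ℤ, (convPow A M (k - l) * A l) i j

/-- `∑_{k ≥ 0} k ϖ A(k) e`, in `[0, ∞]`. -/
def upMean {d : ℕ} (A : ℤ → Matrix (Fin d) (Fin d) ℝ) (ϖ : Fin d → ℝ) : ENNReal :=
  ∑' k : ℕ, ENNReal.ofReal (k * (ϖ ⬝ᵥ (A k *ᵥ 1)))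

/-- `∑_{k ≥ 0} k ϖ A(-k) e`, in `[0, ∞]`. -/
def downMean {d : ℕ} (A : ℤ → Matrix (Fin d) (Fin d) ℝ) (ϖ : Fin d → ℝ) : ENNReal :=
  ∑' k : ℕ, ENNReal.ofReal (k * (ϖ ⬝ᵥ (A (-(k : ℤ)) *ᵥ 1)))

/-- The mean drift `ϖ ∑_{k ∈ ℤ} k A(k) e` as an extended real. It may be `-∞`; it is written so
that the undefined case `∞ - ∞` gets the value `+∞` and therefore never counts as negative. -/
def meanDrift {d : ℕ} (A : ℤ → Matrix (Fin d) (Fin d) ℝ) (ϖ : Fin d → ℝ) : EReal :=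
  -((downMean A ϖ : EReal) - (upMean A ϖ : EReal))

/-- The convergence radius `sup {z ≥ 1 : ∑_{l ≥ 0} z^l A(l) is finite}`, in `[0, ∞]`. -/
def radiusPlus {d : ℕ} (A : ℤ → Matrix (Fin d) (Fin d) ℝ) : ENNReal :=
  sSup (ENNReal.ofReal ''
    {z : ℝ | 1 ≤ z ∧ ∀ i j, Summable fun l : ℕ => z ^ l * A (l : ℤ) i j})

/-- `i`-th entry of `∑_{l = ⌊δ k^(1-α)⌋ + 1}^∞ V(k + l) C(l) e`. -/
def tailMoment {d : ℕ} (C : ℤ → Matrix (Fin d) (Fin d) ℝ) (V : ℝ → ℝ) (α δ : ℝ) (k : ℕ)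
    (i : Fin d) : ℝ :=
  ∑' l : ℕ, if ⌊δ * (k : ℝ) ^ (1 - α)⌋₊ + 1 ≤ l then V (k + l) * (C (l : ℤ) *ᵥ 1) i else 0

/-- The heavy-tail moment conditions on `V : [0, ∞) → [1, ∞)`, with first and second derivatives
`V'` and `V''`, for the family `A` and the family `C` (a convolution power of a truncation
of `A`). Only the values of `V` and `V'` on `[0, ∞)` and of `V''` on `(0, ∞)` matter. -/
structure HeavyTail {d : ℕ} (A C : ℤ → Matrix (Fin d) (Fin d) ℝ) (α : ℝ)
    (V V' V'' : ℝ → ℝ) : Prop where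
  alpha_nonneg : 0 ≤ α
  alpha_lt_one : α < 1
  one_le : ∀ x, 0 ≤ x → 1 ≤ V x
  increasing : StrictMonoOn V (Ici 0)
  convex : ConvexOn ℝ (Ici 0) V
  log_concave : ConcaveOn ℝ (Ici 0) fun x => Real.log (V x)
  growth : Tendsto (fun x : ℝ => ((Real.log (V x) / x : ℝ) : EReal)) atTop
    (𝓝 (ENNReal.log (radiusPlus A)))
  deriv_one : ∀ x, 0 < x → HasDerivAt V (V' x) x
  deriv_two : ∀ x, 0 < x → HasDerivAt V' (V'' x) x
  deriv_zero : Tendsto V' (𝓝[>] 0) (𝓝 (V' 0))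
  deriv_zero_pos : 0 < V' 0
  deriv_atTop : Tendsto V' atTop atTop
  ratio_antitone : AntitoneOn (fun x => V'' x / V' x) (Ioi 0)
  long_tailed : ∃ g : ℝ → EReal,
    (∀ᶠ δ in 𝓝[>] (0 : ℝ),
      Tendsto (fun x : ℝ => ((V' (x + δ * x ^ (1 - α)) / V' x : ℝ) : EReal)) atTop (𝓝 (g δ))) ∧
    limsup g (𝓝[>] 0) = 1
  tail_summable : ∀ i, ∀ᶠ k : ℕ in atTop,
    Summable fun l : ℕ => V (k + l) * (C (l : ℤ) *ᵥ 1) i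
  tail_limit : ∀ δ, 0 < δ → ∀ i,
    Tendsto (fun k : ℕ => tailMoment C V α δ k i / V' k) atTop (𝓝 0)

/-- `φ : [1, ∞) → (0, ∞)` is given by `φ(t) = κ V'(V⁻¹(t))`, that is, `φ(V(x)) = κ V'(x)` for
`x ≥ 0`. If `V 0 = 1` this determines `φ` on `[1, ∞)` and nothing else is required. If `V 0 > 1`
then `V⁻¹` does not exist on `[1, V 0)`, and `φ` may be any extension of `κ V' ∘ V⁻¹` to `[1, ∞)`
that is positive, nondecreasing and concave. -/
structure IsRate (κ : ℝ) (V V' φ : ℝ → ℝ) : Prop where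
  eq_on_range : ∀ x, 0 ≤ x → φ (V x) = κ * V' x
  extension : 1 < V 0 →
    (∀ t, 1 ≤ t → 0 < φ t) ∧ MonotoneOn φ (Ici 1) ∧ ConcaveOn ℝ (Ici 1) φ

/-- `H_φ(x) = ∫₁ˣ dy / φ(y)`. -/
def rateH (φ : ℝ → ℝ) (x : ℝ) : ℝ := ∫ y in (1 : ℝ)..x, 1 / φ y

/-- `r_φ = φ ∘ H_φ⁻¹` on `[0, ∞)`, where `H_φ⁻¹ : [0, ∞) → [1, ∞)`, and `r_φ = 0` on
`(-∞, 0)`. -/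
def rateR (φ : ℝ → ℝ) (x : ℝ) : ℝ :=
  if x < 0 then 0 else φ (Function.invFunOn (rateH φ) (Ici 1) x)

/-- `c_{φ,B}(x) = φ(1) x / φ(B + 1)`. -/
def rateC (φ : ℝ → ℝ) (B x : ℝ) : ℝ := φ 1 / φ (B + 1) * x

/-- `(k, i)` entry of `Q v`, where `v(l, j) = V(l)`. -/
def applyV {d : ℕ} (Q : Matrix (ℕ × Fin d) (ℕ × Fin d) ℝ) (V : ℝ → ℝ) (k : ℕ) (i : Fin d) : ℝ :=
  ∑' y : ℕ × Fin d, Q (k, i) y * V y.1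

/-- The least `x ≥ 0` with `x e ≥ ∑_l Q(k;l) v(l) - v(k) + φ ∘ v(k)` for `k = 0, …, K`, where
`v(k) = V(k) e`. -/
def driftConst {d : ℕ} (Q : Matrix (ℕ × Fin d) (ℕ × Fin d) ℝ) (V φ : ℝ → ℝ) (K : ℕ) : ℝ :=
  sInf {x : ℝ | 0 ≤ x ∧ ∀ k : ℕ, k ≤ K → ∀ i, applyV Q V k i - V k + φ (V k) ≤ x}

end BlockChain

end

/-! The truncated chain is the original chain with its level capped at `n` after every step, so the
two stationary laws differ through the mass that gets capped and through the time needed to forget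
the initial level. Both effects are controlled by a drift condition for the `M`-step chain.

Comparison. Block monotonicity means that the kernel preserves functions nondecreasing in the level
(`KMono`). The phase alone is an irreducible Markov chain with kernel `blockTotal A`, both for the
chain and for its truncation, so `π` and `πn` have the same phase marginal. Two ordered copies of a
monotone chain in the same phase merge once the upper one visits level 0. `op_iterate_le_add_taboo`
states this without constructing a coupling: the price is `taboo`, the probability that the upper
copy has not yet visited level 0. Starting both chains from level 0 with the common phase law gives
`πn ≤ π` in the block order (`stationary_stDom`). One step of the truncated chain then costs at most
`β`, a bound for the `π`-mass above level `n`. After `mM` steps of the original chain,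
`tvDist_lcTrunc_le` yields `2E + 2mMβ`, where `E` bounds the stationary probability of avoiding
level 0 at the times `0, …, m` of the `M`-step chain.

Estimates. Integrating the drift inequality `QV + φ∘V ≤ V + b` against `π` gives `π(φ∘V) ≤ b`
(`ev_le_of_drift`), and Markov's inequality turns this into `β = b / (κ V'(n))`. For `E`, a drift
`Qv + cφ(v) ≤ v` off level 0 is lifted to the time-dependent Lyapunov functions `H⁻¹(H(v) + ct) -
H⁻¹(ct)` (`IsConcaveRate.op_rate_add_le`). They bound the sum of `c r(ct)` times the avoidance
probabilities by `v`, and a decomposition at the last visit to level 0 transfers the bound to `π`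
(`mul_ev_taboo_le`). In case (a) the function `v` is `V` raised by `B` off level 0, which absorbs
the drift constant on the levels `1, …, K` (`shifted_drift`); in case (b) it is `V` itself.

Drift. The chain is dominated by the one with down-jumps cut at `-N`. Far from level 0, `M` steps of
the latter form a free walk with jump law `A_N^{*M}`, and convexity of `V` together with the moment
conditions gives the inequality (`HeavyTail.jump_drift`). The same drift makes the Cesàro averages
tight, hence existence of `π`; irreducibility gives uniqueness. -/

noncomputable section

namespace BlockChain

open scoped ENNReal

/-! ### Stochastic kernels acting on `[0, ∞]`-valued functions, where no summability has to be
checked. -/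

section Operators

variable {S : Type*}

/-- Integral of `f` against the vector of masses `p`. -/
def ev (p : S → ℝ) (f : S → ℝ≥0∞) : ℝ≥0∞ := ∑' x, ENNReal.ofReal (p x) * f x

/-- The action of the kernel `P` on nonnegative functions. -/
def op (P : Matrix S S ℝ) (f : S → ℝ≥0∞) : S → ℝ≥0∞ := fun x => ev (P x) f

/-- `p` is a probability vector. -/
def IsProb (p : S → ℝ) : Prop := (∀ x, 0 ≤ p x) ∧ HasSum p 1

theorem hasSum_of_tsum_ofReal {f : S → ℝ} {a : ℝ} (hf : ∀ x, 0 ≤ f x) (ha : 0 ≤ a)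
    (h : ∑' x, ENNReal.ofReal (f x) = ENNReal.ofReal a) : HasSum f a := by
  have hs : Summable f := by
    have := ENNReal.summable_toReal (f := fun x => ENNReal.ofReal (f x)) (by rw [h]; simp)
    simpa [ENNReal.toReal_ofReal (hf _)] using this
  rw [← ENNReal.ofReal_tsum_of_nonneg hf hs,
    ENNReal.ofReal_eq_ofReal_iff (tsum_nonneg hf) ha] at h
  exact h ▸ hs.hasSum

theorem tsum_ofReal_of_hasSum {f : S → ℝ} {a : ℝ} (hf : ∀ x, 0 ≤ f x) (h : HasSum f a) :
    ∑' x, ENNReal.ofReal (f x) = ENNReal.ofReal a := by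
  rw [← ENNReal.ofReal_tsum_of_nonneg hf h.summable, h.tsum_eq]

theorem ev_mono (p : S → ℝ) {f g : S → ℝ≥0∞} (h : ∀ x, f x ≤ g x) : ev p f ≤ ev p g :=
  ENNReal.tsum_le_tsum fun x => by gcongr; exact h x

theorem ev_add (p : S → ℝ) (f g : S → ℝ≥0∞) :
    ev p (fun x => f x + g x) = ev p f + ev p g := by
  simp only [ev, mul_add, ENNReal.tsum_add]

theorem ev_const_mul (p : S → ℝ) (c : ℝ≥0∞) (f : S → ℝ≥0∞) :
    ev p (fun x => c * f x) = c * ev p f := by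
  simp only [ev, ← ENNReal.tsum_mul_left, mul_left_comm]

theorem ev_finset_sum {ι : Type*} (p : S → ℝ) (s : Finset ι) (f : ι → S → ℝ≥0∞) :
    ev p (fun x => ∑ t ∈ s, f t x) = ∑ t ∈ s, ev p (f t) := by
  classical
  induction s using Finset.induction_on with
  | empty => simp [ev]
  | insert a s ha ih => simp only [Finset.sum_insert ha, ev_add, ih]

theorem ev_const {p : S → ℝ} (hp : IsProb p) (c : ℝ≥0∞) : ev p (fun _ => c) = c := by
  rw [ev, ENNReal.tsum_mul_right, tsum_ofReal_of_hasSum hp.1 hp.2]; simp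

theorem ev_le_const {p : S → ℝ} (hp : IsProb p) {f : S → ℝ≥0∞} {c : ℝ≥0∞} (h : ∀ x, f x ≤ c) :
    ev p f ≤ c := (ev_mono p h).trans_eq (ev_const hp c)

theorem ev_single [DecidableEq S] (p : S → ℝ) (y : S) :
    ev p (fun x => if x = y then 1 else 0) = ENNReal.ofReal (p y) := by
  rw [ev, tsum_eq_single y (by intro x hx; simp [hx])]; simp

/-- Dominated convergence to zero along a probability vector. -/
theorem tendsto_ev_zero {p : S → ℝ} (hp : IsProb p) {f : ℕ → S → ℝ≥0∞} (hf : ∀ m x, f m x ≤ 1)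
    (hlim : ∀ x, Tendsto (fun m => f m x) atTop (𝓝 0)) :
    Tendsto (fun m => ev p (f m)) atTop (𝓝 0) := by
  let _ : MeasurableSpace S := ⊤
  -- The weighted sum is the integral against a sum of weighted Dirac masses; the constant 1
  -- dominates.
  have h := MeasureTheory.tendsto_lintegral_of_dominated_convergence
    (μ := MeasureTheory.Measure.sum fun x : S => ENNReal.ofReal (p x) • MeasureTheory.Measure.dirac x)
    (F := f) (f := fun _ => 0) (fun _ => 1) (fun m => measurable_from_top)
    (fun m => Eventually.of_forall (hf m))
    (by
      simp only [MeasureTheory.lintegral_sum_measure, MeasureTheory.lintegral_smul_measure,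
        MeasureTheory.lintegral_dirac]
      have := ev_const hp 1
      rw [ev] at this
      simp only [smul_eq_mul]
      rw [this]; simp)
    (Eventually.of_forall hlim)
  simpa [MeasureTheory.lintegral_sum_measure, MeasureTheory.lintegral_smul_measure,
    MeasureTheory.lintegral_dirac' _ measurable_from_top, ev] using h

theorem op_mono (P : Matrix S S ℝ) {f g : S → ℝ≥0∞} (h : ∀ x, f x ≤ g x) (x : S) :
    op P f x ≤ op P g x := ev_mono _ h

theorem op_iterate_mono (P : Matrix S S ℝ) (t : ℕ) {f g : S → ℝ≥0∞} (h : ∀ x, f x ≤ g x) :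
    ∀ x, (op P)^[t] f x ≤ (op P)^[t] g x := by
  induction t generalizing f g with
  | zero => exact h
  | succ t ih =>
    intro x
    rw [Function.iterate_succ_apply, Function.iterate_succ_apply]
    exact ih (op_mono P h) x

theorem IsStochastic.isProb {P : Matrix S S ℝ} (hP : IsStochastic P) (x : S) : IsProb (P x) :=
  ⟨hP.1 x, hP.2 x⟩

theorem op_const {P : Matrix S S ℝ} (hP : IsStochastic P) (c : ℝ≥0∞) :
    op P (fun _ => c) = fun _ => c := funext fun x => ev_const (hP.isProb x) c

theorem op_add (P : Matrix S S ℝ) (f g : S → ℝ≥0∞) :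
    op P (fun x => f x + g x) = fun x => op P f x + op P g x := funext fun _ => ev_add _ _ _

theorem op_iterate_add (P : Matrix S S ℝ) (t : ℕ) (f g : S → ℝ≥0∞) :
    (op P)^[t] (fun x => f x + g x) = fun x => (op P)^[t] f x + (op P)^[t] g x := by
  induction t generalizing f g with
  | zero => rfl
  | succ t ih => simp only [Function.iterate_succ_apply, op_add, ih]

theorem op_iterate_const {P : Matrix S S ℝ} (hP : IsStochastic P) (t : ℕ) (c : ℝ≥0∞) :
    (op P)^[t] (fun _ => c) = fun _ => c :=
  Function.iterate_fixed (op_const hP c) t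

theorem ev_op (p : S → ℝ) (P : Matrix S S ℝ) (f : S → ℝ≥0∞) :
    ev p (op P f)
      = ∑' y, (∑' x, ENNReal.ofReal (p x) * ENNReal.ofReal (P x y)) * f y := by
  simp only [ev, op, ← ENNReal.tsum_mul_left, ← ENNReal.tsum_mul_right, mul_assoc]
  exact ENNReal.tsum_comm

theorem IsStochastic.le_one {P : Matrix S S ℝ} (hP : IsStochastic P) (x y : S) : P x y ≤ 1 :=
  le_hasSum (hP.2 x) y fun z _ => hP.1 x z

theorem IsProb.summable_mul {p : S → ℝ} (hp : IsProb p) {P : Matrix S S ℝ} (hP : IsStochastic P)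
    (y : S) : Summable fun x => p x * P x y :=
  Summable.of_nonneg_of_le (fun x => mul_nonneg (hp.1 x) (hP.1 x y))
    (fun x => mul_le_of_le_one_right (hp.1 x) (hP.le_one x y)) hp.2.summable

/-- One step of the chain from the initial law `p`. -/
def push (P : Matrix S S ℝ) (p : S → ℝ) : S → ℝ := fun y => ∑' x, p x * P x y

theorem ofReal_push {p : S → ℝ} (hp : IsProb p) {P : Matrix S S ℝ} (hP : IsStochastic P) (y : S) :
    ENNReal.ofReal (push P p y) = ∑' x, ENNReal.ofReal (p x) * ENNReal.ofReal (P x y) := by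
  rw [push, ENNReal.ofReal_tsum_of_nonneg (fun x => mul_nonneg (hp.1 x) (hP.1 x y))
    (hp.summable_mul hP y)]
  simp only [ENNReal.ofReal_mul (hp.1 _)]

theorem ev_push {p : S → ℝ} (hp : IsProb p) {P : Matrix S S ℝ} (hP : IsStochastic P)
    (f : S → ℝ≥0∞) : ev (push P p) f = ev p (op P f) := by
  rw [ev_op, ev]; simp only [ofReal_push hp hP]

theorem isProb_of_ev_one {p : S → ℝ} (h0 : ∀ x, 0 ≤ p x) (h : ev p (fun _ => 1) = 1) :
    IsProb p :=
  ⟨h0, hasSum_of_tsum_ofReal h0 zero_le_one (by simpa [ev] using h)⟩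

theorem isProb_push {p : S → ℝ} (hp : IsProb p) {P : Matrix S S ℝ} (hP : IsStochastic P) :
    IsProb (push P p) :=
  isProb_of_ev_one (fun y => tsum_nonneg fun x => mul_nonneg (hp.1 x) (hP.1 x y))
    (by rw [ev_push hp hP, op_const hP, ev_const hp])

theorem isProb_push_iterate {p : S → ℝ} (hp : IsProb p) {P : Matrix S S ℝ} (hP : IsStochastic P)
    (t : ℕ) : IsProb ((push P)^[t] p) := by
  induction t with
  | zero => exact hp
  | succ t ih => rw [Function.iterate_succ_apply']; exact isProb_push ih hP

theorem ev_push_iterate {p : S → ℝ} (hp : IsProb p) {P : Matrix S S ℝ} (hP : IsStochastic P)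
    (t : ℕ) (f : S → ℝ≥0∞) : ev ((push P)^[t] p) f = ev p ((op P)^[t] f) := by
  induction t generalizing f with
  | zero => rfl
  | succ t ih =>
    rw [Function.iterate_succ_apply', ev_push (isProb_push_iterate hp hP t) hP, ih,
      Function.iterate_succ_apply]

theorem isProb_single [DecidableEq S] (x : S) : IsProb (fun y : S => if x = y then (1 : ℝ) else 0) :=
  ⟨fun y => by dsimp only; split_ifs <;> simp, by simpa [eq_comm] using hasSum_ite_eq x (1 : ℝ)⟩

theorem matPow_aux [DecidableEq S] {P : Matrix S S ℝ} (hP : IsStochastic P) (t : ℕ) (x : S) :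
    IsProb (matPow P t x) ∧ matPow P t x = (push P)^[t] (fun y => if x = y then 1 else 0) := by
  have h2 : matPow P t x = (push P)^[t] (fun y => if x = y then 1 else 0) := by
    induction t with
    | zero => ext y; simp [matPow, Matrix.one_apply]
    | succ t ih => rw [Function.iterate_succ_apply', ← ih]; rfl
  exact ⟨h2 ▸ isProb_push_iterate (isProb_single x) hP t, h2⟩

theorem isStochastic_matPow [DecidableEq S] {P : Matrix S S ℝ} (hP : IsStochastic P) (t : ℕ) :
    IsStochastic (matPow P t) :=
  ⟨fun x => (matPow_aux hP t x).1.1, fun x => (matPow_aux hP t x).1.2⟩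

theorem op_matPow [DecidableEq S] {P : Matrix S S ℝ} (hP : IsStochastic P) (t : ℕ)
    (f : S → ℝ≥0∞) : op (matPow P t) f = (op P)^[t] f := by
  ext x
  rw [op, (matPow_aux hP t x).2, ev_push_iterate (isProb_single x) hP, ev, tsum_eq_single x]
  · simp
  · intro y hy; simp [Ne.symm hy]

theorem ev_matPow_single [DecidableEq S] {P : Matrix S S ℝ} (hP : IsStochastic P) (t : ℕ)
    (x y : S) : (op P)^[t] (fun z => if z = y then 1 else 0) x = ENNReal.ofReal (matPow P t x y) := by
  rw [← op_matPow hP, op, ev_single]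

theorem IsStationary.isProb {P : Matrix S S ℝ} {π : S → ℝ} (h : IsStationary P π) : IsProb π :=
  ⟨h.1, h.2.1⟩

theorem IsStationary.push_eq {P : Matrix S S ℝ} {π : S → ℝ} (h : IsStationary P π) :
    push P π = π := funext fun y => (h.2.2 y).tsum_eq

theorem isStationary_of_push_eq {P : Matrix S S ℝ} (hP : IsStochastic P) {π : S → ℝ}
    (hπ : IsProb π) (h : push P π = π) : IsStationary P π :=
  ⟨hπ.1, hπ.2, fun y => by
    have := (hπ.summable_mul hP y).hasSum
    rwa [show ∑' x, π x * P x y = π y from congrFun h y] at this⟩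

theorem IsStationary.ev_op_iterate {P : Matrix S S ℝ} (hP : IsStochastic P) {π : S → ℝ}
    (h : IsStationary P π) (t : ℕ) (f : S → ℝ≥0∞) : ev π ((op P)^[t] f) = ev π f := by
  rw [← ev_push_iterate h.isProb hP, Function.iterate_fixed h.push_eq]

theorem IsStationary.ev_op {P : Matrix S S ℝ} (hP : IsStochastic P) {π : S → ℝ}
    (h : IsStationary P π) (f : S → ℝ≥0∞) : ev π (op P f) = ev π f :=
  h.ev_op_iterate hP 1 f

theorem eq_of_ofReal_eq {p q : S → ℝ} (hp : ∀ x, 0 ≤ p x) (hq : ∀ x, 0 ≤ q x)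
    (h : ∀ x, ENNReal.ofReal (p x) = ENNReal.ofReal (q x)) : p = q :=
  funext fun x => (ENNReal.ofReal_eq_ofReal_iff (hp x) (hq x)).1 (h x)

theorem IsStationary.matPow [DecidableEq S] {P : Matrix S S ℝ} (hP : IsStochastic P) {π : S → ℝ}
    (h : IsStationary P π) (t : ℕ) : IsStationary (matPow P t) π := by
  have hQ := isStochastic_matPow hP t
  refine isStationary_of_push_eq hQ h.isProb
    (eq_of_ofReal_eq (isProb_push h.isProb hQ).1 h.1 fun y => ?_)
  rw [← ev_single, ← ev_single, ev_push h.isProb hQ, op_matPow hP, h.ev_op_iterate hP]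

/-- A finite measure that dominates its image under a stochastic kernel is invariant. -/
theorem invariant_of_subinvariant {P : Matrix S S ℝ} (hP : IsStochastic P) {p : S → ℝ≥0∞}
    (hfin : ∑' x, p x ≠ ⊤) (h : ∀ y, ∑' x, p x * ENNReal.ofReal (P x y) ≤ p y) (y : S) :
    ∑' x, p x * ENNReal.ofReal (P x y) = p y := by
  have hmass : ∑' y, ∑' x, p x * ENNReal.ofReal (P x y) = ∑' x, p x := by
    rw [ENNReal.tsum_comm]
    refine tsum_congr fun x => ?_
    rw [ENNReal.tsum_mul_left, tsum_ofReal_of_hasSum (hP.1 x) (hP.2 x)]; simp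
  by_contra hne
  exact (ENNReal.tsum_lt_tsum (hmass ▸ hfin) h (lt_of_le_of_ne (h y) hne)).ne hmass

/-- Invariance persists for all iterates, and some iterate carries a positive share of the mass at
`x` to `y`. -/
theorem pos_of_invariant [DecidableEq S] {P : Matrix S S ℝ} (hP : IsStochastic P)
    (hirr : IsIrreducibleChain P) {q : S → ℝ≥0∞}
    (hq : ∀ y, ∑' x, q x * ENNReal.ofReal (P x y) = q y) {x : S} (hx : q x ≠ 0) (y : S) :
    q y ≠ 0 := by
  have key : ∀ (t : ℕ) (f : S → ℝ≥0∞), ∑' x, q x * (op P)^[t] f x = ∑' x, q x * f x := by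
    intro t
    induction t with
    | zero => intro f; rfl
    | succ t ih =>
      intro f
      rw [Function.iterate_succ, Function.comp, ih]
      simp only [op, ev, ← ENNReal.tsum_mul_left]
      rw [ENNReal.tsum_comm]
      refine tsum_congr fun z => ?_
      simp only [← mul_assoc]
      rw [ENNReal.tsum_mul_right, hq]
  obtain ⟨m, hm⟩ := hirr x y
  have h1 := key m (fun z => if z = y then 1 else 0)
  rw [tsum_eq_single (f := fun x => q x * if x = y then 1 else 0) y
    (by intro z hz; simp [hz])] at h1
  simp only [if_true, mul_one] at h1
  rw [← h1]
  intro h0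
  rw [ENNReal.tsum_eq_zero] at h0
  have := h0 x
  rw [ev_matPow_single hP, mul_eq_zero] at this
  rcases this with h | h
  · exact hx h
  · exact absurd hm (not_lt.2 (ENNReal.ofReal_eq_zero.1 h))

/-- The pointwise minimum of two stationary vectors is mapped below itself, hence is invariant, and
so is its difference from the first vector. By irreducibility this difference vanishes everywhere or
nowhere. Either way one vector lies below the other, and equal total mass forces equality. -/
theorem isStationary_unique [DecidableEq S] {P : Matrix S S ℝ} (hP : IsStochastic P)
    (hirr : IsIrreducibleChain P) {π π' : S → ℝ} (h : IsStationary P π) (h' : IsStationary P π') :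
    π = π' := by
  set a : S → ℝ≥0∞ := fun x => ENNReal.ofReal (π x) with ha
  set b : S → ℝ≥0∞ := fun x => ENNReal.ofReal (π' x) with hb
  set c : S → ℝ≥0∞ := fun x => min (a x) (b x) with hc
  have inv : ∀ {ρ : S → ℝ}, IsStationary P ρ → ∀ y,
      ∑' x, ENNReal.ofReal (ρ x) * ENNReal.ofReal (P x y) = ENNReal.ofReal (ρ y) := by
    intro ρ hρ y
    rw [← ofReal_push hρ.isProb hP, hρ.push_eq]
  have ma : ∑' x, a x = 1 := by rw [ha, tsum_ofReal_of_hasSum h.1 h.2.1]; simp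
  have mb : ∑' x, b x = 1 := by rw [hb, tsum_ofReal_of_hasSum h'.1 h'.2.1]; simp
  have cfin : ∑' x, c x ≠ ⊤ := ((ENNReal.tsum_le_tsum fun x => min_le_left _ _).trans_lt
    (ma ▸ ENNReal.one_lt_top)).ne
  have cinv : ∀ y, ∑' x, c x * ENNReal.ofReal (P x y) = c y := by
    refine invariant_of_subinvariant hP cfin fun y => le_min ?_ ?_
    · refine le_trans ?_ (inv h y).le; exact ENNReal.tsum_le_tsum fun x => by gcongr; exact min_le_left _ _
    · refine le_trans ?_ (inv h' y).le; exact ENNReal.tsum_le_tsum fun x => by gcongr; exact min_le_right _ _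
  have cle : ∀ y, c y ≠ ⊤ := fun y => ENNReal.ne_top_of_tsum_ne_top cfin y
  have diff : ∀ {ρ : S → ℝ}, IsStationary P ρ → (∀ x, c x ≤ ENNReal.ofReal (ρ x)) → ∀ y,
      ∑' x, (ENNReal.ofReal (ρ x) - c x) * ENNReal.ofReal (P x y) = ENNReal.ofReal (ρ y) - c y := by
    intro ρ hρ hle y
    have : ∑' x, (ENNReal.ofReal (ρ x) - c x) * ENNReal.ofReal (P x y) + c y
        = ENNReal.ofReal (ρ y) := by
      rw [← inv hρ y]
      conv_lhs => rw [← cinv y]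
      rw [← ENNReal.tsum_add]
      refine tsum_congr fun x => ?_
      rw [← add_mul, tsub_add_cancel_of_le (hle x)]
    rw [← this, ENNReal.add_sub_cancel_right (cle y)]
  have da := diff h fun x => min_le_left _ _
  have eq_of_le : ∀ {u v : S → ℝ≥0∞}, ∑' x, u x = 1 → ∑' x, v x = 1 → (∀ x, u x ≤ v x) →
      ∀ x, u x = v x := by
    intro u v hu hv hle x
    by_contra hne
    exact (ENNReal.tsum_lt_tsum (by rw [hu]; simp) hle (lt_of_le_of_ne (hle x) hne)).ne (hu.trans hv.symm)
  refine eq_of_ofReal_eq h.1 h'.1 ?_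
  by_cases h0 : ∃ x, a x - c x ≠ 0
  · obtain ⟨x, hx⟩ := h0
    have hpos := pos_of_invariant hP hirr da hx
    refine fun y => (eq_of_le mb ma (fun z => ?_) y).symm
    by_contra hlt
    refine hpos z ?_
    rw [show c z = a z from min_eq_left (not_le.1 hlt).le]
    exact tsub_self _
  · push Not at h0
    refine eq_of_le ma mb (fun z => ?_)
    have := h0 z
    rw [tsub_eq_zero_iff_le] at this
    exact this.trans (min_le_right _ _)

end Operators

/-! ### Existence of a stationary vector from tight Cesàro averages. -/

section Existence

variable {S : Type*}

/-- Cesàro averages of the laws of the chain started at `x₀`. -/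
def cesaro [DecidableEq S] (Q : Matrix S S ℝ) (x₀ : S) (T : ℕ) (f : S → ℝ≥0∞) : ℝ≥0∞ :=
  (T : ℝ≥0∞)⁻¹ * ∑ t ∈ Finset.range T, ev (matPow Q t x₀) f

theorem cesaro_mono [DecidableEq S] (Q : Matrix S S ℝ) (x₀ : S) (T : ℕ) {f g : S → ℝ≥0∞}
    (h : ∀ x, f x ≤ g x) : cesaro Q x₀ T f ≤ cesaro Q x₀ T g := by
  unfold cesaro
  gcongr
  exact ev_mono _ h

theorem cesaro_const [DecidableEq S] {Q : Matrix S S ℝ} (hQ : IsStochastic Q) (x₀ : S) {T : ℕ}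
    (hT : T ≠ 0) (c : ℝ≥0∞) : cesaro Q x₀ T (fun _ => c) = c := by
  have : ∀ t, ev (matPow Q t x₀) (fun _ => c) = c :=
    fun t => ev_const ((isStochastic_matPow hQ t).isProb x₀) c
  simp only [cesaro, this, Finset.sum_const, Finset.card_range, nsmul_eq_mul]
  rw [← mul_assoc, ENNReal.inv_mul_cancel (by exact_mod_cast hT) (by simp), one_mul]

theorem cesaro_add [DecidableEq S] (Q : Matrix S S ℝ) (x₀ : S) (T : ℕ) (f g : S → ℝ≥0∞) :
    cesaro Q x₀ T (fun x => f x + g x) = cesaro Q x₀ T f + cesaro Q x₀ T g := by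
  simp only [cesaro, ev_add, Finset.sum_add_distrib, mul_add]

theorem cesaro_const_mul [DecidableEq S] (Q : Matrix S S ℝ) (x₀ : S) (T : ℕ) (c : ℝ≥0∞)
    (f : S → ℝ≥0∞) : cesaro Q x₀ T (fun x => c * f x) = c * cesaro Q x₀ T f := by
  simp only [cesaro, ev_const_mul, ← Finset.mul_sum, mul_left_comm]

theorem cesaro_finset_sum {ι : Type*} [DecidableEq S] (Q : Matrix S S ℝ) (x₀ : S) (T : ℕ)
    (s : Finset ι) (f : ι → S → ℝ≥0∞) :
    cesaro Q x₀ T (fun x => ∑ i ∈ s, f i x) = ∑ i ∈ s, cesaro Q x₀ T (f i) := by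
  simp only [cesaro, ev_finset_sum]
  rw [Finset.sum_comm, Finset.mul_sum]

/-- Applying the kernel shifts the time window by one, which adds only the last term, at most 1
before the division by `T`. -/
theorem cesaro_op_le [DecidableEq S] {Q : Matrix S S ℝ} (hQ : IsStochastic Q) (x₀ : S) (T : ℕ)
    {f : S → ℝ≥0∞} (hf : ∀ x, f x ≤ 1) :
    cesaro Q x₀ T (op Q f) ≤ cesaro Q x₀ T f + (T : ℝ≥0∞)⁻¹ := by
  have h1 : ∀ t, ev (matPow Q t x₀) (op Q f) = ev (matPow Q (t + 1) x₀) f := fun t =>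
    (ev_push ((isStochastic_matPow hQ t).isProb x₀) hQ f).symm
  simp only [cesaro, h1]
  have h2 : ∑ t ∈ Finset.range T, ev (matPow Q (t + 1) x₀) f
      ≤ ∑ t ∈ Finset.range T, ev (matPow Q t x₀) f + 1 := by
    calc _ ≤ ∑ t ∈ Finset.range (T + 1), ev (matPow Q t x₀) f := by
          rw [Finset.sum_range_succ']; exact le_self_add
      _ ≤ _ := by
          rw [Finset.sum_range_succ]
          gcongr
          exact ev_le_const ((isStochastic_matPow hQ T).isProb x₀) hf
  calc _ ≤ (T : ℝ≥0∞)⁻¹ * (∑ t ∈ Finset.range T, ev (matPow Q t x₀) f + 1) := by gcongr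
    _ = _ := by rw [mul_add, mul_one]

/-- Krylov–Bogolyubov: if the Cesàro averages of a function with finite sublevel sets stay bounded,
then there is a stationary probability vector. -/
theorem exists_isStationary_of_cesaro_le [DecidableEq S] {Q : Matrix S S ℝ} (hQ : IsStochastic Q)
    (x₀ : S) (w : S → ℝ≥0∞) (hw : ∀ c : ℕ, {x | w x ≤ c}.Finite) {D : ℝ≥0∞} (hD : D ≠ ⊤)
    (hb : ∀ T, T ≠ 0 → cesaro Q x₀ T w ≤ D) : ∃ π, IsStationary Q π := by
  set ind : S → S → ℝ≥0∞ := fun y x => if x = y then 1 else 0 with hind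
  -- Limits along an ultrafilter exist at every state at once, so no diagonal subsequence is needed.
  let U : Ultrafilter ℕ := hyperfilter ℕ
  have hU : (U : Filter ℕ) ≤ atTop := Nat.hyperfilter_le_atTop
  have hex : ∀ y, ∃ a, Tendsto (fun T => cesaro Q x₀ T (ind y)) U (𝓝 a) := by
    intro y
    obtain ⟨a, -, ha⟩ := isCompact_univ.ultrafilter_le_nhds
      (U.map fun T => cesaro Q x₀ T (ind y)) (by simp)
    exact ⟨a, ha⟩
  choose p hp using hex
  have hpos : ∀ᶠ T : ℕ in U, T ≠ 0 := hU (eventually_ne_atTop 0)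
  have hlim : ∀ (F : Finset S) (c : S → ℝ≥0∞), (∀ x, c x ≠ ⊤) →
      Tendsto (fun T => cesaro Q x₀ T (fun x => ∑ y ∈ F, c y * ind y x)) U
        (𝓝 (∑ y ∈ F, p y * c y)) := by
    intro F c hc
    simp only [cesaro_finset_sum, cesaro_const_mul]
    refine tendsto_finsetSum _ fun y _ => ?_
    rw [mul_comm (p y)]
    exact ENNReal.Tendsto.const_mul (hp y) (Or.inr (hc y))
  have sum_ind : ∀ (F : Finset S) (c : S → ℝ≥0∞) (x : S),
      ∑ y ∈ F, c y * ind y x = if x ∈ F then c x else 0 := by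
    intro F c x
    simp [hind]
  have hle : ∑' y, p y ≤ 1 := by
    rw [ENNReal.tsum_eq_iSup_sum]
    refine iSup_le fun F => ?_
    have := hlim F (fun _ => 1) (by simp)
    simp only [mul_one] at this
    refine le_of_tendsto this (hpos.mono fun T hT => ?_)
    refine (cesaro_mono Q x₀ T fun x => ?_).trans_eq (cesaro_const hQ x₀ hT 1)
    rw [sum_ind F (fun _ => 1)]; split_ifs <;> simp
  have hge : 1 ≤ ∑' y, p y := by
    -- Tightness: outside the finite set `w ≤ c` the averages have mass at most `D / c`. Using `D +
    -- 1` keeps the factor nonzero, so that `c = 0` gives the trivial bound `⊤`.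
    have key : ∀ c : ℕ, 1 ≤ ∑' y, p y + (c : ℝ≥0∞)⁻¹ * (D + 1) := by
      intro c
      rcases eq_or_ne c 0 with rfl | hc
      · simp
      · have h := hlim (hw c).toFinset (fun _ => 1) (by simp)
        simp only [mul_one] at h
        have h' := h.add_const ((c : ℝ≥0∞)⁻¹ * (D + 1))
        refine le_trans (ge_of_tendsto h' (hpos.mono fun T hT => ?_))
          (by gcongr; exact ENNReal.sum_le_tsum _)
        calc (1 : ℝ≥0∞) = cesaro Q x₀ T (fun _ => 1) := (cesaro_const hQ x₀ hT 1).symm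
          _ ≤ cesaro Q x₀ T (fun x => (∑ y ∈ (hw c).toFinset, 1 * ind y x)
                + (c : ℝ≥0∞)⁻¹ * w x) := by
              refine cesaro_mono Q x₀ T fun x => ?_
              rw [sum_ind _ (fun _ => 1)]
              split_ifs with hx
              · exact le_self_add
              · simp only [Finite.mem_toFinset, mem_ofPred_eq, not_le] at hx
                rw [zero_add, ← ENNReal.inv_mul_cancel (a := (c : ℝ≥0∞)) (by exact_mod_cast hc)
                  (by simp)]
                gcongr
          _ ≤ _ := by
              rw [cesaro_add, cesaro_const_mul]
              simp only [one_mul]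
              gcongr
              exact (hb T hT).trans le_self_add
    have hlim0 : Tendsto (fun c : ℕ => ∑' y, p y + (c : ℝ≥0∞)⁻¹ * (D + 1)) atTop
        (𝓝 (∑' y, p y + 0 * (D + 1))) :=
      (ENNReal.Tendsto.mul_const ENNReal.tendsto_inv_nat_nhds_zero (Or.inr (by simp [hD]))).const_add _
    rw [zero_mul, add_zero] at hlim0
    exact ge_of_tendsto' hlim0 key
  have hsum : ∑' y, p y = 1 := le_antisymm hle hge
  have hfin : ∑' y, p y ≠ ⊤ := by simp [hsum]
  -- Passing to the limit on finite sets yields only an inequality; conservation of mass upgrades it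
  -- to invariance.
  have hsub : ∀ y, ∑' x, p x * ENNReal.ofReal (Q x y) ≤ p y := by
    intro y
    rw [ENNReal.tsum_eq_iSup_sum]
    refine iSup_le fun F => ?_
    have h1 := hlim F (fun x => ENNReal.ofReal (Q x y)) (by simp)
    have h2 : Tendsto (fun T : ℕ => cesaro Q x₀ T (ind y) + (T : ℝ≥0∞)⁻¹) U (𝓝 (p y + 0)) :=
      (hp y).add (ENNReal.tendsto_inv_nat_nhds_zero.mono_left hU)
    rw [add_zero] at h2
    refine le_of_tendsto_of_tendsto' h1 h2 fun T => ?_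
    refine le_trans (cesaro_mono Q x₀ T fun x => ?_)
      (cesaro_op_le hQ x₀ T (f := ind y) fun x => by simp only [hind]; split_ifs <;> simp)
    rw [sum_ind, op, ev_single]
    split_ifs <;> simp
  have hinv := invariant_of_subinvariant hQ hfin hsub
  have hpt : ∀ y, p y ≠ ⊤ := fun y => ENNReal.ne_top_of_tsum_ne_top hfin y
  have hprob : IsProb fun y => (p y).toReal :=
    ⟨fun y => ENNReal.toReal_nonneg, hasSum_of_tsum_ofReal (fun y => ENNReal.toReal_nonneg)
      zero_le_one (by simp [ENNReal.ofReal_toReal (hpt _), hsum])⟩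
  refine ⟨_, isStationary_of_push_eq hQ hprob
    (eq_of_ofReal_eq (isProb_push hprob hQ).1 hprob.1 fun y => ?_)⟩
  rw [ofReal_push hprob hQ]
  simp only [ENNReal.ofReal_toReal (hpt _), hinv]

/-- A stationary vector of a power of `P` yields one of `P`, by averaging. -/
theorem exists_isStationary_of_matPow [DecidableEq S] {P : Matrix S S ℝ} (hP : IsStochastic P)
    {M : ℕ} (hM : M ≠ 0) {η : S → ℝ} (hη : IsStationary (matPow P M) η) :
    ∃ π, IsStationary P π := by
  have hprob := isProb_push_iterate hη.isProb hP
  have hper : (push P)^[M] η = η := by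
    refine eq_of_ofReal_eq (hprob M).1 hη.1 fun y => ?_
    rw [← ev_single, ← ev_single, ev_push_iterate hη.isProb hP, ← op_matPow hP,
      hη.ev_op (isStochastic_matPow hP M)]
  set π : S → ℝ := fun y => (M : ℝ)⁻¹ * ∑ s ∈ Finset.range M, (push P)^[s] η y with hπ
  have hev : ∀ f, ev π f
      = ENNReal.ofReal (M : ℝ)⁻¹ * ∑ s ∈ Finset.range M, ev ((push P)^[s] η) f := by
    intro f
    have hof : ∀ y, ENNReal.ofReal (π y)
        = ENNReal.ofReal (M : ℝ)⁻¹ * ∑ s ∈ Finset.range M, ENNReal.ofReal ((push P)^[s] η y) := by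
      intro y
      rw [hπ, ENNReal.ofReal_mul (by positivity),
        ENNReal.ofReal_sum_of_nonneg fun s _ => (hprob s).1 y]
    simp only [ev, hof, Finset.mul_sum, Finset.sum_mul, mul_assoc]
    rw [Summable.tsum_finsetSum fun _ _ => ENNReal.summable]
    simp only [ENNReal.tsum_mul_left]
  have h0 : ∀ y, 0 ≤ π y := fun y =>
    mul_nonneg (by positivity) (Finset.sum_nonneg fun s _ => (hprob s).1 y)
  have hpi : IsProb π := by
    refine isProb_of_ev_one h0 ?_
    simp only [hev, ev_const (hprob _), Finset.sum_const, Finset.card_range, nsmul_eq_mul, mul_one]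
    rw [← ENNReal.ofReal_natCast, ← ENNReal.ofReal_mul (by positivity),
      inv_mul_cancel₀ (by exact_mod_cast hM), ENNReal.ofReal_one]
  refine ⟨π, isStationary_of_push_eq hP hpi (eq_of_ofReal_eq (isProb_push hpi hP).1 h0 fun y => ?_)⟩
  rw [← ev_single, ← ev_single, ev_push hpi hP, hev, hev]
  congr 1
  have h1 : ∀ s, ev ((push P)^[s] η) (op P fun x => if x = y then 1 else 0)
      = ev ((push P)^[s + 1] η) fun x => if x = y then 1 else 0 := by
    intro s
    rw [Function.iterate_succ_apply', ev_push (hprob s) hP]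
  simp only [h1]
  -- One step turns the sum over `0, …, M - 1` into the sum over `1, …, M`; the end terms agree
  -- because `η` returns to itself after `M` steps.
  obtain ⟨M', rfl⟩ := Nat.exists_eq_succ_of_ne_zero hM
  rw [Finset.sum_range_succ, Finset.sum_range_succ' (fun s => ev ((push P)^[s] η) _)]
  rw [Nat.succ_eq_add_one] at hper
  rw [hper]
  rfl

end Existence

/-! ### Blockwise stochastic order, merging at level 0 and avoidance probabilities. -/

section LevelOrder

variable {d : ℕ}

/-- `f` is nondecreasing in the level. -/
def LevelMono (f : ℕ × Fin d → ℝ≥0∞) : Prop := ∀ i, Monotone fun k => f (k, i)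

/-- `p` is dominated by `q` in the blockwise stochastic order. -/
def StDom (p q : ℕ × Fin d → ℝ) : Prop := ∀ f, LevelMono f → ev p f ≤ ev q f

/-- `P` preserves level monotonicity. -/
def KMono (P : Matrix (ℕ × Fin d) (ℕ × Fin d) ℝ) : Prop := ∀ f, LevelMono f → LevelMono (op P f)

/-- Mass of `p` in phase `j` at the levels `≥ l`. -/
def tailMass (p : ℕ × Fin d → ℝ) (l : ℕ) (j : Fin d) : ℝ≥0∞ :=
  ∑' m : ℕ, ENNReal.ofReal (p (l + m, j))

theorem tsum_level (f : ℕ × Fin d → ℝ≥0∞) : ∑' x, f x = ∑ j, ∑' l, f (l, j) := by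
  rw [ENNReal.tsum_prod', ENNReal.tsum_comm, tsum_fintype]

theorem tsum_ite_le (f : ℕ → ℝ≥0∞) (s : ℕ) :
    ∑' l, (if s ≤ l then f l else 0) = ∑' m, f (s + m) := by
  rw [← ENNReal.summable.sum_add_tsum_nat_add' (k := s), Finset.sum_eq_zero, zero_add]
  · refine tsum_congr fun m => ?_
    rw [if_pos (Nat.le_add_left _ _), add_comm]
  · intro l hl
    rw [if_neg (by simpa using hl)]

/-- Summation by parts: a level-monotone function is a nonnegative combination, with its increments
`Δ` as weights, of indicators of upper tails within one phase. -/
theorem stDom_of_tailMass {p q : ℕ × Fin d → ℝ}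
    (h : ∀ l j, tailMass p l j ≤ tailMass q l j) : StDom p q := by
  intro f hf
  let Δ : Fin d → ℕ → ℝ≥0∞ := fun j s => Nat.casesOn s (f (0, j)) fun s => f (s + 1, j) - f (s, j)
  have hΔ : ∀ l j, f (l, j) = ∑' s, if s ≤ l then Δ j s else 0 := by
    intro l j
    rw [tsum_eq_sum (s := Finset.range (l + 1))
      (by intro s hs; rw [if_neg (by simpa [Nat.lt_succ_iff] using hs)])]
    rw [Finset.sum_congr rfl (g := Δ j)
      (by intro s hs; rw [if_pos (by simpa [Nat.lt_succ_iff] using hs)])]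
    induction l with
    | zero => simp [Δ]
    | succ l ih =>
      rw [Finset.sum_range_succ, ← ih]
      exact (add_tsub_cancel_of_le (hf j (Nat.le_succ l))).symm
  have key : ∀ r : ℕ × Fin d → ℝ, ev r f = ∑ j, ∑' s, Δ j s * tailMass r s j := by
    intro r
    rw [ev, tsum_level]
    refine Finset.sum_congr rfl fun j _ => ?_
    simp only [hΔ, ← ENNReal.tsum_mul_left]
    rw [ENNReal.tsum_comm]
    refine tsum_congr fun s => ?_
    rw [tailMass, ← tsum_ite_le (fun l => ENNReal.ofReal (r (l, j))), ← ENNReal.tsum_mul_left]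
    refine tsum_congr fun l => ?_
    split_ifs <;> simp [mul_comm]
  rw [key, key]
  refine Finset.sum_le_sum fun j _ => ?_
  exact ENNReal.tsum_le_tsum fun s => mul_le_mul_right (h s j) _

theorem levelMono_comp {u : ℕ → ℝ≥0∞} (hu : Monotone u) :
    LevelMono (fun x : ℕ × Fin d => u x.1) := fun _ => hu

theorem levelMono_tail (l : ℕ) (s : Set (Fin d)) :
    LevelMono (s.indicator (1 : Fin d → ℝ≥0∞) ∘ Prod.snd * fun x : ℕ × Fin d => if l ≤ x.1 then 1 else 0) := by
  intro i a b hab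
  simp only [Pi.mul_apply, Function.comp]
  gcongr
  split_ifs <;> first | exact le_rfl | omega | simp

theorem ev_tail_eq (p : ℕ × Fin d → ℝ) (l : ℕ) (j : Fin d) :
    ev p (({j} : Set (Fin d)).indicator (1 : Fin d → ℝ≥0∞) ∘ Prod.snd *
      fun x : ℕ × Fin d => if l ≤ x.1 then 1 else 0) = tailMass p l j := by
  rw [ev, tsum_level, Finset.sum_eq_single j]
  · rw [tailMass, ← tsum_ite_le (fun l => ENNReal.ofReal (p (l, j)))]
    refine tsum_congr fun m => ?_
    simp
  · intro b _ hb
    simp [hb]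
  · simp

/-- Domination may be tested on functions bounded by one. -/
theorem stDom_of_le_one {p q : ℕ × Fin d → ℝ}
    (h : ∀ f, LevelMono f → (∀ x, f x ≤ 1) → ev p f ≤ ev q f) : StDom p q := by
  refine stDom_of_tailMass fun l j => ?_
  rw [← ev_tail_eq, ← ev_tail_eq]
  refine h _ (levelMono_tail l {j}) fun x => ?_
  simp only [Pi.mul_apply, Function.comp, indicator]
  split_ifs <;> simp

theorem kMono_of_stDom {P : Matrix (ℕ × Fin d) (ℕ × Fin d) ℝ}
    (h : ∀ k i, StDom (P (k, i)) (P (k + 1, i))) : KMono P :=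
  fun f hf i => monotone_nat_of_le_succ fun k => h k i f hf

theorem KMono.iterate {P : Matrix (ℕ × Fin d) (ℕ × Fin d) ℝ} (h : KMono P) (t : ℕ)
    {f : ℕ × Fin d → ℝ≥0∞} (hf : LevelMono f) : LevelMono ((op P)^[t] f) := by
  induction t with
  | zero => exact hf
  | succ t ih => rw [Function.iterate_succ_apply']; exact h _ ih

theorem KMono.matPow {P : Matrix (ℕ × Fin d) (ℕ × Fin d) ℝ} (hP : IsStochastic P) (h : KMono P)
    (t : ℕ) : KMono (matPow P t) := fun f hf => by
  rw [op_matPow hP]; exact h.iterate t hf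

theorem KMono.stDom {P : Matrix (ℕ × Fin d) (ℕ × Fin d) ℝ} (h : KMono P) {k l : ℕ} (hkl : k ≤ l)
    (i : Fin d) : StDom (P (k, i)) (P (l, i)) := fun f hf => h f hf i hkl

theorem op_iterate_le_of_dom {R P : Matrix (ℕ × Fin d) (ℕ × Fin d) ℝ} (hP : KMono P)
    (hRP : ∀ x, StDom (R x) (P x)) (t : ℕ) {f : ℕ × Fin d → ℝ≥0∞} (hf : LevelMono f) :
    ∀ x, (op R)^[t] f x ≤ (op P)^[t] f x := by
  induction t with
  | zero => exact fun _ => le_rfl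
  | succ t ih =>
    intro x
    rw [Function.iterate_succ_apply', Function.iterate_succ_apply']
    exact (op_mono R ih x).trans (hRP x _ (hP.iterate t hf))

theorem matPow_dom {R P : Matrix (ℕ × Fin d) (ℕ × Fin d) ℝ} (hRs : IsStochastic R)
    (hPs : IsStochastic P) (hP : KMono P) (hRP : ∀ x, StDom (R x) (P x)) (t : ℕ)
    (x : ℕ × Fin d) : StDom (matPow R t x) (matPow P t x) := by
  intro f hf
  have := op_iterate_le_of_dom hP hRP t hf x
  rwa [← op_matPow hRs, ← op_matPow hPs] at this

theorem kMono_of_blockMonotone {P : Matrix (ℕ × Fin d) (ℕ × Fin d) ℝ} (hP : IsStochastic P)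
    (h : BlockMonotone P) : KMono P := by
  refine kMono_of_stDom fun k i => stDom_of_tailMass fun l j => ?_
  have hs : ∀ x : ℕ × Fin d, Summable fun m => P x (l + m, j) := fun x =>
    (hP.2 x).summable.comp_injective (i := fun m => (l + m, j)) fun a b hab => by simpa using hab
  rw [tailMass, tailMass, ← ENNReal.ofReal_tsum_of_nonneg (fun _ => hP.1 _ _) (hs _),
    ← ENNReal.ofReal_tsum_of_nonneg (fun _ => hP.1 _ _) (hs _)]
  exact ENNReal.ofReal_le_ofReal (h k l i j)

/-- The running maximum of `f` over the lower levels is level-monotone and lies between `f` and `f +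
g`, so domination applies to it although `f` itself need not be monotone. -/
theorem ev_le_add_of_stDom {p q : ℕ × Fin d → ℝ} (hpq : StDom p q) {f g : ℕ × Fin d → ℝ≥0∞}
    (h : ∀ k l i, k ≤ l → f (k, i) ≤ f (l, i) + g (l, i)) : ev p f ≤ ev q f + ev q g := by
  let F : ℕ × Fin d → ℝ≥0∞ := fun x => ⨆ k, ⨆ (_ : k ≤ x.1), f (k, x.2)
  have hF : LevelMono F := fun i a b hab =>
    biSup_mono fun k hk => le_trans hk hab
  calc ev p f ≤ ev p F := ev_mono p fun x => le_iSup₂_of_le x.1 le_rfl le_rfl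
    _ ≤ ev q F := hpq F hF
    _ ≤ ev q (fun x => f x + g x) := ev_mono q fun x => iSup₂_le fun k hk => h k x.1 x.2 hk
    _ = _ := ev_add _ _ _

/-- Probability that the chain avoids level `0` at the times `0, …, m`. -/
def taboo (Q : Matrix (ℕ × Fin d) (ℕ × Fin d) ℝ) : ℕ → ℕ × Fin d → ℝ≥0∞
  | 0 => fun x => if x.1 = 0 then 0 else 1
  | m + 1 => fun x => if x.1 = 0 then 0 else op Q (taboo Q m) x

theorem taboo_le_one {Q : Matrix (ℕ × Fin d) (ℕ × Fin d) ℝ} (hQ : IsStochastic Q) (m : ℕ)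
    (x : ℕ × Fin d) : taboo Q m x ≤ 1 := by
  induction m generalizing x with
  | zero => simp only [taboo]; split_ifs <;> simp
  | succ m ih =>
    simp only [taboo]
    split_ifs
    · simp
    · exact ev_le_const (hQ.isProb x) ih

theorem taboo_level_zero (Q : Matrix (ℕ × Fin d) (ℕ × Fin d) ℝ) (m : ℕ) (i : Fin d) :
    taboo Q m (0, i) = 0 := by
  cases m <;> simp [taboo]

theorem levelMono_taboo {Q : Matrix (ℕ × Fin d) (ℕ × Fin d) ℝ} (hQ : KMono Q) (m : ℕ) :
    LevelMono (taboo Q m) := by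
  induction m with
  | zero =>
    intro i a b hab
    simp only [taboo]
    split_ifs <;> first | exact le_rfl | omega | simp
  | succ m ih =>
    intro i a b hab
    simp only [taboo]
    split_ifs
    · exact le_rfl
    · simp
    · omega
    · exact hQ _ ih i hab

theorem taboo_le_of_dom {R Q : Matrix (ℕ × Fin d) (ℕ × Fin d) ℝ} (hQ : KMono Q)
    (hRQ : ∀ x, StDom (R x) (Q x)) (m : ℕ) (x : ℕ × Fin d) : taboo R m x ≤ taboo Q m x := by
  induction m generalizing x with
  | zero => exact le_rfl
  | succ m ih =>
    simp only [taboo]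
    split_ifs
    · exact le_rfl
    · exact (op_mono R ih x).trans (hRQ x _ (levelMono_taboo hQ m))

/-- Analytic substitute for coupling. If the upper state is at level 0, then so is the lower one,
and the two sides coincide without error; otherwise one more step is taken and `ev_le_add_of_stDom`
carries the inequality through it. -/
theorem op_iterate_le_add_taboo {Q : Matrix (ℕ × Fin d) (ℕ × Fin d) ℝ} (hQ : KMono Q)
    {f : ℕ × Fin d → ℝ≥0∞} (hf : ∀ x, f x ≤ 1) (m : ℕ) :
    ∀ k l i, k ≤ l → (op Q)^[m] f (k, i) ≤ (op Q)^[m] f (l, i) + taboo Q m (l, i) := by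
  induction m with
  | zero =>
    intro k l i hkl
    simp only [taboo, Function.iterate_zero, id]
    split_ifs with h
    · obtain rfl : k = l := by omega
      simp
    · exact (hf _).trans le_add_self
  | succ m ih =>
    intro k l i hkl
    simp only [taboo, Function.iterate_succ_apply']
    split_ifs with h
    · obtain rfl : k = l := by omega
      simp
    · exact ev_le_add_of_stDom (hQ.stDom hkl i) ih

theorem ev_op_iterate_le_add_taboo {Q : Matrix (ℕ × Fin d) (ℕ × Fin d) ℝ} (hQ : KMono Q)
    {p q : ℕ × Fin d → ℝ} (hpq : StDom p q) {f : ℕ × Fin d → ℝ≥0∞} (hf : ∀ x, f x ≤ 1) (m : ℕ) :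
    ev p ((op Q)^[m] f) ≤ ev q ((op Q)^[m] f) + ev q (taboo Q m) :=
  ev_le_add_of_stDom hpq (op_iterate_le_add_taboo hQ hf m)

/-- The law on level `0` with phase law `a`. -/
def ground (a : Fin d → ℝ) : ℕ × Fin d → ℝ := fun x => if x.1 = 0 then a x.2 else 0

theorem ev_ground (a : Fin d → ℝ) (f : ℕ × Fin d → ℝ≥0∞) :
    ev (ground a) f = ∑ i, ENNReal.ofReal (a i) * f (0, i) := by
  rw [ev, tsum_level]
  refine Finset.sum_congr rfl fun j _ => ?_
  rw [tsum_eq_single 0 (by intro l hl; simp [ground, hl])]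
  simp [ground]

theorem isProb_ground {a : Fin d → ℝ} (ha : IsProb a) : IsProb (ground a) := by
  refine isProb_of_ev_one (fun x => ?_) ?_
  · unfold ground; split_ifs; exacts [ha.1 _, le_rfl]
  · rw [ev_ground]
    have := ev_const ha 1
    rwa [ev, tsum_fintype] at this

theorem ground_stDom {a : Fin d → ℝ} {q : ℕ × Fin d → ℝ}
    (hq : ∀ i, tailMass q 0 i = ENNReal.ofReal (a i)) : StDom (ground a) q := by
  intro f hf
  rw [ev_ground, ev, tsum_level]
  gcongr with i _
  rw [← hq, tailMass, ← ENNReal.tsum_mul_right]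
  refine ENNReal.tsum_le_tsum fun l => ?_
  rw [zero_add]
  gcongr
  exact hf i (Nat.zero_le l)

/-- Stationary vectors inherit the blockwise domination of the kernels. -/
theorem stationary_stDom {R Q : Matrix (ℕ × Fin d) (ℕ × Fin d) ℝ} (hRs : IsStochastic R)
    (hQs : IsStochastic Q) (hR : KMono R) (hQ : KMono Q) (hRQ : ∀ x, StDom (R x) (Q x))
    {ρ π : ℕ × Fin d → ℝ} (hρ : IsStationary R ρ) (hπ : IsStationary Q π) {a : Fin d → ℝ}
    (ha : IsProb a) (hρa : ∀ i, tailMass ρ 0 i = ENNReal.ofReal (a i))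
    (hπa : ∀ i, tailMass π 0 i = ENNReal.ofReal (a i))
    (hlim : ∀ x, Tendsto (fun m => taboo Q m x) atTop (𝓝 0)) : StDom ρ π := by
  refine stDom_of_le_one fun f hf hf1 => ?_
  have hg := isProb_ground ha
  have key : ∀ m, ev ρ f ≤ ev π f + ev ρ (taboo Q m) := by
    intro m
    have hadd : ∀ x, f x + (1 - f x) = 1 := fun x => add_tsub_cancel_of_le (hf1 x)
    have split : ∀ {p : ℕ × Fin d → ℝ}, IsProb p →
        ev p ((op R)^[m] f) + ev p ((op R)^[m] fun x => 1 - f x) = 1 := by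
      intro p hp
      rw [← ev_add, ← op_iterate_add]
      simp only [hadd, op_iterate_const hRs, ev_const hp]
    -- The merging inequality only bounds the lower law by the upper one. Applied to `1 - f` it
    -- gives the reverse bound, of `ρ` by the law started at level 0.
    have h1 := ev_op_iterate_le_add_taboo hR (ground_stDom hρa) (f := fun x => 1 - f x)
      (fun x => tsub_le_self) m
    have h2 := split hρ.isProb
    have h3 := split hg
    rw [hρ.ev_op_iterate hRs] at h2
    have hfin : ev (ground a) ((op R)^[m] fun x => 1 - f x) ≠ ⊤ :=
      ne_top_of_le_ne_top ENNReal.one_ne_top (le_add_self.trans_eq h3)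
    have h4 : ev ρ f ≤ ev (ground a) ((op R)^[m] f) + ev ρ (taboo R m) := by
      rw [← ENNReal.add_le_add_iff_right hfin]
      calc _ ≤ ev ρ f + (ev ρ ((op R)^[m] fun x => 1 - f x) + ev ρ (taboo R m)) := by gcongr
        _ = 1 + ev ρ (taboo R m) := by rw [← add_assoc, h2]
        _ = _ := by rw [add_right_comm, h3]
    calc ev ρ f ≤ ev (ground a) ((op R)^[m] f) + ev ρ (taboo R m) := h4
      _ ≤ ev (ground a) ((op Q)^[m] f) + ev ρ (taboo Q m) := by
          gcongr
          · exact ev_mono _ (op_iterate_le_of_dom hQ hRQ m hf)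
          · exact ev_mono _ (taboo_le_of_dom hQ hRQ m)
      _ ≤ ev π ((op Q)^[m] f) + ev ρ (taboo Q m) := by
          gcongr
          exact ground_stDom hπa _ (hQ.iterate m hf)
      _ = _ := by rw [hπ.ev_op_iterate hQs]
  have h := (tendsto_ev_zero hρ.isProb (taboo_le_one hQs) hlim).const_add (ev π f)
  rw [add_zero] at h
  exact ge_of_tendsto' h key

/-- Supermartingale argument up to the first visit to level 0: each step off level 0 pays `r t` out
of `W t`. The offset `s` makes the induction on the horizon possible. -/
theorem sum_taboo_le {Q : Matrix (ℕ × Fin d) (ℕ × Fin d) ℝ} {W : ℕ → ℕ × Fin d → ℝ≥0∞}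
    {r : ℕ → ℝ≥0∞} (hW : ∀ t x, x.1 ≠ 0 → op Q (W (t + 1)) x + r t ≤ W t x) (T : ℕ) :
    ∀ s x, ∑ t ∈ Finset.range T, r (s + t) * taboo Q t x ≤ W s x := by
  induction T with
  | zero => simp
  | succ T ih =>
    intro s x
    rcases eq_or_ne x.1 0 with hx | hx
    · obtain ⟨k, i⟩ := x
      obtain rfl : k = 0 := hx
      simp [taboo_level_zero]
    · rw [Finset.sum_range_succ']
      refine le_trans ?_ (hW s x hx)
      gcongr
      · refine le_trans (le_of_eq ?_) (op_mono Q (ih (s + 1)) x)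
        simp only [op, ev_finset_sum, ev_const_mul, taboo, if_neg hx]
        refine Finset.sum_congr rfl fun t _ => ?_
        rw [add_right_comm, add_assoc]
      · simp [taboo, hx]

theorem tendsto_taboo_zero {Q : Matrix (ℕ × Fin d) (ℕ × Fin d) ℝ} {v : ℕ × Fin d → ℝ≥0∞}
    {r : ℕ → ℝ≥0∞} (hr : Monotone r) (hr0 : r 0 ≠ 0) (x : ℕ × Fin d) (hv : v x ≠ ⊤)
    (h : ∀ T, ∑ t ∈ Finset.range T, r t * taboo Q t x ≤ v x) :
    Tendsto (fun m => taboo Q m x) atTop (𝓝 0) := by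
  refine ENNReal.tendsto_atTop_zero_of_tsum_ne_top fun htop => hv (top_unique ?_)
  have h1 : r 0 * ∑' t, taboo Q t x ≤ v x := by
    rw [← ENNReal.tsum_mul_left, ENNReal.tsum_eq_iSup_nat]
    refine iSup_le fun T => le_trans ?_ (h T)
    gcongr with t _
    exact hr (Nat.zero_le t)
  rwa [htop, ENNReal.mul_top hr0] at h1

/-- The stationary probability of avoiding level `0` up to time `m`. -/
theorem mul_ev_taboo_le {Q : Matrix (ℕ × Fin d) (ℕ × Fin d) ℝ} (hQ : IsStochastic Q)
    {π : ℕ × Fin d → ℝ} (hπ : IsStationary Q π) {v : ℕ × Fin d → ℝ≥0∞} {r : ℕ → ℝ≥0∞}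
    (hr : Monotone r) (hrt : ∀ t, r t ≠ ⊤)
    (h : ∀ T x, ∑ t ∈ Finset.range T, r t * taboo Q t x ≤ v x)
    {D : ℝ≥0∞} (hD : ∀ i, op Q v (0, i) ≤ D)
    (hlim : ∀ x, Tendsto (fun m => taboo Q m x) atTop (𝓝 0)) (m : ℕ) :
    r m * ev π (taboo Q m) ≤ D := by
  -- `z t` records a visit to level 0 followed by avoidance at the next `t + 1` times. Stationarity
  -- writes the avoidance probability as such visits plus avoidance for one step longer, and this
  -- telescopes.
  set z : ℕ → ℕ × Fin d → ℝ≥0∞ := fun t x => if x.1 = 0 then op Q (taboo Q t) x else 0 with hz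
  have step : ∀ t, ev π (taboo Q t) = ev π (z t) + ev π (taboo Q (t + 1)) := by
    intro t
    rw [← hπ.ev_op hQ (taboo Q t), ← ev_add]
    congr 1
    ext x
    simp only [hz, taboo]
    split_ifs <;> simp
  have tele : ∀ n, ev π (taboo Q m)
      = ∑ t ∈ Finset.range n, ev π (z (m + t)) + ev π (taboo Q (m + n)) := by
    intro n
    induction n with
    | zero => simp
    | succ n ih => rw [ih, Finset.sum_range_succ, step (m + n), add_assoc, add_assoc]
  have hsum : ∀ n, r m * ∑ t ∈ Finset.range n, ev π (z (m + t)) ≤ D := by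
    intro n
    rw [← ev_finset_sum, ← ev_const_mul]
    refine ev_le_const hπ.isProb fun x => ?_
    obtain ⟨k, i⟩ := x
    rcases eq_or_ne k 0 with rfl | hk
    · refine le_trans ?_ (hD i)
      simp only [hz, if_true, op, ← ev_finset_sum, ← ev_const_mul]
      refine ev_mono _ fun y => le_trans ?_ (h (m + n) y)
      -- Since `r` is monotone, `r m` may be replaced by `r (m + t)`; restoring the first `m` terms
      -- then gives the full weighted sum, which is bounded by `v`.
      rw [Finset.mul_sum, Finset.sum_range_add]
      refine le_trans ?_ le_add_self
      gcongr with t _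
      exact hr (Nat.le_add_right m t)
    · simp [hz, hk]
  have hlim' : Tendsto (fun n => D + r m * ev π (taboo Q (m + n))) atTop (𝓝 (D + r m * 0)) := by
    refine (ENNReal.Tendsto.const_mul ?_ (Or.inr (hrt m))).const_add D
    have := tendsto_ev_zero hπ.isProb (taboo_le_one hQ) hlim
    exact this.comp (tendsto_atTop_mono (fun n => Nat.le_add_left n m) tendsto_id)
  rw [mul_zero, add_zero] at hlim'
  refine ge_of_tendsto' hlim' fun n => ?_
  conv_lhs => rw [tele n, mul_add]
  gcongr
  exact hsum n

end LevelOrder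

/-! ### Concave rates: the function `H`, its inverse, and the Lyapunov functions for subgeometric
drift. -/

section Rate

/-- A positive, nondecreasing and concave function on `[1, ∞)`. -/
structure IsConcaveRate (φ : ℝ → ℝ) : Prop where
  pos : ∀ t, 1 ≤ t → 0 < φ t
  mono : MonotoneOn φ (Ici 1)
  conc : ConcaveOn ℝ (Ici 1) φ

/-- The inverse of `rateH φ`. -/
def rateG (φ : ℝ → ℝ) (x : ℝ) : ℝ := Function.invFunOn (rateH φ) (Ici 1) x

namespace IsConcaveRate

variable {φ : ℝ → ℝ} (hφ : IsConcaveRate φ)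
include hφ

/-- Chord slopes of a concave function decrease when both endpoints move right. The chord from `x₁`
to `y₂` mediates, so the two intervals may overlap. -/
theorem slope_le {x₁ y₁ x₂ y₂ : ℝ} (h1 : 1 ≤ x₁) (hx : x₁ ≤ x₂) (hy : y₁ ≤ y₂) (h₁ : x₁ < y₁)
    (h₂ : x₂ < y₂) : (φ y₂ - φ x₂) / (y₂ - x₂) ≤ (φ y₁ - φ x₁) / (y₁ - x₁) := by
  have m1 : x₁ ∈ Ici (1 : ℝ) := h1
  have m2 : x₂ ∈ Ici (1 : ℝ) := h1.trans hx
  have m3 : y₁ ∈ Ici (1 : ℝ) := h1.trans h₁.le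
  have m4 : y₂ ∈ Ici (1 : ℝ) := h1.trans (h₁.le.trans hy)
  have e1 := hφ.conc.neg.secant_mono m1 m3 m4 h₁.ne' (h₁.trans_le hy).ne' hy
  have e2 := hφ.conc.neg.secant_mono m4 m1 m2 (h₁.trans_le hy).ne h₂.ne hx
  simp only [Pi.neg_apply] at e1 e2
  have e3 : (-φ x₁ - -φ y₂) / (x₁ - y₂) = (-φ y₂ - -φ x₁) / (y₂ - x₁) := by
    rw [← neg_div_neg_eq, neg_sub, neg_sub]
  have e4 : (-φ x₂ - -φ y₂) / (x₂ - y₂) = -((φ y₂ - φ x₂) / (y₂ - x₂)) := by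
    rw [← neg_div_neg_eq, neg_sub, neg_sub, ← neg_div]; ring
  have e5 : (-φ y₁ - -φ x₁) / (y₁ - x₁) = -((φ y₁ - φ x₁) / (y₁ - x₁)) := by
    rw [← neg_div]; ring
  linarith

theorem antitoneOn_inv : AntitoneOn (fun y => 1 / φ y) (Ici 1) := fun _ ha _ hb hab =>
  one_div_le_one_div_of_le (hφ.pos _ ha) (hφ.mono ha hb hab)

theorem intervalIntegrable {a b : ℝ} (ha : 1 ≤ a) (hb : 1 ≤ b) :
    IntervalIntegrable (fun y => 1 / φ y) MeasureTheory.volume a b :=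
  (hφ.antitoneOn_inv.mono fun _ hx => (le_inf ha hb).trans hx.1).intervalIntegrable

theorem rateH_sub {a b : ℝ} (ha : 1 ≤ a) (hb : 1 ≤ b) :
    rateH φ b - rateH φ a = ∫ y in a..b, 1 / φ y :=
  intervalIntegral.integral_interval_sub_left (hφ.intervalIntegrable le_rfl hb)
    (hφ.intervalIntegrable le_rfl ha)

theorem rateH_sub_le {a b : ℝ} (ha : 1 ≤ a) (hab : a ≤ b) :
    rateH φ b - rateH φ a ≤ (b - a) / φ a := by
  rw [hφ.rateH_sub ha (ha.trans hab)]
  refine (intervalIntegral.integral_mono_on hab (hφ.intervalIntegrable ha (ha.trans hab))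
    intervalIntegrable_const fun x hx => hφ.antitoneOn_inv ha (ha.trans hx.1) hx.1).trans_eq ?_
  simp [div_eq_mul_inv]

theorem le_rateH_sub {a b : ℝ} (ha : 1 ≤ a) (hab : a ≤ b) :
    (b - a) / φ b ≤ rateH φ b - rateH φ a := by
  rw [hφ.rateH_sub ha (ha.trans hab)]
  refine le_trans (le_of_eq ?_) (intervalIntegral.integral_mono_on hab intervalIntegrable_const
    (hφ.intervalIntegrable ha (ha.trans hab)) fun x hx =>
      hφ.antitoneOn_inv (ha.trans hx.1) (ha.trans hab) hx.2)
  simp [div_eq_mul_inv]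

theorem strictMonoOn_rateH : StrictMonoOn (rateH φ) (Ici 1) := fun a ha b hb hab => by
  have := hφ.le_rateH_sub ha hab.le
  have h2 : 0 < (b - a) / φ b := div_pos (sub_pos.2 hab) (hφ.pos b hb)
  linarith

theorem continuousOn_rateH : ContinuousOn (rateH φ) (Ici 1) := by
  have h : LipschitzOnWith (Real.toNNReal (1 / φ 1)) (rateH φ) (Ici 1) := by
    refine LipschitzOnWith.of_le_add_mul _ fun x hx y hy => ?_
    rw [Real.coe_toNNReal _ (one_div_pos.2 (hφ.pos 1 le_rfl)).le]
    rcases le_total x y with hxy | hxy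
    · have := hφ.strictMonoOn_rateH.monotoneOn hx hy hxy
      have h3 : 0 ≤ 1 / φ 1 * dist x y :=
        mul_nonneg (one_div_pos.2 (hφ.pos 1 le_rfl)).le dist_nonneg
      linarith
    · have h1 := hφ.rateH_sub_le hy hxy
      have h2 : (x - y) / φ y ≤ 1 / φ 1 * dist x y := by
        rw [Real.dist_eq, abs_of_nonneg (sub_nonneg.2 hxy), div_eq_mul_one_div, mul_comm]
        exact mul_le_mul_of_nonneg_right (hφ.antitoneOn_inv self_mem_Ici hy hy)
          (sub_nonneg.2 hxy)
      linarith
  exact h.continuousOn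

/-- Concavity allows at most linear growth; this makes `H` unbounded, so that its inverse is defined
on all of `[0, ∞)`. -/
theorem le_linear {y : ℝ} (hy : 2 ≤ y) : φ y ≤ y * φ 2 := by
  have h := hφ.slope_le (x₁ := 1) (y₁ := 2) (x₂ := 1) (y₂ := y) le_rfl le_rfl hy (by norm_num)
    (by linarith)
  rw [div_le_iff₀ (by linarith)] at h
  have h1 := hφ.pos 1 le_rfl
  have h2 := hφ.mono (a := 1) (b := 2) (by simp) (by simp) (by norm_num)
  nlinarith

omit hφ in
theorem rateH_one : rateH φ 1 = 0 := by simp [rateH]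

/-- Each doubling of the argument adds at least `1 / (2 φ 2)` to `H`, by the linear bound on `φ`. -/
theorem le_rateH_pow (n : ℕ) : n / (2 * φ 2) ≤ rateH φ (2 ^ n) := by
  have hp := hφ.pos 2 (by norm_num)
  induction n with
  | zero => simp [rateH_one]
  | succ n ih =>
    have h1 : (1 : ℝ) ≤ 2 ^ n := one_le_pow₀ (by norm_num)
    have h2 : (2 : ℝ) ^ (n + 1) = 2 * 2 ^ n := by ring
    have h3 := hφ.le_rateH_sub (a := 2 ^ n) (b := 2 ^ (n + 1)) h1 (by linarith)
    have h4 := hφ.le_linear (y := 2 ^ (n + 1)) (by linarith)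
    have h5 : 1 / (2 * φ 2) ≤ (2 ^ (n + 1) - 2 ^ n) / φ (2 ^ (n + 1)) := by
      rw [div_le_div_iff₀ (by positivity) (hφ.pos _ (by linarith))]
      nlinarith
    push_cast
    rw [add_div]
    linarith

theorem exists_rateH_eq {t : ℝ} (ht : 0 ≤ t) : ∃ y ∈ Ici (1 : ℝ), rateH φ y = t := by
  have hp := hφ.pos 2 (by norm_num)
  obtain ⟨n, hn⟩ := exists_nat_ge (t * (2 * φ 2))
  have h1 : (1 : ℝ) ≤ 2 ^ n := one_le_pow₀ (by norm_num)
  have h2 : t ≤ rateH φ (2 ^ n) :=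
    ((le_div_iff₀ (by positivity)).2 hn).trans (hφ.le_rateH_pow n)
  obtain ⟨y, hy, hyt⟩ := intermediate_value_Icc h1
    (hφ.continuousOn_rateH.mono Icc_subset_Ici_self) ⟨rateH_one.trans_le ht, h2⟩
  exact ⟨y, hy.1, hyt⟩

theorem one_le_rateG {t : ℝ} (ht : 0 ≤ t) : 1 ≤ rateG φ t :=
  Function.invFunOn_mem (hφ.exists_rateH_eq ht)

theorem rateH_rateG {t : ℝ} (ht : 0 ≤ t) : rateH φ (rateG φ t) = t :=
  Function.invFunOn_eq (hφ.exists_rateH_eq ht)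

theorem rateH_nonneg {y : ℝ} (hy : 1 ≤ y) : 0 ≤ rateH φ y :=
  rateH_one ▸ hφ.strictMonoOn_rateH.monotoneOn self_mem_Ici hy hy

theorem rateG_rateH {y : ℝ} (hy : 1 ≤ y) : rateG φ (rateH φ y) = y :=
  hφ.strictMonoOn_rateH.injOn (hφ.one_le_rateG (hφ.rateH_nonneg hy)) hy
    (hφ.rateH_rateG (hφ.rateH_nonneg hy))

theorem rateG_le_iff {t y : ℝ} (ht : 0 ≤ t) (hy : 1 ≤ y) : rateG φ t ≤ y ↔ t ≤ rateH φ y := by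
  rw [← hφ.strictMonoOn_rateH.le_iff_le (hφ.one_le_rateG ht) hy, hφ.rateH_rateG ht]

theorem rateG_mono {t u : ℝ} (ht : 0 ≤ t) (htu : t ≤ u) : rateG φ t ≤ rateG φ u := by
  rw [hφ.rateG_le_iff ht (hφ.one_le_rateG (ht.trans htu)), hφ.rateH_rateG (ht.trans htu)]
  exact htu

theorem rateG_add_sub_le {u c : ℝ} (hu : 0 ≤ u) (hc : 0 ≤ c) :
    rateG φ (u + c) - rateG φ u ≤ c * φ (rateG φ (u + c)) := by
  have h := hφ.le_rateH_sub (hφ.one_le_rateG hu) (hφ.rateG_mono hu (le_add_of_nonneg_right hc))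
  rw [hφ.rateH_rateG hu, hφ.rateH_rateG (add_nonneg hu hc), add_sub_cancel_left,
    div_le_iff₀ (hφ.pos _ (hφ.one_le_rateG (add_nonneg hu hc)))] at h
  exact h

theorem le_rateG_add_sub {u c : ℝ} (hu : 0 ≤ u) (hc : 0 ≤ c) :
    c * φ (rateG φ u) ≤ rateG φ (u + c) - rateG φ u := by
  have h := hφ.rateH_sub_le (hφ.one_le_rateG hu) (hφ.rateG_mono hu (le_add_of_nonneg_right hc))
  rw [hφ.rateH_rateG hu, hφ.rateH_rateG (add_nonneg hu hc), add_sub_cancel_left,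
    le_div_iff₀ (hφ.pos _ (hφ.one_le_rateG hu))] at h
  exact h

/-- `y ↦ H⁻¹(H(y) + a)` lies below its tangent at `v` wherever the tangent stays above the
diagonal. -/
theorem rateG_add_le_tangent_aux {v y a : ℝ} (hv : 1 ≤ v) (hy : 1 ≤ y) (ha : 0 ≤ a)
    (hdiag : y ≤ rateG φ (rateH φ v + a) + φ (rateG φ (rateH φ v + a)) / φ v * (y - v)) :
    rateG φ (rateH φ y + a)
      ≤ rateG φ (rateH φ v + a) + φ (rateG φ (rateH φ v + a)) / φ v * (y - v) := by
  set w := rateG φ (rateH φ v + a) with hw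
  set s := φ w / φ v with hs
  have hva := add_nonneg (hφ.rateH_nonneg hv) ha
  have hvw : v ≤ w := by
    rw [← hφ.rateG_rateH hv]
    exact hφ.rateG_mono (hφ.rateH_nonneg hv) (le_add_of_nonneg_right ha)
  have hφv := hφ.pos v hv
  have hs1 : 1 ≤ s := by
    rw [hs, le_div_iff₀ hφv, one_mul]
    exact hφ.mono hv (hv.trans hvw) hvw
  have hsv : s * φ v = φ w := by rw [hs]; field_simp
  -- `ℓ` is the candidate tangent at `v`, with slope `φ(w)/φ(v)`. The claim becomes `H(y) + a ≤
  -- H(ℓ(y))`; the substitution `z ↦ ℓ(z)` reduces it to comparing `1/φ(z)` with `s/φ(ℓ(z))`, so `φ`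
  -- need not be differentiable.
  set ℓ : ℝ → ℝ := fun z => s * z + (w - s * v) with hℓ
  have hℓv : ℓ v = w := by simp [hℓ]
  have hℓy : w + s * (y - v) = ℓ y := by simp only [hℓ]; ring
  rw [hℓy] at hdiag ⊢
  rw [hφ.rateG_le_iff (add_nonneg (hφ.rateH_nonneg hy) ha) (hy.trans hdiag)]
  have hHw : rateH φ w = rateH φ v + a := hφ.rateH_rateG hva
  have hsub : rateH φ (ℓ y) - rateH φ w = ∫ z in v..y, s * (1 / φ (ℓ z)) := by
    rw [hφ.rateH_sub (hv.trans hvw) (hy.trans hdiag), ← hℓv, intervalIntegral.integral_const_mul]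
    exact (intervalIntegral.smul_integral_comp_mul_add (fun z => 1 / φ z) s (w - s * v)).symm
  have hsub' := hφ.rateH_sub hv hy
  have hint : IntervalIntegrable (fun z => s * (1 / φ (ℓ z))) MeasureTheory.volume v y := by
    have hmem : ∀ z ∈ uIcc v y, 1 ≤ ℓ z := by
      intro z hz
      rcases le_total v y with h | h
      · rw [uIcc_of_le h] at hz
        have : 0 ≤ s * (z - v) := mul_nonneg (by linarith) (by linarith [hz.1])
        simp only [hℓ]; linarith
      · rw [uIcc_of_ge h] at hz
        have : 0 ≤ s * (z - y) := mul_nonneg (by linarith) (by linarith [hz.1])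
        simp only [hℓ] at hdiag ⊢; linarith
    refine AntitoneOn.intervalIntegrable fun x hx z hz hxz => ?_
    refine mul_le_mul_of_nonneg_left ?_ (by linarith)
    refine hφ.antitoneOn_inv (hmem x hx) (hmem z hz) ?_
    simp only [hℓ]
    nlinarith
  rcases le_total v y with h | h
  · have : ∫ z in v..y, 1 / φ z ≤ ∫ z in v..y, s * (1 / φ (ℓ z)) := by
      refine intervalIntegral.integral_mono_on h (hφ.intervalIntegrable hv hy) hint fun z hz => ?_
      have hz1 : 1 ≤ z := hv.trans hz.1
      have h0 : 0 ≤ s * (z - v) := mul_nonneg (by linarith) (by linarith [hz.1])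
      have hℓz : 1 ≤ ℓ z := by simp only [hℓ]; linarith
      rw [mul_one_div, div_le_div_iff₀ (hφ.pos z hz1) (hφ.pos _ hℓz), one_mul]
      rcases eq_or_lt_of_le hz.1 with rfl | hlt
      · rw [hℓv, hsv]
      · have hzz : z ≤ ℓ z := by simp only [hℓ]; nlinarith
        -- The interval from `w` to `ℓ z` lies to the right of the one from `v` to `z` and is `s`
        -- times as long. Concavity and `φ(w) = s φ(v)` therefore give `φ(ℓ z) ≤ s φ(z)`.
        have h1 := hφ.slope_le hv hvw hzz hlt (y₂ := ℓ z) (by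
          have : 0 < s * (z - v) := mul_pos (by linarith) (by linarith)
          simp only [hℓ]; linarith)
        rw [show ℓ z - w = s * (z - v) by simp only [hℓ]; ring,
          div_le_div_iff₀ (mul_pos (by linarith) (by linarith)) (by linarith)] at h1
        have h2 : φ (ℓ z) - φ w ≤ s * (φ z - φ v) := by
          have hzv : 0 < z - v := by linarith
          refine le_of_mul_le_mul_right ?_ hzv
          calc _ ≤ _ := h1
            _ = _ := by ring
        linarith
    linarith
  · have : ∫ z in y..v, s * (1 / φ (ℓ z)) ≤ ∫ z in y..v, 1 / φ z := by
      refine intervalIntegral.integral_mono_on h hint.symm (hφ.intervalIntegrable hy hv)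
        fun z hz => ?_
      have hz1 : 1 ≤ z := hy.trans hz.1
      have hzz : z ≤ ℓ z := by
        have : 0 ≤ (s - 1) * (z - y) := mul_nonneg (by linarith) (by linarith [hz.1])
        simp only [hℓ] at hdiag ⊢; linarith
      rw [mul_one_div, div_le_div_iff₀ (hφ.pos _ (hz1.trans hzz)) (hφ.pos z hz1), one_mul]
      rcases eq_or_lt_of_le hz.2 with rfl | hlt
      · rw [hℓv, hsv]
      · have h1 := hφ.slope_le hz1 hzz hvw hlt (y₂ := w) (by
          have : 0 < s * (v - z) := mul_pos (by linarith) (by linarith)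
          simp only [hℓ]; linarith)
        rw [show w - ℓ z = s * (v - z) by simp only [hℓ]; ring,
          div_le_div_iff₀ (mul_pos (by linarith) (by linarith)) (by linarith)] at h1
        have h2 : φ w - φ (ℓ z) ≤ s * (φ v - φ z) := by
          have hzv : 0 < v - z := by linarith
          refine le_of_mul_le_mul_right ?_ hzv
          calc _ ≤ _ := h1
            _ = _ := by ring
        linarith
    rw [intervalIntegral.integral_symm] at hsub hsub'
    linarith

/-- The side condition of the auxiliary lemma always holds. If the tangent fell below the diagonal
at `y`, it would meet it at some `z`, and there the auxiliary lemma would give `H⁻¹(H(z) + a) ≤ z`,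
impossible for `a > 0`. -/
theorem rateG_add_le_tangent {v y a : ℝ} (hv : 1 ≤ v) (hy : 1 ≤ y) (ha : 0 ≤ a) :
    rateG φ (rateH φ y + a)
      ≤ rateG φ (rateH φ v + a) + φ (rateG φ (rateH φ v + a)) / φ v * (y - v) := by
  rcases eq_or_lt_of_le ha with rfl | ha'
  · simp only [add_zero, hφ.rateG_rateH hv, hφ.rateG_rateH hy, div_self (hφ.pos v hv).ne']
    linarith
  set w := rateG φ (rateH φ v + a) with hw
  set s := φ w / φ v with hs
  by_cases hdiag : y ≤ w + s * (y - v)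
  · exact hφ.rateG_add_le_tangent_aux hv hy ha hdiag
  exfalso
  push Not at hdiag
  have hvw : v ≤ w := by
    rw [← hφ.rateG_rateH hv]
    exact hφ.rateG_mono (hφ.rateH_nonneg hv) (le_add_of_nonneg_right ha)
  have hs1 : 1 ≤ s := by
    rw [hs, le_div_iff₀ (hφ.pos v hv), one_mul]
    exact hφ.mono hv (hv.trans hvw) hvw
  have hyv : y ≤ v := by
    by_contra hlt
    push Not at hlt
    nlinarith
  obtain ⟨z, hz, hz0⟩ := intermediate_value_Icc hyv
    (f := fun z => w + s * (z - v) - z) (by fun_prop)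
    (show (0 : ℝ) ∈ Icc _ _ from ⟨by linarith, by simp [hvw]⟩)
  have hz1 : 1 ≤ z := hy.trans hz.1
  have h1 := hφ.rateG_add_le_tangent_aux hv hz1 ha (by simp only at hz0; linarith)
  have h2 : rateG φ (rateH φ z + a) ≤ z := h1.trans (by simp only at hz0; linarith)
  rw [hφ.rateG_le_iff (add_nonneg (hφ.rateH_nonneg hz1) ha) hz1] at h2
  linarith

/-- By concavity, shifting by `B` raises `φ` at `y` by no more than at 1; the rest is `(φ(y) - φ(1))
(φ(B+1) - φ(1)) ≥ 0`. This is the source of the constant in `rateC`. -/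
theorem shift_le {B y : ℝ} (hB : 0 ≤ B) (hy : 1 ≤ y) : φ 1 / φ (B + 1) * φ (y + B) ≤ φ y := by
  have hB1 := hφ.pos (B + 1) (by linarith)
  rcases eq_or_lt_of_le hB with rfl | hB'
  · simp only [zero_add, add_zero]
    rw [div_self (hφ.pos 1 le_rfl).ne', one_mul]
  have h := hφ.slope_le (x₁ := 1) (y₁ := B + 1) (x₂ := y) (y₂ := y + B) le_rfl hy (by linarith)
    (by linarith) (by linarith)
  rw [add_sub_cancel_left, add_sub_cancel_right, div_le_div_iff_of_pos_right hB'] at h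
  have h1 := hφ.pos 1 le_rfl
  have h2 := hφ.mono (a := 1) (b := y) self_mem_Ici hy hy
  have h3 := hφ.mono (a := 1) (b := B + 1) self_mem_Ici (by simp [hB]) (by linarith)
  rw [div_mul_eq_mul_div, div_le_iff₀ hB1]
  nlinarith

omit hφ in
theorem rateR_eq {x : ℝ} (hx : 0 ≤ x) : rateR φ x = φ (rateG φ x) := by
  rw [rateR, if_neg (not_lt.2 hx)]; rfl

theorem rateR_pos {x : ℝ} (hx : 0 ≤ x) : 0 < rateR φ x := by
  rw [rateR_eq hx]; exact hφ.pos _ (hφ.one_le_rateG hx)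

theorem rateR_mono {x y : ℝ} (hx : 0 ≤ x) (hxy : x ≤ y) : rateR φ x ≤ rateR φ y := by
  rw [rateR_eq hx, rateR_eq (hx.trans hxy)]
  exact hφ.mono (hφ.one_le_rateG hx) (hφ.one_le_rateG (hx.trans hxy)) (hφ.rateG_mono hx hxy)

/-- The time-dependent Lyapunov functions built from a subgeometric drift condition. -/
theorem op_rate_add_le {S : Type*} {Q : Matrix S S ℝ} (hQ : IsStochastic Q) {v : S → ℝ}
    (hv : ∀ x, 1 ≤ v x) {c : ℝ} (hc : 0 ≤ c) {x : S}
    (hx : op Q (fun y => ENNReal.ofReal (v y)) x + ENNReal.ofReal (c * φ (v x))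
      ≤ ENNReal.ofReal (v x)) (t : ℕ) :
    op Q (fun y => ENNReal.ofReal
        (rateG φ (rateH φ (v y) + c * (t + 1 : ℕ)) - rateG φ (c * (t + 1 : ℕ)))) x
      + ENNReal.ofReal (c * rateR φ (c * t))
      ≤ ENNReal.ofReal (rateG φ (rateH φ (v x) + c * t) - rateG φ (c * t)) := by
  set a : ℝ := c * (t + 1 : ℕ) with ha
  have hct : 0 ≤ c * t := by positivity
  have ha0 : 0 ≤ a := by positivity
  have hHx := hφ.rateH_nonneg (hv x)
  set w := rateG φ (rateH φ (v x) + a) with hw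
  have hw1 : 1 ≤ w := hφ.one_le_rateG (by positivity)
  set s := φ w / φ (v x) with hs
  have hs0 : 0 < s := div_pos (hφ.pos w hw1) (hφ.pos _ (hv x))
  have hsv : s * (c * φ (v x)) = c * φ w := by
    have := (hφ.pos _ (hv x)).ne'
    rw [hs]; field_simp
  have hge : ∀ y, ∀ u : ℝ, 0 ≤ u → rateG φ u ≤ rateG φ (rateH φ (v y) + u) := fun y u hu =>
    hφ.rateG_mono hu (le_add_of_nonneg_left (hφ.rateH_nonneg (hv y)))
  set F : S → ℝ≥0∞ := fun y => ENNReal.ofReal (rateG φ (rateH φ (v y) + a) - rateG φ a) with hF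
  -- Jensen's inequality via the tangent at `v x`. The term `s * v x` is added on both sides because
  -- subtraction in `[0, ∞]` is truncated.
  have h1 : op Q F x + ENNReal.ofReal (s * v x)
      ≤ ENNReal.ofReal (w - rateG φ a)
        + ENNReal.ofReal s * op Q (fun y => ENNReal.ofReal (v y)) x := by
    rw [← congrFun (op_const hQ (ENNReal.ofReal (s * v x))) x,
      ← congrFun (op_const hQ (ENNReal.ofReal (w - rateG φ a))) x]
    simp only [op, ← ev_const_mul, ← ev_add]
    refine ev_mono _ fun y => ?_
    have hvx := hv x
    have hvy := hv y
    have e1 := hge y a ha0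
    have e2 := hge x a ha0
    rw [hF, ← ENNReal.ofReal_mul hs0.le, ← ENNReal.ofReal_add (by linarith) (by positivity),
      ← ENNReal.ofReal_add (by linarith) (by positivity)]
    refine ENNReal.ofReal_le_ofReal ?_
    have := hφ.rateG_add_le_tangent (hv x) (hv y) ha0
    rw [← hw, ← hs] at this
    linarith
  have h2 : op Q F x + ENNReal.ofReal (c * φ w) ≤ ENNReal.ofReal (w - rateG φ a) := by
    have hne : ENNReal.ofReal (s * v x) ≠ ⊤ := ENNReal.ofReal_ne_top
    rw [← ENNReal.add_le_add_iff_right hne]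
    calc _ = (op Q F x + ENNReal.ofReal (s * v x)) + ENNReal.ofReal (c * φ w) := by
          rw [add_right_comm]
      _ ≤ (ENNReal.ofReal (w - rateG φ a)
          + ENNReal.ofReal s * op Q (fun y => ENNReal.ofReal (v y)) x)
          + ENNReal.ofReal (s * (c * φ (v x))) := by rw [hsv]; gcongr
      _ = ENNReal.ofReal (w - rateG φ a) + ENNReal.ofReal s *
          (op Q (fun y => ENNReal.ofReal (v y)) x + ENNReal.ofReal (c * φ (v x))) := by
          rw [ENNReal.ofReal_mul hs0.le, mul_add, add_assoc]
      _ ≤ _ := by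
          rw [ENNReal.ofReal_mul hs0.le]
          gcongr
  have hne : ENNReal.ofReal (c * φ w) ≠ ⊤ := ENNReal.ofReal_ne_top
  rw [← ENNReal.add_le_add_iff_right hne]
  have hwa := hge x a ha0
  have hwt := hge x _ hct
  have hw0 : 0 ≤ c * φ w := mul_nonneg hc (hφ.pos w hw1).le
  have hr0 : 0 ≤ c * rateR φ (c * t) := mul_nonneg hc (hφ.rateR_pos hct).le
  calc _ = (op Q F x + ENNReal.ofReal (c * φ w)) + ENNReal.ofReal (c * rateR φ (c * t)) := by
        rw [add_right_comm]
    _ ≤ ENNReal.ofReal (w - rateG φ a) + ENNReal.ofReal (c * rateR φ (c * t)) := by gcongr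
    _ ≤ _ := by
        rw [← ENNReal.ofReal_add (by linarith) hr0, ← ENNReal.ofReal_add (by linarith) hw0]
        refine ENNReal.ofReal_le_ofReal ?_
        -- Over a time increment `c`, `H⁻¹` grows by at most `c φ` at the later point and at least
        -- `c φ` at the earlier one. The first bound uses up the drift gain `c φ(w)`; the second
        -- leaves `c r(ct)`.
        have e1 := hφ.rateG_add_sub_le (u := rateH φ (v x) + c * t) (by positivity) hc
        have e2 := hφ.le_rateG_add_sub hct hc
        have e3 : c * t + c = a := by rw [ha]; push_cast; ring
        rw [add_assoc, e3, ← hw] at e1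
        rw [e3] at e2
        rw [rateR_eq hct]
        linarith

end IsConcaveRate

end Rate

/-! ### Calculus of `V`, and concavity of `κ V' ∘ V⁻¹`. -/

namespace HeavyTail

variable {d : ℕ} {A C : ℤ → Matrix (Fin d) (Fin d) ℝ} {α : ℝ} {V V' V'' : ℝ → ℝ}
  (hV : HeavyTail A C α V V' V'')
include hV

theorem tangent_le {x y : ℝ} (hx : 0 ≤ x) (hy : 0 < y) : V y + V' y * (x - y) ≤ V x := by
  rcases lt_trichotomy x y with h | rfl | h
  · have := hV.convex.slope_le_of_hasDerivAt (mem_Ici.2 hx) (mem_Ici.2 hy.le) h (hV.deriv_one y hy)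
    rw [slope_def_field, div_le_iff₀ (by linarith)] at this
    linarith
  · simp
  · have := hV.convex.le_slope_of_hasDerivAt (mem_Ici.2 hy.le) (mem_Ici.2 hx) h (hV.deriv_one y hy)
    rw [slope_def_field, le_div_iff₀ (by linarith)] at this
    linarith

theorem deriv_monotoneOn : MonotoneOn V' (Ici 0) := by
  have h1 : ∀ x y, 0 < x → x ≤ y → V' x ≤ V' y := by
    intro x y hx hxy
    rcases eq_or_lt_of_le hxy with rfl | hlt
    · exact le_rfl
    · have e1 := hV.tangent_le hx.le (hx.trans hlt)
      have e2 := hV.tangent_le (hx.trans hlt).le hx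
      nlinarith
  intro x hx y hy hxy
  rcases eq_or_lt_of_le (mem_Ici.1 hx) with rfl | hx0
  · rcases eq_or_lt_of_le hxy with rfl | hy0
    · exact le_rfl
    · refine le_of_tendsto hV.deriv_zero ?_
      filter_upwards [Ioo_mem_nhdsGT hy0] with z hz using h1 z y hz.1 hz.2.le
  · exact h1 x y hx0 hxy

theorem deriv_pos {x : ℝ} (hx : 0 ≤ x) : 0 < V' x :=
  hV.deriv_zero_pos.trans_le (hV.deriv_monotoneOn self_mem_Ici hx hx)

theorem tendsto_right_zero : Tendsto V (𝓝[>] 0) (𝓝 (V 0)) := by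
  have h1 : Tendsto (fun x : ℝ => (1 - x) * V 0 + x * V 1) (𝓝[>] 0) (𝓝 ((1 - 0) * V 0 + 0 * V 1)) := by
    refine Tendsto.mono_left (Continuous.tendsto ?_ 0) nhdsWithin_le_nhds
    fun_prop
  simp only [sub_zero, one_mul, zero_mul, add_zero] at h1
  refine tendsto_of_tendsto_of_tendsto_of_le_of_le' tendsto_const_nhds h1 ?_ ?_
  · filter_upwards [self_mem_nhdsWithin] with x hx
    exact (hV.increasing self_mem_Ici (mem_Ici.2 (le_of_lt hx)) hx).le
  · filter_upwards [Ioo_mem_nhdsGT (zero_lt_one' ℝ)] with x hx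
    have := hV.convex.2 (self_mem_Ici (a := (0 : ℝ))) (mem_Ici.2 zero_le_one)
      (by linarith [hx.2] : (0 : ℝ) ≤ 1 - x) hx.1.le (by ring)
    simpa using this

theorem tendsto_right {x : ℝ} (hx : 0 ≤ x) :
    Tendsto V (𝓝[>] x) (𝓝 (V x)) ∧ Tendsto V' (𝓝[>] x) (𝓝 (V' x)) := by
  rcases eq_or_lt_of_le hx with rfl | hx0
  · exact ⟨hV.tendsto_right_zero, hV.deriv_zero⟩
  · exact ⟨(hV.deriv_one x hx0).continuousAt.tendsto.mono_left nhdsWithin_le_nhds,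
      (hV.deriv_two x hx0).continuousAt.tendsto.mono_left nhdsWithin_le_nhds⟩

theorem continuousOn : ContinuousOn V (Ici 0) := by
  intro x hx
  rcases eq_or_lt_of_le (mem_Ici.1 hx) with rfl | hx0
  · rw [← continuousWithinAt_Ioi_iff_Ici]
    exact hV.tendsto_right_zero
  · exact (hV.deriv_one x hx0).continuousAt.continuousWithinAt

theorem exists_eq {t : ℝ} (ht : V 0 ≤ t) : ∃ x, 0 ≤ x ∧ V x = t := by
  have hp := hV.deriv_pos zero_le_one
  -- At this `y` the tangent at 1 has already passed the height `t`, and `V` lies above it.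
  set y := max 1 ((t - V 1) / V' 1 + 1) with hy
  have hy0 : 0 ≤ y := zero_le_one.trans (le_max_left _ _)
  have h1 := hV.tangent_le hy0 zero_lt_one
  have h2 : t - V 1 ≤ V' 1 * (y - 1) := by
    have : (t - V 1) / V' 1 ≤ y - 1 := by linarith [le_max_right 1 ((t - V 1) / V' 1 + 1)]
    rwa [div_le_iff₀' hp] at this
  obtain ⟨x, hx, hxt⟩ := intermediate_value_Icc hy0 (hV.continuousOn.mono Icc_subset_Ici_self)
    ⟨ht, by linarith⟩
  exact ⟨x, hx.1, hxt⟩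

/-- Cauchy's mean value theorem for `V'` against `V`. The version with one-sided limits is needed
because at 0 only right limits are available. -/
theorem exists_slope_eq {x y : ℝ} (hx : 0 ≤ x) (hxy : x < y) :
    ∃ c ∈ Ioo x y, (V' y - V' x) / (V y - V x) = V'' c / V' c := by
  obtain ⟨c, hc, h⟩ := exists_ratio_hasDerivAt_eq_ratio_slope' V' V'' hxy V V'
    (fun z hz => hV.deriv_two z (hx.trans_lt hz.1)) (fun z hz => hV.deriv_one z (hx.trans_lt hz.1))
    (hV.tendsto_right hx).2 (hV.tendsto_right hx).1
    ((hV.deriv_two y (hx.trans_lt hxy)).continuousAt.tendsto.mono_left nhdsWithin_le_nhds)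
    ((hV.deriv_one y (hx.trans_lt hxy)).continuousAt.tendsto.mono_left nhdsWithin_le_nhds)
  refine ⟨c, hc, ?_⟩
  have h1 := hV.increasing (mem_Ici.2 hx) (mem_Ici.2 (hx.trans hxy.le)) hxy
  rw [div_eq_div_iff (by linarith) (hV.deriv_pos (hx.trans hc.1.le)).ne']
  linarith

/-- In the variable `t = V(x)`, chord slopes of `φ` are `κ` times values of `V''/V'` at intermediate
points, and that ratio is nonincreasing. If `V 0 > 1`, the three properties belong to the chosen
extension. -/
theorem isConcaveRate {κ : ℝ} (hκ : 0 < κ) {φ : ℝ → ℝ} (hφ : IsRate κ V V' φ) :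
    IsConcaveRate φ := by
  rcases eq_or_lt_of_le (hV.one_le 0 le_rfl) with h0 | h0
  · have hex : ∀ t : ℝ, 1 ≤ t → ∃ x, 0 ≤ x ∧ V x = t := fun t ht => hV.exists_eq (h0 ▸ ht)
    refine ⟨fun t ht => ?_, fun s hs t ht hst => ?_,
      concaveOn_of_slope_anti_adjacent (convex_Ici 1) fun {s t u} hs hu hst htu => ?_⟩
    · obtain ⟨x, hx, rfl⟩ := hex t ht
      rw [hφ.eq_on_range x hx]
      exact mul_pos hκ (hV.deriv_pos hx)
    · obtain ⟨x, hx, rfl⟩ := hex s hs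
      obtain ⟨y, hy, rfl⟩ := hex t ht
      rw [hφ.eq_on_range x hx, hφ.eq_on_range y hy]
      exact mul_le_mul_of_nonneg_left
        (hV.deriv_monotoneOn hx hy ((hV.increasing.le_iff_le hx hy).1 hst)) hκ.le
    · obtain ⟨x, hx, rfl⟩ := hex s hs
      obtain ⟨y, hy, rfl⟩ := hex t ((mem_Ici.1 hs).trans hst.le)
      obtain ⟨z, hz, rfl⟩ := hex u hu
      have hxy := (hV.increasing.lt_iff_lt hx hy).1 hst
      have hyz := (hV.increasing.lt_iff_lt hy hz).1 htu
      rw [hφ.eq_on_range x hx, hφ.eq_on_range y hy, hφ.eq_on_range z hz, ← mul_sub, ← mul_sub,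
        mul_div_assoc, mul_div_assoc]
      refine mul_le_mul_of_nonneg_left ?_ hκ.le
      obtain ⟨a, ha, ha'⟩ := hV.exists_slope_eq hx hxy
      obtain ⟨b, hb, hb'⟩ := hV.exists_slope_eq hy hyz
      rw [ha', hb']
      exact hV.ratio_antitone (hx.trans_lt ha.1) (hy.trans_lt hb.1) (ha.2.trans hb.1).le
  · exact ⟨(hφ.extension h0).1, (hφ.extension h0).2.1, (hφ.extension h0).2.2⟩

end HeavyTail

/-! ### The capped chain, its phase marginal, and the abstract error bound. -/

section Truncation

variable {d : ℕ}

theorem tailMass_zero (p : ℕ × Fin d → ℝ) (j : Fin d) :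
    tailMass p 0 j = ev p fun x => if x.2 = j then 1 else 0 := by
  rw [ev, tsum_level, Finset.sum_eq_single j]
  · simp [tailMass]
  · intro i _ hi
    simp [hi]
  · simp

theorem lcTrunc_nonneg {P : Matrix (ℕ × Fin d) (ℕ × Fin d) ℝ} (hP : IsStochastic P) (n : ℕ)
    (x y : ℕ × Fin d) : 0 ≤ lcTrunc P n x y := by
  unfold lcTrunc
  split_ifs
  exacts [hP.1 _ _, tsum_nonneg fun _ => hP.1 _ _, le_rfl]

theorem tsum_nat_split (f : ℕ → ℝ≥0∞) (n : ℕ) :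
    ∑' l, f l = ∑ l ∈ Finset.range n, f l + ∑' m, f (m + n) :=
  (ENNReal.summable.sum_add_tsum_nat_add' (k := n)).symm

/-- Collecting all mass from level `n` on in column `n` amounts to moving by `P` and then capping
the level. Stochasticity, monotonicity and domination of the truncation all follow from this
formula. -/
theorem op_lcTrunc {P : Matrix (ℕ × Fin d) (ℕ × Fin d) ℝ} (hP : IsStochastic P) (n : ℕ)
    (f : ℕ × Fin d → ℝ≥0∞) : op (lcTrunc P n) f = op P fun y => f (min y.1 n, y.2) := by
  ext x
  rw [op, op, ev, ev, tsum_level, tsum_level]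
  refine Finset.sum_congr rfl fun j _ => ?_
  refine (tsum_nat_split (fun l => ENNReal.ofReal (lcTrunc P n x (l, j)) * f (l, j)) n).trans
    (Eq.trans ?_
      (tsum_nat_split (fun l => ENNReal.ofReal (P x (l, j)) * f (min l n, j)) n).symm)
  congr 1
  · refine Finset.sum_congr rfl fun l hl => ?_
    have hl' : l < n := Finset.mem_range.1 hl
    simp [lcTrunc, hl', hl'.le]
  · rw [tsum_eq_single 0 (by intro m hm; simp [lcTrunc, hm])]
    have hs : Summable fun m => P x (n + m, j) :=
      (hP.2 x).summable.comp_injective (i := fun m => (n + m, j)) fun a b hab => by simpa using hab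
    have h0 : lcTrunc P n x (0 + n, j) = ∑' m, P x (n + m, j) := by simp [lcTrunc]
    rw [h0, ENNReal.ofReal_tsum_of_nonneg (fun _ => hP.1 _ _) hs, ← ENNReal.tsum_mul_right]
    refine tsum_congr fun m => ?_
    rw [min_eq_right (Nat.le_add_left n m), add_comm n m, zero_add]

theorem isStochastic_lcTrunc {P : Matrix (ℕ × Fin d) (ℕ × Fin d) ℝ} (hP : IsStochastic P) (n : ℕ) :
    IsStochastic (lcTrunc P n) := by
  refine ⟨lcTrunc_nonneg hP n, fun x => (isProb_of_ev_one (lcTrunc_nonneg hP n x) ?_).2⟩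
  exact (congrFun (op_lcTrunc hP n fun _ => 1) x).trans (congrFun (op_const hP 1) x)

theorem lcTrunc_stDom {P : Matrix (ℕ × Fin d) (ℕ × Fin d) ℝ} (hP : IsStochastic P) (n : ℕ)
    (x : ℕ × Fin d) : StDom (lcTrunc P n x) (P x) := fun f hf =>
  (congrFun (op_lcTrunc hP n f) x).trans_le (ev_mono _ fun y => hf y.2 (min_le_left _ _))

theorem KMono.lcTrunc {P : Matrix (ℕ × Fin d) (ℕ × Fin d) ℝ} (hP : IsStochastic P) (hm : KMono P)
    (n : ℕ) : KMono (lcTrunc P n) := by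
  intro f hf
  rw [op_lcTrunc hP]
  exact hm _ fun i a b hab => hf i (min_le_min_right n hab)

/-- Under `P` the phase is a Markov chain with transition matrix `Ψ`. -/
def HasPhase (P : Matrix (ℕ × Fin d) (ℕ × Fin d) ℝ) (Ψ : Matrix (Fin d) (Fin d) ℝ) : Prop :=
  ∀ x j, tailMass (P x) 0 j = ENNReal.ofReal (Ψ x.2 j)

theorem HasPhase.lcTrunc {P : Matrix (ℕ × Fin d) (ℕ × Fin d) ℝ} (hP : IsStochastic P)
    {Ψ : Matrix (Fin d) (Fin d) ℝ} (h : HasPhase P Ψ) (n : ℕ) : HasPhase (lcTrunc P n) Ψ := by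
  intro x j
  rw [← h x j, tailMass_zero, tailMass_zero]
  exact congrFun (op_lcTrunc hP n _) x

/-- The phase is a lumping of the chain, so the phase marginal of a stationary law is stationary for
`Ψ`; irreducibility of `Ψ` will identify the marginals of `π` and `πn`. -/
theorem HasPhase.exists_stationary {P : Matrix (ℕ × Fin d) (ℕ × Fin d) ℝ} (hP : IsStochastic P)
    {Ψ : Matrix (Fin d) (Fin d) ℝ} (hΨ : IsStochastic Ψ) (h : HasPhase P Ψ)
    {π : ℕ × Fin d → ℝ} (hπ : IsStationary P π) :
    ∃ a, IsStationary Ψ a ∧ ∀ i, tailMass π 0 i = ENNReal.ofReal (a i) := by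
  have hle : ∀ i, tailMass π 0 i ≤ 1 := fun i => by
    rw [tailMass_zero]
    exact ev_le_const hπ.isProb fun x => by split_ifs <;> simp
  have hof : ∀ i, ENNReal.ofReal (tailMass π 0 i).toReal = tailMass π 0 i := fun i =>
    ENNReal.ofReal_toReal (ne_top_of_le_ne_top ENNReal.one_ne_top (hle i))
  have hprob : IsProb fun i => (tailMass π 0 i).toReal := by
    refine isProb_of_ev_one (fun _ => ENNReal.toReal_nonneg) ?_
    have h1 := ev_const hπ.isProb 1
    rw [ev, tsum_level] at h1
    simp only [ev, tsum_fintype, hof, mul_one]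
    simpa only [tailMass, zero_add, mul_one] using h1
  refine ⟨_, isStationary_of_push_eq hΨ hprob
    (eq_of_ofReal_eq (isProb_push hprob hΨ).1 hprob.1 fun j => ?_), fun i => (hof i).symm⟩
  rw [ofReal_push hprob hΨ, hof, tailMass_zero π j, ← hπ.ev_op hP, tsum_fintype, ev, tsum_level]
  refine Finset.sum_congr rfl fun i _ => ?_
  rw [hof, tailMass, ← ENNReal.tsum_mul_right]
  refine tsum_congr fun l => ?_
  rw [zero_add, op, ← tailMass_zero, h]

/-- Bound the total variation distance by testing against functions into `[0, 1]`. -/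
theorem tvDist_le_of_ev {S : Type*} {p q : S → ℝ} (hp : IsProb p) (hq : IsProb q) {δ : ℝ}
    (hδ : 0 ≤ δ)
    (h : ∀ f : S → ℝ≥0∞, (∀ x, f x ≤ 1) → ev p f ≤ ev q f + ENNReal.ofReal δ) :
    tvDist p q ≤ 2 * δ := by
  classical
  have key : ∀ {r : S → ℝ}, IsProb r →
      ev r (fun x => if q x < p x then 1 else 0)
        = ENNReal.ofReal (∑' x, if q x < p x then r x else 0)
      ∧ Summable (fun x => if q x < p x then r x else 0) := by
    intro r hr
    have hs : Summable (fun x => if q x < p x then r x else 0) :=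
      Summable.of_nonneg_of_le (fun x => by split_ifs; exacts [hr.1 x, le_rfl])
        (fun x => by split_ifs; exacts [le_rfl, hr.1 x]) hr.2.summable
    refine ⟨?_, hs⟩
    rw [ENNReal.ofReal_tsum_of_nonneg (fun x => by split_ifs; exacts [hr.1 x, le_rfl]) hs, ev]
    refine tsum_congr fun x => ?_
    split_ifs <;> simp
  have h1 := h (fun x => if q x < p x then 1 else 0) fun x => by split_ifs <;> simp
  have hnn : 0 ≤ ∑' x, (if q x < p x then q x else 0) :=
    tsum_nonneg fun x => by split_ifs; exacts [hq.1 x, le_rfl]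
  rw [(key hp).1, (key hq).1, ← ENNReal.ofReal_add hnn hδ,
    ENNReal.ofReal_le_ofReal_iff (add_nonneg hnn hδ)] at h1
  -- The absolute value is twice the positive part minus the difference, and the differences sum to
  -- zero. Testing on the single set `q < p` therefore suffices.
  have h2 : tvDist p q = 2 * (∑' x, (if q x < p x then p x else 0)
      - ∑' x, (if q x < p x then q x else 0)) - (∑' x, p x - ∑' x, q x) := by
    rw [← (key hp).2.tsum_sub (key hq).2, ← hp.2.summable.tsum_sub hq.2.summable, ← tsum_mul_left,
      ← Summable.tsum_sub (((key hp).2.sub (key hq).2).mul_left 2)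
        (hp.2.summable.sub hq.2.summable)]
    refine tsum_congr fun x => ?_
    split_ifs with hx
    · rw [abs_of_pos (sub_pos.2 hx)]; ring
    · rw [abs_of_nonpos (by linarith)]; ring
  rw [hp.2.tsum_eq, hq.2.tsum_eq] at h2
  linarith

theorem tvDist_lcTrunc_le {P : Matrix (ℕ × Fin d) (ℕ × Fin d) ℝ} (hP : IsStochastic P)
    (hm : KMono P) {Ψ : Matrix (Fin d) (Fin d) ℝ} (hΨ : IsStochastic Ψ)
    (hirr : IsIrreducibleChain Ψ) (hph : HasPhase P Ψ) {π πn : ℕ × Fin d → ℝ}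
    (hπ : IsStationary P π) {n : ℕ} (hπn : IsStationary (lcTrunc P n) πn) {M : ℕ}
    (hlim : ∀ x, Tendsto (fun m => taboo (matPow P M) m x) atTop (𝓝 0)) (m : ℕ) {E β : ℝ}
    (hE0 : 0 ≤ E) (hβ0 : 0 ≤ β) (hE : ev π (taboo (matPow P M) m) ≤ ENNReal.ofReal E)
    (hβ : ev π (fun x => if n < x.1 then 1 else 0) ≤ ENNReal.ofReal β) :
    tvDist πn π ≤ 2 * E + 2 * m * M * β := by
  have hR := isStochastic_lcTrunc hP n
  have hRm := KMono.lcTrunc hP hm n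
  obtain ⟨a, ha, haπ⟩ := hph.exists_stationary hP hΨ hπ
  obtain ⟨a', ha', haπn⟩ := (HasPhase.lcTrunc hP hph n).exists_stationary hR hΨ hπn
  obtain rfl : a' = a := isStationary_unique hΨ hirr ha' ha
  have hQ := isStochastic_matPow hP M
  have hQm := hm.matPow hP M
  have hdom : StDom πn π := stationary_stDom (isStochastic_matPow hR M) hQ (hRm.matPow hR M) hQm
    (matPow_dom hR hP hm (lcTrunc_stDom hP n) M) (hπn.matPow hR M) (hπ.matPow hP M) ha.isProb
    haπn haπ hlim
  -- Capping changes the outcome only if a `P`-step from `πn` ends above `n`; by domination this is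
  -- at most the corresponding probability under `π`, which is invariant.
  have hstep : ∀ g : ℕ × Fin d → ℝ≥0∞, (∀ x, g x ≤ 1) →
      ev πn g ≤ ev πn (op P g) + ENNReal.ofReal β := by
    intro g hg
    set u : ℕ × Fin d → ℝ≥0∞ := fun x => if n < x.1 then 1 else 0 with hu
    have hum : LevelMono u := by
      intro i a b hab
      simp only [hu]
      split_ifs <;> first | exact le_rfl | omega | simp
    calc ev πn g = ev πn (op P fun y => g (min y.1 n, y.2)) := by
          rw [← op_lcTrunc hP, hπn.ev_op hR]
      _ ≤ ev πn (op P fun y => g y + u y) := by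
          refine ev_mono _ (op_mono P fun y => ?_)
          simp only [hu]
          split_ifs with h
          · exact (hg _).trans le_add_self
          · rw [min_eq_left (not_lt.1 h)]; simp
      _ = ev πn (op P g) + ev πn (op P u) := by rw [op_add, ev_add]
      _ ≤ ev πn (op P g) + ev π (op P u) := by gcongr; exact hdom _ (hm _ hum)
      _ ≤ _ := by rw [hπ.ev_op hP]; gcongr
  have hone : ∀ (f : ℕ × Fin d → ℝ≥0∞), (∀ x, f x ≤ 1) → ∀ t x, (op P)^[t] f x ≤ 1 := by
    intro f hf t x
    exact (op_iterate_mono P t hf x).trans_eq (congrFun (op_iterate_const hP t 1) x)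
  have hiter : ∀ (f : ℕ × Fin d → ℝ≥0∞), (∀ x, f x ≤ 1) → ∀ t : ℕ,
      ev πn f ≤ ev πn ((op P)^[t] f) + t * ENNReal.ofReal β := by
    intro f hf t
    induction t with
    | zero => simp
    | succ t ih =>
      refine ih.trans ?_
      rw [Function.iterate_succ_apply']
      push_cast
      rw [add_mul, one_mul, add_comm ((t : ℝ≥0∞) * _), ← add_assoc]
      gcongr
      exact hstep _ (hone f hf t)
  -- The truncated law is first replaced by its image under `M * m` steps of `P`, at cost `m * M *
  -- β`, and then compared with `π` through merging, at cost `E`.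
  have := tvDist_le_of_ev hπn.isProb hπ.isProb (δ := E + m * M * β) (by positivity) fun f hf => by
    have h1 := hiter f hf (M * m)
    have h2 : (op P)^[M * m] f = (op (matPow P M))^[m] f := by
      rw [Function.iterate_mul, show op (matPow P M) = (op P)^[M] from funext (op_matPow hP M)]
    rw [h2] at h1
    have h3 := ev_op_iterate_le_add_taboo hQm hdom hf m
    rw [(hπ.matPow hP M).ev_op_iterate hQ] at h3
    calc ev πn f ≤ _ := h1
      _ ≤ (ev π f + ENNReal.ofReal E) + (M * m : ℕ) * ENNReal.ofReal β := by
          gcongr; exact h3.trans (by gcongr)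
      _ = _ := by
          rw [ENNReal.ofReal_add hE0 (by positivity), add_assoc, ENNReal.ofReal_mul (by positivity),
            ← Nat.cast_mul, ENNReal.ofReal_natCast, mul_comm M m]
  linarith

/-- The drift inequality bounds the stationary mean of the drift. -/
theorem ev_le_of_drift {S : Type*} {Q : Matrix S S ℝ} (hQ : IsStochastic Q) {π : S → ℝ}
    (hπ : IsStationary Q π) {V Φ : S → ℝ≥0∞} {b : ℝ≥0∞} (hV : ∀ x, V x ≠ ⊤)
    (h : ∀ x, op Q V x + Φ x ≤ V x + b) : ev π Φ ≤ b := by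
  classical
  -- The integral of `V` may be infinite and then cannot be cancelled, so `V` is capped at `c`. The
  -- drift inequality survives where `V ≤ c`, and elsewhere the capped function cannot increase on
  -- average.
  have key : ∀ c : ℕ, ev π (fun x => if V x ≤ c then Φ x else 0) ≤ b := by
    intro c
    have hfin : ev π (fun x => min (V x) c) ≠ ⊤ :=
      ne_top_of_le_ne_top (ENNReal.natCast_ne_top c)
        (ev_le_const hπ.isProb fun x => min_le_right _ _)
    rw [← ENNReal.add_le_add_iff_left hfin]
    calc _ = ev π (fun x => op Q (fun y => min (V y) c) x + if V x ≤ c then Φ x else 0) := by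
          rw [ev_add, hπ.ev_op hQ]
      _ ≤ ev π (fun x => min (V x) c + b) := by
          refine ev_mono _ fun x => ?_
          split_ifs with hx
          · rw [min_eq_left hx]
            refine le_trans ?_ (h x)
            gcongr
            exact op_mono Q (fun y => min_le_left _ _) x
          · rw [min_eq_right (not_le.1 hx).le, add_zero]
            exact (ev_le_const (hQ.isProb x) fun y => min_le_right _ _).trans le_self_add
      _ = _ := by rw [ev_add, ev_const hπ.isProb]
  rw [ev, ENNReal.tsum_eq_iSup_sum]
  refine iSup_le fun F => ?_
  obtain ⟨c, hc⟩ := ENNReal.exists_nat_gt (r := ∑ x ∈ F, V x) (by simp [hV])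
  refine le_trans (Finset.sum_le_sum fun x hx => ?_) ((ENNReal.sum_le_tsum F).trans (key c))
  dsimp only
  rw [if_pos ((Finset.single_le_sum (fun _ _ => zero_le) hx).trans hc.le)]

/-- A subgeometric drift condition off level `0` controls the avoidance of level `0`. -/
theorem taboo_of_drift {Q : Matrix (ℕ × Fin d) (ℕ × Fin d) ℝ} (hQ : IsStochastic Q)
    (hm : KMono Q) {π : ℕ × Fin d → ℝ} (hπ : IsStationary Q π) {φ : ℝ → ℝ}
    (hφ : IsConcaveRate φ) {v : ℕ → ℝ} (hv : ∀ k, 1 ≤ v k) (hvm : Monotone v) {c : ℝ} (hc : 0 < c)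
    (hdrift : ∀ k i, k ≠ 0 → op Q (fun y => ENNReal.ofReal (v y.1)) (k, i)
      + ENNReal.ofReal (c * φ (v k)) ≤ ENNReal.ofReal (v k)) :
    (∀ x, Tendsto (fun m => taboo Q m x) atTop (𝓝 0)) ∧
      ∀ m : ℕ, ev π (taboo Q m) ≤ ENNReal.ofReal (v 1 / (c * rateR φ (c * m))) := by
  set r : ℕ → ℝ≥0∞ := fun t => ENNReal.ofReal (c * rateR φ (c * t)) with hr
  have hpos : ∀ t : ℕ, 0 < c * rateR φ (c * t) := fun t =>
    mul_pos hc (hφ.rateR_pos (by positivity))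
  have hrm : Monotone r := fun s t hst => ENNReal.ofReal_le_ofReal
    (mul_le_mul_of_nonneg_left (hφ.rateR_mono (by positivity) (by gcongr)) hc.le)
  have hsum : ∀ T x, ∑ t ∈ Finset.range T, r t * taboo Q t x ≤ ENNReal.ofReal (v x.1) := by
    intro T x
    have h := sum_taboo_le (Q := Q) (r := r)
      (W := fun t x => ENNReal.ofReal (rateG φ (rateH φ (v x.1) + c * t) - rateG φ (c * t)))
      (fun t x hx => hφ.op_rate_add_le hQ (v := fun x => v x.1) (fun x => hv x.1) hc.le
        (hdrift x.1 x.2 hx) t) T 0 x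
    simp only [zero_add, Nat.cast_zero, mul_zero, add_zero] at h
    refine h.trans (ENNReal.ofReal_le_ofReal ?_)
    rw [hφ.rateG_rateH (hv _)]
    linarith [hφ.one_le_rateG (le_refl 0)]
  have hlim : ∀ x, Tendsto (fun m => taboo Q m x) atTop (𝓝 0) := fun x =>
    tendsto_taboo_zero (v := fun x => ENNReal.ofReal (v x.1)) hrm
      (by simpa [hr] using hpos 0) x ENNReal.ofReal_ne_top fun T => hsum T x
  refine ⟨hlim, fun m => ?_⟩
  -- No drift is assumed at level 0, but monotonicity bounds the value there by the value at level
  -- 1, where the drift holds.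
  have hD : ∀ i, op Q (fun y => ENNReal.ofReal (v y.1)) (0, i) ≤ ENNReal.ofReal (v 1) := fun i =>
    (hm _ (levelMono_comp (u := fun k => ENNReal.ofReal (v k))
      fun a b hab => ENNReal.ofReal_le_ofReal (hvm hab)) i zero_le_one).trans
      (le_self_add.trans (hdrift 1 i one_ne_zero))
  have h := mul_ev_taboo_le hQ hπ hrm (fun t => ENNReal.ofReal_ne_top) hsum hD hlim m
  rw [ENNReal.ofReal_div_of_pos (hpos m), ENNReal.le_div_iff_mul_le
    (Or.inl (by simpa using hpos m)) (Or.inl ENNReal.ofReal_ne_top), mul_comm]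
  exact h

end Truncation

/-! ### Tail sums of the block-structured chain, and the cut of its downward jumps. -/

section Gig1

variable {d : ℕ}

theorem tsum_int_split (F : ℤ → ℝ≥0∞) (s : ℤ) :
    ∑' z, F z = ∑' m : ℕ, F (s + m) + ∑' m : ℕ, F (s - 1 - m) := by
  rw [← (Equiv.addLeft s).tsum_eq F,
    tsum_of_nat_of_neg_add_one ENNReal.summable ENNReal.summable]
  congr 1
  refine tsum_congr fun m => ?_
  simp only [Equiv.coe_addLeft]
  congr 1
  ring

theorem summable_of_tsum_ofReal_ne_top {ι : Type*} {f : ι → ℝ} (hf : ∀ x, 0 ≤ f x)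
    (h : ∑' x, ENNReal.ofReal (f x) ≠ ⊤) : Summable f := by
  simpa [ENNReal.toReal_ofReal (hf _)] using ENNReal.summable_toReal h

/-- The sum of the entries `A z i j` over `z ≥ s`. -/
def zTail (A : ℤ → Matrix (Fin d) (Fin d) ℝ) (s : ℤ) (i j : Fin d) : ℝ≥0∞ :=
  ∑' m : ℕ, ENNReal.ofReal (A (s + m) i j)

/-- The sum of the entries `A z i j` over all `z`. -/
def zTotal (A : ℤ → Matrix (Fin d) (Fin d) ℝ) (i j : Fin d) : ℝ≥0∞ :=
  ∑' z : ℤ, ENNReal.ofReal (A z i j)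

theorem zTotal_eq (A : ℤ → Matrix (Fin d) (Fin d) ℝ) (s : ℤ) (i j : Fin d) :
    zTotal A i j = zTail A s i j + ∑' m : ℕ, ENNReal.ofReal (A (s - 1 - m) i j) :=
  tsum_int_split _ s

theorem zTail_le_zTotal (A : ℤ → Matrix (Fin d) (Fin d) ℝ) (s : ℤ) (i j : Fin d) :
    zTail A s i j ≤ zTotal A i j := zTotal_eq A s i j ▸ le_self_add

theorem zTail_sub_one (A : ℤ → Matrix (Fin d) (Fin d) ℝ) (s : ℤ) (i j : Fin d) :
    zTail A (s - 1) i j = ENNReal.ofReal (A (s - 1) i j) + zTail A s i j := by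
  rw [zTail, tsum_eq_zero_add' ENNReal.summable, zTail]
  congr 1
  · simp
  · refine tsum_congr fun m => ?_
    rw [show s - 1 + ((m + 1 : ℕ) : ℤ) = s + m by push_cast; ring]

theorem zTail_sub_nat (A : ℤ → Matrix (Fin d) (Fin d) ℝ) (s : ℤ) (n : ℕ) (i j : Fin d) :
    zTail A (s - n) i j
      = zTail A s i j + ∑ m ∈ Finset.range n, ENNReal.ofReal (A (s - 1 - m) i j) := by
  induction n with
  | zero => simp
  | succ n ih =>
    rw [show s - ((n + 1 : ℕ) : ℤ) = s - n - 1 by push_cast; ring, zTail_sub_one, ih,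
      Finset.sum_range_succ, sub_right_comm s 1, add_comm, add_assoc]

theorem zTail_antitone (A : ℤ → Matrix (Fin d) (Fin d) ℝ) (s : ℤ) (i j : Fin d) :
    zTail A s i j ≤ zTail A (s - 1) i j := zTail_sub_one A s i j ▸ le_add_self

theorem zTotal_le_of_zTail_le {A : ℤ → Matrix (Fin d) (Fin d) ℝ} {i j : Fin d} {c : ℝ≥0∞}
    (h : ∀ n : ℕ, zTail A (0 - n) i j ≤ c) : zTotal A i j ≤ c := by
  rw [zTotal_eq A 0, ENNReal.tsum_eq_iSup_nat, ENNReal.add_iSup]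
  exact iSup_le fun n => (zTail_sub_nat A 0 n i j).symm.trans_le (h n)

theorem nonneg_of_gig1 {A : ℤ → Matrix (Fin d) (Fin d) ℝ} {B₀ : ℕ → Matrix (Fin d) (Fin d) ℝ}
    (h : ∀ x y, 0 ≤ gig1 A B₀ x y) (z : ℤ) (i j : Fin d) : 0 ≤ A z i j := by
  have := h ((-z).toNat + 1, i) (z.toNat + 1, j)
  simp only [gig1, Nat.add_one_ne_zero, if_false] at this
  rwa [show (((z.toNat + 1 : ℕ) : ℤ) - (((-z).toNat + 1 : ℕ) : ℤ)) = z by omega] at this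

/-- Row `n + 1` contains all blocks `A z` with `z ≥ -n`, so these tails are at most 1; let `n` grow.
-/
theorem zTotal_ne_top_of_gig1 {A : ℤ → Matrix (Fin d) (Fin d) ℝ}
    {B₀ : ℕ → Matrix (Fin d) (Fin d) ℝ} (h : IsStochastic (gig1 A B₀)) (i j : Fin d) :
    zTotal A i j ≠ ⊤ := by
  refine ne_top_of_le_ne_top ENNReal.one_ne_top (zTotal_le_of_zTail_le fun n => ?_)
  have h1 := ev_const (h.isProb (n + 1, i)) 1
  rw [ev, tsum_level] at h1
  refine le_trans ?_ ((Finset.single_le_sum (fun _ _ => zero_le) (Finset.mem_univ j)).trans h1.le)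
  rw [tsum_nat_split _ 1]
  refine le_trans (le_of_eq ?_) le_add_self
  refine tsum_congr fun m => ?_
  simp only [gig1, Nat.add_one_ne_zero, if_false, mul_one]
  congr 3
  push_cast; ring

theorem ofReal_lowerTail {A : ℤ → Matrix (Fin d) (Fin d) ℝ} (hA : ∀ z i j, 0 ≤ A z i j)
    {i j : Fin d} (hs : zTotal A i j ≠ ⊤) (k : ℕ) :
    ENNReal.ofReal (lowerTail A k i j) = ∑' m : ℕ, ENNReal.ofReal (A (-(k : ℤ) - m) i j) := by
  refine ENNReal.ofReal_tsum_of_nonneg (fun m => hA _ _ _) ?_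
  exact (summable_of_tsum_ofReal_ne_top (fun z => hA z i j) hs).comp_injective
    (i := fun m : ℕ => -(k : ℤ) - m) fun a b hab => by simpa using hab

theorem ofReal_blockTotal {A : ℤ → Matrix (Fin d) (Fin d) ℝ} (hA : ∀ z i j, 0 ≤ A z i j)
    {i j : Fin d} (hs : zTotal A i j ≠ ⊤) : ENNReal.ofReal (blockTotal A i j) = zTotal A i j :=
  ENNReal.ofReal_tsum_of_nonneg (fun _ => hA _ _ _)
    (summable_of_tsum_ofReal_ne_top (fun z => hA z i j) hs)

theorem tailMass_gig1_zero {A : ℤ → Matrix (Fin d) (Fin d) ℝ} (B₀ : ℕ → Matrix (Fin d) (Fin d) ℝ)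
    (hA : ∀ z i j, 0 ≤ A z i j) {i j : Fin d} (hs : zTotal A i j ≠ ⊤) (k : ℕ) :
    tailMass (gig1 A B₀ (k + 1, i)) 0 j = zTotal A i j := by
  rw [tailMass, tsum_eq_zero_add' ENNReal.summable, zTotal_eq A (-(k : ℤ)), add_comm]
  congr 1
  · refine tsum_congr fun m => ?_
    simp only [gig1, Nat.add_one_ne_zero, if_false, zero_add]
    congr 3
    push_cast; ring
  · simp only [gig1, Nat.add_one_ne_zero, if_false, zero_add, if_true]
    rw [ofReal_lowerTail hA hs]
    refine tsum_congr fun m => ?_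
    congr 3
    push_cast; ring

theorem tailMass_gig1_succ (A : ℤ → Matrix (Fin d) (Fin d) ℝ)
    (B₀ : ℕ → Matrix (Fin d) (Fin d) ℝ) (k l : ℕ) (i j : Fin d) :
    tailMass (gig1 A B₀ (k + 1, i)) (l + 1) j = zTail A ((l : ℤ) - k) i j := by
  refine tsum_congr fun m => ?_
  have : l + 1 + m ≠ 0 := by omega
  simp only [gig1, Nat.add_one_ne_zero, if_false, this]
  congr 3
  push_cast; ring

theorem truncBelow_nonneg {A : ℤ → Matrix (Fin d) (Fin d) ℝ} (hA : ∀ z i j, 0 ≤ A z i j) (N : ℕ)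
    (z : ℤ) (i j : Fin d) : 0 ≤ truncBelow A N z i j := by
  unfold truncBelow
  split_ifs
  exacts [le_rfl, tsum_nonneg fun _ => hA _ _ _, hA _ _ _]

theorem truncBelow_of_lt (A : ℤ → Matrix (Fin d) (Fin d) ℝ) {N : ℕ} {z : ℤ} (hz : z < -(N : ℤ)) :
    truncBelow A N z = 0 := if_pos hz

theorem zTail_truncBelow_of_lt (A : ℤ → Matrix (Fin d) (Fin d) ℝ) {N : ℕ} {s : ℤ}
    (hs : -(N : ℤ) < s) (i j : Fin d) : zTail (truncBelow A N) s i j = zTail A s i j := by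
  refine tsum_congr fun m => ?_
  rw [truncBelow, if_neg (by omega), if_neg (by omega)]

theorem zTotal_truncBelow {A : ℤ → Matrix (Fin d) (Fin d) ℝ} (hA : ∀ z i j, 0 ≤ A z i j)
    {i j : Fin d} (hs : zTotal A i j ≠ ⊤) (N : ℕ) :
    zTotal (truncBelow A N) i j = zTotal A i j := by
  rw [zTotal_eq _ (1 - (N : ℤ)), zTotal_eq A (1 - (N : ℤ)), zTail_truncBelow_of_lt A (by omega)]
  congr 1
  rw [tsum_eq_single 0]
  · rw [truncBelow, if_neg (by simp), if_pos (by simp), ofReal_lowerTail hA hs]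
    refine tsum_congr fun m => ?_
    congr 3
    ring
  · intro m hm
    rw [truncBelow_of_lt A (by omega)]
    simp

theorem zTail_truncBelow_of_le {A : ℤ → Matrix (Fin d) (Fin d) ℝ} (hA : ∀ z i j, 0 ≤ A z i j)
    {i j : Fin d} (hs : zTotal A i j ≠ ⊤) {N : ℕ} {s : ℤ} (hsN : s ≤ -(N : ℤ)) :
    zTail (truncBelow A N) s i j = zTotal A i j := by
  rw [← zTotal_truncBelow hA hs N, zTotal_eq _ s, ENNReal.tsum_eq_zero.2, add_zero]
  intro m
  rw [truncBelow_of_lt A (by omega)]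
  simp

theorem zTail_le_truncBelow {A : ℤ → Matrix (Fin d) (Fin d) ℝ} (hA : ∀ z i j, 0 ≤ A z i j)
    {i j : Fin d} (hs : zTotal A i j ≠ ⊤) (N : ℕ) (s : ℤ) :
    zTail A s i j ≤ zTail (truncBelow A N) s i j := by
  rcases le_or_gt s (-(N : ℤ)) with h | h
  · rw [zTail_truncBelow_of_le hA hs h]; exact zTail_le_zTotal _ _ _ _
  · rw [zTail_truncBelow_of_lt A h]

theorem gig1_zero_row (A A' : ℤ → Matrix (Fin d) (Fin d) ℝ) (B₀ : ℕ → Matrix (Fin d) (Fin d) ℝ)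
    (i : Fin d) : gig1 A B₀ (0, i) = gig1 A' B₀ (0, i) := by
  ext y; simp [gig1]

theorem StDom.tailMass_le {p q : ℕ × Fin d → ℝ} (h : StDom p q) (l : ℕ) (j : Fin d) :
    tailMass p l j ≤ tailMass q l j := by
  rw [← ev_tail_eq, ← ev_tail_eq]
  exact h _ (levelMono_tail l {j})

theorem StDom.trans {p q r : ℕ × Fin d → ℝ} (h : StDom p q) (h' : StDom q r) : StDom p r :=
  fun f hf => (h f hf).trans (h' f hf)

theorem ev_one_eq_sum_tailMass (p : ℕ × Fin d → ℝ) :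
    ev p (fun _ => 1) = ∑ j, tailMass p 0 j := by
  rw [ev, tsum_level]
  simp [tailMass]

variable {A : ℤ → Matrix (Fin d) (Fin d) ℝ} {B₀ : ℕ → Matrix (Fin d) (Fin d) ℝ}
  (hP : IsStochastic (gig1 A B₀))
include hP

theorem gig1_truncBelow_dom (N : ℕ) (x : ℕ × Fin d) :
    StDom (gig1 A B₀ x) (gig1 (truncBelow A N) B₀ x) := by
  have hA := nonneg_of_gig1 hP.1
  have hs := zTotal_ne_top_of_gig1 hP
  obtain ⟨k, i⟩ := x
  rcases k with _ | k
  · rw [gig1_zero_row A (truncBelow A N)]; exact fun f _ => le_rfl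
  · refine stDom_of_tailMass fun l j => ?_
    rcases l with _ | l
    · rw [tailMass_gig1_zero B₀ hA (hs i j), tailMass_gig1_zero B₀ (truncBelow_nonneg hA N)
        ((zTotal_truncBelow hA (hs i j) N).trans_ne (hs i j)), zTotal_truncBelow hA (hs i j)]
    · rw [tailMass_gig1_succ, tailMass_gig1_succ]
      exact zTail_le_truncBelow hA (hs i j) N _

theorem isStochastic_gig1_truncBelow (N : ℕ) : IsStochastic (gig1 (truncBelow A N) B₀) := by
  have hA := nonneg_of_gig1 hP.1
  have hs := zTotal_ne_top_of_gig1 hP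
  have h0 : ∀ x y, 0 ≤ gig1 (truncBelow A N) B₀ x y := by
    intro x y
    have hB := hP.1 x y
    unfold gig1 at hB ⊢
    split_ifs with h1 h2
    · rwa [if_pos h1] at hB
    · exact tsum_nonneg fun _ => truncBelow_nonneg hA N _ _ _
    · exact truncBelow_nonneg hA N _ _ _
  refine ⟨h0, fun x => (isProb_of_ev_one (h0 x) ?_).2⟩
  refine Eq.trans ?_ (ev_const (hP.isProb x) 1)
  rw [ev_one_eq_sum_tailMass, ev_one_eq_sum_tailMass]
  refine Finset.sum_congr rfl fun j _ => ?_
  obtain ⟨k, i⟩ := x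
  rcases k with _ | k
  · rw [gig1_zero_row A (truncBelow A N)]
  · rw [tailMass_gig1_zero B₀ hA (hs i j), tailMass_gig1_zero B₀ (truncBelow_nonneg hA N)
      ((zTotal_truncBelow hA (hs i j) N).trans_ne (hs i j)), zTotal_truncBelow hA (hs i j)]

/-- Interior rows are translates of one jump law. For the step from row 0 to row 1, the cut leaves
row 0 unchanged and only raises row 1. -/
theorem kMono_gig1_truncBelow (hm : KMono (gig1 A B₀)) (N : ℕ) :
    KMono (gig1 (truncBelow A N) B₀) := by
  have hA := nonneg_of_gig1 hP.1
  have hs := zTotal_ne_top_of_gig1 hP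
  refine kMono_of_stDom fun k i => ?_
  rcases k with _ | k
  · rw [← gig1_zero_row A (truncBelow A N)]
    exact (hm.stDom zero_le_one i).trans (gig1_truncBelow_dom hP N _)
  · refine stDom_of_tailMass fun l j => ?_
    have hsN := (zTotal_truncBelow hA (hs i j) N).trans_ne (hs i j)
    rcases l with _ | l
    · rw [tailMass_gig1_zero B₀ (truncBelow_nonneg hA N) hsN,
        tailMass_gig1_zero B₀ (truncBelow_nonneg hA N) hsN]
    · rw [tailMass_gig1_succ, tailMass_gig1_succ]
      refine (zTail_antitone _ _ i j).trans_eq ?_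
      congr 1
      push_cast; ring

/-- In rows from level 1 on, the phase law is visibly `blockTotal A`. Monotonicity puts the phase
law of row 0 entrywise below it, and both have total mass 1. -/
theorem hasPhase_gig1 (hm : KMono (gig1 A B₀)) : HasPhase (gig1 A B₀) (blockTotal A) := by
  have hA := nonneg_of_gig1 hP.1
  have hs := zTotal_ne_top_of_gig1 hP
  have h1 : ∀ k i j, tailMass (gig1 A B₀ (k + 1, i)) 0 j = ENNReal.ofReal (blockTotal A i j) :=
    fun k i j => by rw [tailMass_gig1_zero B₀ hA (hs i j), ofReal_blockTotal hA (hs i j)]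
  rintro ⟨k, i⟩ j
  rcases k with _ | k
  · rw [← h1 0]
    by_contra hne
    have hle : ∀ j, tailMass (gig1 A B₀ (0, i)) 0 j ≤ tailMass (gig1 A B₀ (0 + 1, i)) 0 j :=
      (hm.stDom (Nat.zero_le _) i).tailMass_le 0
    have e0 := ev_const (hP.isProb (0, i)) 1
    have e1 := ev_const (hP.isProb (0 + 1, i)) 1
    rw [ev_one_eq_sum_tailMass, ← tsum_fintype (L := .unconditional _)] at e0 e1
    exact (ENNReal.tsum_lt_tsum (e0.trans_ne ENNReal.one_ne_top) hle
      (lt_of_le_of_ne (hle j) hne)).ne (e0.trans e1.symm)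
  · exact h1 k i j

end Gig1

/-! ### Random walks on the integers with phases, and convolution powers. -/

section Convolution

variable {d : ℕ}

/-- The action of the additive kernel with jump matrices `a` on functions of `(z, j)`, `z ∈ ℤ`. -/
def cop (a : ℤ → Matrix (Fin d) (Fin d) ℝ) (F : ℤ → Fin d → ℝ≥0∞) (z : ℤ) (i : Fin d) : ℝ≥0∞ :=
  ∑' w : ℤ, ∑' j, ENNReal.ofReal (a w i j) * F (z + w) j

/-- `a` consists of nonnegative matrices whose sum is stochastic. -/
def IsJumpLaw (a : ℤ → Matrix (Fin d) (Fin d) ℝ) : Prop :=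
  (∀ w i j, 0 ≤ a w i j) ∧ ∀ i, ∑' w : ℤ, ∑' j, ENNReal.ofReal (a w i j) = 1

namespace IsJumpLaw

variable {a : ℤ → Matrix (Fin d) (Fin d) ℝ}

theorem le_one (h : IsJumpLaw a) (w : ℤ) (i j : Fin d) : a w i j ≤ 1 := by
  rw [← ENNReal.ofReal_le_one, ← h.2 i]
  exact (ENNReal.le_tsum j).trans (ENNReal.le_tsum (f := fun w => ∑' j, ENNReal.ofReal (a w i j)) w)

theorem summable (h : IsJumpLaw a) (i j : Fin d) : Summable fun w => a w i j := by
  refine summable_of_tsum_ofReal_ne_top (fun w => h.1 w i j)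
    (ne_top_of_le_ne_top ENNReal.one_ne_top ?_)
  rw [← h.2 i]
  exact ENNReal.tsum_le_tsum fun w => ENNReal.le_tsum j

theorem ofReal_conv {c : ℤ → Matrix (Fin d) (Fin d) ℝ} (hc : IsJumpLaw c) (ha : IsJumpLaw a)
    (k : ℤ) (i j : Fin d) : ENNReal.ofReal (∑' l : ℤ, (c (k - l) * a l) i j)
      = ∑' l : ℤ, ∑' m, ENNReal.ofReal (c (k - l) i m) * ENNReal.ofReal (a l m j) := by
  have hnn : ∀ l m, 0 ≤ c (k - l) i m * a l m j := fun l m => mul_nonneg (hc.1 _ _ _) (ha.1 _ _ _)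
  simp only [Matrix.mul_apply]
  rw [ENNReal.ofReal_tsum_of_nonneg (fun l => Finset.sum_nonneg fun m _ => hnn l m)]
  · refine tsum_congr fun l => ?_
    rw [ENNReal.ofReal_sum_of_nonneg fun m _ => hnn l m, tsum_fintype]
    simp only [ENNReal.ofReal_mul (hc.1 _ _ _)]
  · refine summable_sum fun m _ => ?_
    exact Summable.of_nonneg_of_le (fun l => hnn l m)
      (fun l => mul_le_of_le_one_left (ha.1 _ _ _) (hc.le_one _ _ _)) (ha.summable m j)

theorem cop_conv {c : ℤ → Matrix (Fin d) (Fin d) ℝ} (hc : IsJumpLaw c) (ha : IsJumpLaw a)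
    (F : ℤ → Fin d → ℝ≥0∞) :
    cop (fun k i j => ∑' l : ℤ, (c (k - l) * a l) i j) F = cop c (cop a F) := by
  ext z i
  set X : ℤ → ℤ → Fin d → Fin d → ℝ≥0∞ := fun w l j m =>
    ENNReal.ofReal (c w i m) * (ENNReal.ofReal (a l m j) * F (z + w + l) j) with hX
  calc _ = ∑' w : ℤ, ∑' j, ∑' l : ℤ, ∑' m, X (w - l) l j m := by
        refine tsum_congr fun w => tsum_congr fun j => ?_
        rw [ofReal_conv hc ha, ← ENNReal.tsum_mul_right]
        refine tsum_congr fun l => ?_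
        rw [← ENNReal.tsum_mul_right]
        refine tsum_congr fun m => ?_
        rw [hX, mul_assoc]
        simp only
        rw [show z + (w - l) + l = z + w by ring]
    _ = ∑' w : ℤ, ∑' l : ℤ, ∑' j, ∑' m, X (w - l) l j m :=
        tsum_congr fun w => ENNReal.tsum_comm
    _ = ∑' l : ℤ, ∑' w : ℤ, ∑' j, ∑' m, X (w - l) l j m := ENNReal.tsum_comm
    _ = ∑' l : ℤ, ∑' w : ℤ, ∑' j, ∑' m, X w l j m :=
        tsum_congr fun l => (Equiv.subRight l).tsum_eq fun w => ∑' j, ∑' m, X w l j m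
    _ = ∑' w : ℤ, ∑' l : ℤ, ∑' j, ∑' m, X w l j m := ENNReal.tsum_comm
    _ = ∑' w : ℤ, ∑' l : ℤ, ∑' m, ∑' j, X w l j m :=
        tsum_congr fun w => tsum_congr fun l => ENNReal.tsum_comm
    _ = ∑' w : ℤ, ∑' m, ∑' l : ℤ, ∑' j, X w l j m := tsum_congr fun w => ENNReal.tsum_comm
    _ = _ := by simp only [hX, ENNReal.tsum_mul_left]; rfl

theorem cop_one (h : IsJumpLaw a) : cop a (fun _ _ => 1) = fun _ _ => 1 := by
  ext z i
  simpa [cop] using h.2 i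

theorem convPow (h : IsJumpLaw a) (t : ℕ) : IsJumpLaw (convPow a t) := by
  induction t with
  | zero =>
    refine ⟨fun w i j => ?_, fun i => ?_⟩
    · simp only [BlockChain.convPow]
      split_ifs
      · rw [Matrix.one_apply]; split_ifs <;> simp
      · simp
    · rw [tsum_eq_single 0 (by intro w hw; simp [BlockChain.convPow, hw]), tsum_eq_single i
        (by intro j hj; simp [BlockChain.convPow, Ne.symm hj])]
      simp [BlockChain.convPow]
  | succ t ih =>
    refine ⟨fun w i j => tsum_nonneg fun l => ?_, fun i => ?_⟩
    · rw [Matrix.mul_apply]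
      exact Finset.sum_nonneg fun m _ => mul_nonneg (ih.1 _ _ _) (h.1 _ _ _)
    · have := congrFun₂ (cop_conv ih h fun _ _ => 1) 0 i
      rw [h.cop_one, ih.cop_one] at this
      simpa [cop, BlockChain.convPow] using this

theorem cop_convPow (h : IsJumpLaw a) (t : ℕ) (F : ℤ → Fin d → ℝ≥0∞) :
    cop (BlockChain.convPow a t) F = (cop a)^[t] F := by
  induction t generalizing F with
  | zero =>
    ext z i
    rw [cop, tsum_eq_single 0 (by intro w hw; simp [BlockChain.convPow, hw]), tsum_eq_single i
        (by intro j hj; simp [BlockChain.convPow, Ne.symm hj])]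
    simp [BlockChain.convPow]
  | succ t ih =>
    rw [Function.iterate_succ_apply, ← ih, ← cop_conv (h.convPow t) h]
    rfl

end IsJumpLaw

theorem convPow_eq_zero {a : ℤ → Matrix (Fin d) (Fin d) ℝ} {N : ℕ}
    (ha : ∀ w, w < -(N : ℤ) → a w = 0) (t : ℕ) :
    ∀ w, w < -((t * N : ℕ) : ℤ) → convPow a t w = 0 := by
  induction t with
  | zero =>
    intro w hw
    exact if_neg (by rw [zero_mul] at hw; simp at hw; omega)
  | succ t ih =>
    intro w hw
    ext i j
    have : ∀ l : ℤ, (convPow a t (w - l) * a l) i j = 0 := by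
      intro l
      rcases lt_or_ge l (-(N : ℤ)) with hl | hl
      · rw [ha l hl]; simp
      · rw [ih (w - l) (by push_cast at hw ⊢; linarith)]; simp
    simp [convPow, this]

variable {A : ℤ → Matrix (Fin d) (Fin d) ℝ} {B₀ : ℕ → Matrix (Fin d) (Fin d) ℝ}

/-- From level `N` on, the boundary column follows the interior rule: for `k = N` only the atom at
`-N` remains, and for `k > N` both sides vanish. -/
theorem lowerTail_truncBelow {N k : ℕ} (hk : N ≤ k) :
    lowerTail (truncBelow A N) k = truncBelow A N (-k) := by
  ext i j
  rw [lowerTail, tsum_eq_single 0]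
  · simp
  · intro m hm
    rw [truncBelow_of_lt A (by omega)]
    rfl

theorem isJumpLaw_truncBelow (hP : IsStochastic (gig1 A B₀)) (hΨ : IsStochastic (blockTotal A))
    (N : ℕ) : IsJumpLaw (truncBelow A N) := by
  have hA := nonneg_of_gig1 hP.1
  have hs := zTotal_ne_top_of_gig1 hP
  refine ⟨truncBelow_nonneg hA N, fun i => ?_⟩
  have h := tsum_ofReal_of_hasSum (hΨ.1 i) (hΨ.2 i)
  rw [ENNReal.ofReal_one] at h
  rw [ENNReal.tsum_comm, ← h]
  refine tsum_congr fun j => ?_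
  rw [ofReal_blockTotal hA (hs i j), ← zTotal_truncBelow hA (hs i j) N]
  rfl

theorem op_gig1_truncBelow {N : ℕ} (hN : 1 ≤ N) {k : ℕ} (hk : N ≤ k) (f : ℕ × Fin d → ℝ≥0∞)
    (i : Fin d) : op (gig1 (truncBelow A N) B₀) f (k, i)
      = cop (truncBelow A N) (fun z j => f (z.toNat, j)) k i := by
  set G : ℤ → ℝ≥0∞ := fun z =>
    ∑' j, ENNReal.ofReal (truncBelow A N (z - k) i j) * f (z.toNat, j) with hG
  have h1 : cop (truncBelow A N) (fun z j => f (z.toNat, j)) k i = ∑' z, G z := by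
    rw [← (Equiv.addLeft (k : ℤ)).tsum_eq G]
    refine tsum_congr fun w => ?_
    simp [hG]
  rw [h1, tsum_int_split G 0, ENNReal.tsum_eq_zero (f := fun m : ℕ => G (0 - 1 - m)) |>.2, add_zero, op, ev, tsum_level,
    ← tsum_fintype (L := .unconditional _), ENNReal.tsum_comm]
  · refine tsum_congr fun l => tsum_congr fun j => ?_
    have hk0 : k ≠ 0 := by omega
    simp only [zero_add, Int.toNat_natCast, gig1, hk0, if_false]
    split_ifs with hl
    · subst hl
      rw [lowerTail_truncBelow hk]
      simp
    · rfl
  · intro m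
    simp only [hG]
    rw [truncBelow_of_lt A (by omega)]
    simp

/-- One step descends by at most `N`, so from a level `k ≥ t * N` the boundary at 0 is not felt
during `t` steps. -/
theorem op_iterate_gig1_truncBelow {N : ℕ} (hN : 1 ≤ N) (f : ℕ × Fin d → ℝ≥0∞) (t : ℕ) :
    ∀ k i, t * N ≤ k → (op (gig1 (truncBelow A N) B₀))^[t] f (k, i)
      = (cop (truncBelow A N))^[t] (fun z j => f (z.toNat, j)) k i := by
  induction t with
  | zero => intro k i _; simp
  | succ t ih =>
    intro k i hk
    rw [add_mul, one_mul] at hk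
    rw [Function.iterate_succ_apply', Function.iterate_succ_apply',
      op_gig1_truncBelow hN (by omega)]
    refine tsum_congr fun w => tsum_congr fun j => ?_
    rcases lt_or_ge w (-(N : ℤ)) with hw | hw
    · rw [truncBelow_of_lt A hw]; simp
    · have h0 : (((k + w).toNat : ℕ) : ℤ) = k + w := Int.toNat_of_nonneg (by omega)
      dsimp only
      rw [ih (k + w).toNat j (by omega), h0]

/-- Away from level `0`, the powers of the truncated chain act through the convolution powers. -/
theorem op_iterate_eq_convPow (hP : IsStochastic (gig1 A B₀)) (hΨ : IsStochastic (blockTotal A))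
    {N : ℕ} (hN : 1 ≤ N) (M : ℕ) (u : ℕ → ℝ≥0∞) (k : ℕ) (i : Fin d) (hk : M * N ≤ k) :
    (op (gig1 (truncBelow A N) B₀))^[M] (fun y => u y.1) (k, i)
      = ∑' w : ℤ, ENNReal.ofReal ((convPow (truncBelow A N) M w *ᵥ 1) i) * u (k + w).toNat := by
  have hJ := isJumpLaw_truncBelow hP hΨ N
  rw [op_iterate_gig1_truncBelow hN _ M k i hk, ← hJ.cop_convPow, cop]
  refine tsum_congr fun w => ?_
  dsimp only
  rw [ENNReal.tsum_mul_right]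
  congr 1
  simp only [Matrix.mulVec, dotProduct, Pi.one_apply, mul_one]
  rw [tsum_fintype, ENNReal.ofReal_sum_of_nonneg fun j _ => (hJ.convPow M).1 w i j]

end Convolution

/-! ### From moment conditions to drift inequalities. -/

section Drift

variable {d : ℕ}

theorem hasSum_int_of_nat {f : ℕ → ℝ} (hf : Summable f) :
    HasSum (fun w : ℤ => if 0 ≤ w then f w.toNat else 0) (∑' l, f l) := by
  rw [← Function.Injective.hasSum_iff Nat.cast_injective]
  · simpa [Function.comp_def] using hf.hasSum
  · intro w hw
    refine if_neg fun h0 => hw ⟨w.toNat, by simpa using h0⟩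

/-- The drift inequality for a jump law with a light enough upper tail. -/
theorem HeavyTail.jump_drift {A C : ℤ → Matrix (Fin d) (Fin d) ℝ} {α : ℝ} {V V' V'' : ℝ → ℝ}
    (hV : HeavyTail A C α V V' V'') {c : ℤ → ℝ} (hc0 : ∀ w, 0 ≤ c w) (hc1 : HasSum c 1) {L : ℕ}
    (hcL : ∀ w, w < -(L : ℤ) → c w = 0) {κ ε δ : ℝ} (hκ : 0 < κ) (hδ : 0 ≤ δ) {k : ℕ}
    (hk : L + 1 ≤ k) (hsum : Summable fun w : ℤ => (w : ℝ) * c w)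
    (hκε : (1 - ε) * ∑' w : ℤ, (w : ℝ) * c w + 2 * ε * ∑' l : ℕ, (l : ℝ) * c l ≤ -2 * κ)
    (hup : V' (k + δ * (k : ℝ) ^ (1 - α)) ≤ (1 + ε) * V' k)
    (hdown : (1 - ε) * V' k ≤ V' ((k : ℝ) - L))
    (hfin : Summable fun l : ℕ => V (k + l) * c l)
    (htail : ∑' l : ℕ, (if ⌊δ * (k : ℝ) ^ (1 - α)⌋₊ + 1 ≤ l then V (k + l) * c l else 0)
      ≤ κ * V' k) :
    ∑' w : ℤ, ENNReal.ofReal (c w) * ENNReal.ofReal (V ((k + w).toNat : ℕ))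
      + ENNReal.ofReal (κ * V' k) ≤ ENNReal.ofReal (V k) := by
  set n := ⌊δ * (k : ℝ) ^ (1 - α)⌋₊ with hn
  have hδk : 0 ≤ δ * (k : ℝ) ^ (1 - α) := by positivity
  have hVp : ∀ x : ℝ, 0 ≤ x → 0 < V x := fun x hx => zero_lt_one.trans_le (hV.one_le x hx)
  have hk0 : (0 : ℝ) ≤ k := by positivity
  have hV'k := hV.deriv_pos hk0
  set S₁ := ∑' w : ℤ, (w : ℝ) * c w with hS₁
  set S₂ := ∑' l : ℕ, (l : ℝ) * c l with hS₂
  set S₃ := ∑' l : ℕ, (if n + 1 ≤ l then V (k + l) * c l else 0) with hS₃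
  have hs2 : Summable fun l : ℕ => (l : ℝ) * c l := by
    simpa [Function.comp_def] using hsum.comp_injective (i := fun l : ℕ => (l : ℤ)) Nat.cast_injective
  have hs3 : Summable fun l : ℕ => (if n + 1 ≤ l then V (k + l) * c l else 0) := by
    refine Summable.of_nonneg_of_le (fun l => ?_) (fun l => ?_) hfin
    · split_ifs
      exacts [mul_nonneg (hVp _ (by positivity)).le (hc0 _), le_rfl]
    · split_ifs
      exacts [le_rfl, mul_nonneg (hVp _ (by positivity)).le (hc0 _)]
  -- A summable majorant: slope `(1 - ε) V' k` for every jump, an extra `2 ε V' k` for upward jumps,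
  -- and the raw value of `V` for upward jumps beyond `n`.
  set T : ℤ → ℝ := fun w => V k * c w
    + (V' k * ((1 - ε) * ((w : ℝ) * c w))
      + V' k * (2 * ε * (if 0 ≤ w then (w.toNat : ℝ) * c (w.toNat : ℕ) else 0)))
    + (if 0 ≤ w then (if n + 1 ≤ w.toNat then V (k + w.toNat) * c (w.toNat : ℕ) else 0) else 0)
    with hT
  have hTsum : HasSum T (V k * 1 + (V' k * ((1 - ε) * S₁) + V' k * (2 * ε * S₂)) + S₃) := by
    refine ((hc1.mul_left _).add (((hsum.hasSum.mul_left _).mul_left _).add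
      (((hasSum_int_of_nat hs2).mul_left _).mul_left _))).add (hasSum_int_of_nat hs3)
  have hle : ∀ w : ℤ, c w * V ((k + w).toNat : ℕ) ≤ T w := by
    intro w
    rcases lt_or_ge w (-(L : ℤ)) with hw | hw
    · have h0 : ¬ (0 ≤ w) := by omega
      simp [hT, hcL w hw, h0]
    · have hcast : (((k + w).toNat : ℕ) : ℝ) = k + w := by
        have : (((k + w).toNat : ℕ) : ℤ) = k + w := Int.toNat_of_nonneg (by omega)
        exact_mod_cast congrArg (Int.cast (R := ℝ)) this
      have hkw : (0 : ℝ) < k + w := by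
        have : (0 : ℤ) < k + w := by omega
        exact_mod_cast this
      rw [hcast]
      -- The tangent is taken at the landing point `k + w` and evaluated at `k`, which bounds `V (k
      -- + w)` from above.
      have htan : V (k + w) ≤ V k + V' (k + w) * w := by
        have := hV.tangent_le hk0 hkw
        linarith
      rcases lt_or_ge w 0 with hw0 | hw0
      · have h0 : ¬ (0 ≤ w) := by omega
        simp only [hT, h0, if_false, mul_zero, add_zero]
        have hkL : (0 : ℝ) ≤ (k : ℝ) - L := by
          have : ((L + 1 : ℕ) : ℝ) ≤ k := by exact_mod_cast hk
          push_cast at this; linarith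
        have hwL : (k : ℝ) - L ≤ k + w := by
          have : (-(L : ℤ) : ℝ) ≤ w := by exact_mod_cast hw
          push_cast at this; linarith
        have h1 : (1 - ε) * V' k ≤ V' (k + w) :=
          hdown.trans (hV.deriv_monotoneOn hkL hkw.le hwL)
        have hwr : (w : ℝ) ≤ 0 := by exact_mod_cast hw0.le
        have h2 : V' (k + w) * w ≤ (1 - ε) * V' k * w := mul_le_mul_of_nonpos_right h1 hwr
        calc c w * V (k + w) ≤ c w * (V k + (1 - ε) * V' k * w) := by
              gcongr
              · exact hc0 w
              · linarith
          _ = _ := by ring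
      · obtain ⟨l, rfl⟩ := Int.eq_ofNat_of_zero_le hw0
        have hcl := hc0 l
        simp only [hT, hw0, if_true, Int.toNat_natCast, Int.cast_natCast] at htan hkw ⊢
        have hlr : (0 : ℝ) ≤ l := by positivity
        split_ifs with hln
        -- For a jump beyond `n` the last term of `T` alone suffices; the others are nonnegative,
        -- the factor `1 + ε` being controlled by `hup`.
        · have : 0 ≤ V k * c l := mul_nonneg (hVp _ hk0).le hcl
          have hp : 0 ≤ V' k * ((1 + ε) * (l * c l)) := by
            have h1 : 0 ≤ (1 + ε) * V' k :=
              (hV.deriv_pos (by positivity)).le.trans hup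
            have := mul_nonneg h1 (mul_nonneg hlr hcl)
            linarith
          linarith
        · have hl : (l : ℝ) ≤ δ * (k : ℝ) ^ (1 - α) :=
            (Nat.le_floor_iff hδk).1 (by omega)
          have h1 : V' (k + l) ≤ (1 + ε) * V' k :=
            (hV.deriv_monotoneOn hkw.le (mem_Ici.2 (by positivity)) (by linarith)).trans hup
          have h2 : V' (k + l) * l ≤ (1 + ε) * V' k * l := mul_le_mul_of_nonneg_right h1 hlr
          calc c l * V (k + l) ≤ c l * (V k + (1 + ε) * V' k * l) := by
                gcongr
                linarith
            _ = _ := by ring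
  have hT0 : ∀ w, 0 ≤ T w := fun w =>
    (mul_nonneg (hc0 w) (hVp _ (by positivity)).le).trans (hle w)
  have hmain : ∑' w : ℤ, ENNReal.ofReal (c w) * ENNReal.ofReal (V ((k + w).toNat : ℕ))
      ≤ ENNReal.ofReal (V k * 1 + (V' k * ((1 - ε) * S₁) + V' k * (2 * ε * S₂)) + S₃) := by
    rw [← tsum_ofReal_of_hasSum hT0 hTsum]
    refine ENNReal.tsum_le_tsum fun w => ?_
    rw [← ENNReal.ofReal_mul (hc0 w)]
    exact ENNReal.ofReal_le_ofReal (hle w)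
  have hnn := hTsum.nonneg hT0
  calc _ ≤ _ := add_le_add_left hmain _
    _ = _ := (ENNReal.ofReal_add hnn (by positivity)).symm
    _ ≤ _ := by
        refine ENNReal.ofReal_le_ofReal ?_
        have := mul_le_mul_of_nonneg_left hκε hV'k.le
        nlinarith

theorem ofReal_applyV {Q : Matrix (ℕ × Fin d) (ℕ × Fin d) ℝ} (hQ : IsStochastic Q) {V : ℝ → ℝ}
    (hV : ∀ x, 0 ≤ x → 0 ≤ V x) {k : ℕ} {i : Fin d}
    (h : op Q (fun y => ENNReal.ofReal (V y.1)) (k, i) ≠ ⊤) :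
    ENNReal.ofReal (applyV Q V k i) = op Q (fun y => ENNReal.ofReal (V y.1)) (k, i) := by
  have hnn : ∀ y : ℕ × Fin d, 0 ≤ Q (k, i) y * V y.1 := fun y =>
    mul_nonneg (hQ.1 _ _) (hV _ (by positivity))
  have heq : op Q (fun y => ENNReal.ofReal (V y.1)) (k, i)
      = ∑' y, ENNReal.ofReal (Q (k, i) y * V y.1) :=
    tsum_congr fun y => (ENNReal.ofReal_mul (hQ.1 _ _)).symm
  rw [heq] at h ⊢
  exact ENNReal.ofReal_tsum_of_nonneg hnn (summable_of_tsum_ofReal_ne_top hnn h)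

/-- Only finitely many constraints occur, so the sum of their absolute values is admissible and the
infimum satisfies all of them. -/
theorem driftConst_spec (Q : Matrix (ℕ × Fin d) (ℕ × Fin d) ℝ) (V φ : ℝ → ℝ) (K : ℕ) :
    0 ≤ driftConst Q V φ K ∧ ∀ k, k ≤ K → ∀ i,
      applyV Q V k i - V k + φ (V k) ≤ driftConst Q V φ K := by
  set u : ℕ × Fin d → ℝ := fun x => applyV Q V x.1 x.2 - V x.1 + φ (V x.1) with hu
  have hne : {x : ℝ | 0 ≤ x ∧ ∀ k : ℕ, k ≤ K → ∀ i, applyV Q V k i - V k + φ (V k) ≤ x}.Nonempty := by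
    refine ⟨∑ x ∈ Finset.range (K + 1) ×ˢ Finset.univ, |u x|,
      Finset.sum_nonneg fun _ _ => abs_nonneg _, fun k hk i => ?_⟩
    exact (le_abs_self (u (k, i))).trans (Finset.single_le_sum (f := fun x => |u x|)
      (fun _ _ => abs_nonneg _) (by simp; omega))
  exact ⟨le_csInf hne fun x hx => hx.1, fun k hk i => le_csInf hne fun x hx => hx.2 k hk i⟩

end Drift

/-! ### Assembly of the error bound. -/

section Main

/-- Summing the drift inequality along the chain telescopes to `V x₀ + T b`; dividing by `T ≥ 1`
gives the bound. -/
theorem cesaro_le_of_drift {S : Type*} [DecidableEq S] {Q : Matrix S S ℝ} (hQ : IsStochastic Q)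
    {V w : S → ℝ≥0∞} {b : ℝ≥0∞} (h : ∀ x, op Q V x + w x ≤ V x + b) (x₀ : S) {T : ℕ}
    (hT : T ≠ 0) : cesaro Q x₀ T w ≤ V x₀ + b := by
  have key : ∀ T : ℕ, ∑ t ∈ Finset.range T, ev (matPow Q t x₀) w + ev (matPow Q T x₀) V
      ≤ V x₀ + T * b := by
    intro T
    induction T with
    | zero =>
      have : ev (matPow Q 0 x₀) V = V x₀ := congrFun (op_matPow hQ 0 V) x₀
      simp [this]
    | succ T ih =>
      have hp := (isStochastic_matPow hQ T).isProb x₀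
      have h1 : ev (matPow Q (T + 1) x₀) V = ev (matPow Q T x₀) (op Q V) := ev_push hp hQ V
      rw [Finset.sum_range_succ, h1, add_assoc, add_comm (ev _ w), ← ev_add]
      calc _ ≤ ∑ t ∈ Finset.range T, ev (matPow Q t x₀) w
            + ev (matPow Q T x₀) (fun x => V x + b) := by gcongr; exact ev_mono _ h
        _ = (∑ t ∈ Finset.range T, ev (matPow Q t x₀) w + ev (matPow Q T x₀) V) + b := by
            rw [ev_add, ev_const hp, add_assoc]
        _ ≤ V x₀ + T * b + b := by gcongr
        _ = _ := by push_cast; ring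
  have hT1 : (1 : ℝ≥0∞) ≤ T := by exact_mod_cast Nat.one_le_iff_ne_zero.2 hT
  have hTi : (T : ℝ≥0∞)⁻¹ * T = 1 := ENNReal.inv_mul_cancel (by exact_mod_cast hT) (by simp)
  calc cesaro Q x₀ T w ≤ (T : ℝ≥0∞)⁻¹ * (V x₀ + T * b) := by
        unfold cesaro
        gcongr
        exact le_self_add.trans (key T)
    _ = (T : ℝ≥0∞)⁻¹ * V x₀ + b := by rw [mul_add, ← mul_assoc, hTi, one_mul]
    _ ≤ _ := by
        gcongr
        exact mul_le_of_le_one_left' (ENNReal.inv_le_one.2 hT1)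

variable {d : ℕ} {A : ℤ → Matrix (Fin d) (Fin d) ℝ} {B₀ : ℕ → Matrix (Fin d) (Fin d) ℝ}

theorem IsJumpLaw.row {a : ℤ → Matrix (Fin d) (Fin d) ℝ} (h : IsJumpLaw a) (i : Fin d) :
    (∀ w, 0 ≤ (a w *ᵥ 1) i) ∧ HasSum (fun w => (a w *ᵥ 1) i) 1 := by
  have h0 : ∀ w, 0 ≤ (a w *ᵥ 1) i := fun w => by
    simp only [Matrix.mulVec, dotProduct, Pi.one_apply, mul_one]
    exact Finset.sum_nonneg fun j _ => h.1 w i j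
  refine ⟨h0, hasSum_of_tsum_ofReal h0 zero_le_one ?_⟩
  rw [ENNReal.ofReal_one, ← h.2 i]
  refine tsum_congr fun w => ?_
  simp only [Matrix.mulVec, dotProduct, Pi.one_apply, mul_one]
  rw [tsum_fintype, ENNReal.ofReal_sum_of_nonneg fun j _ => h.1 w i j]

variable {α : ℝ} {V V' V'' : ℝ → ℝ} {N M : ℕ}

theorem HeavyTail.levelMono {C : ℤ → Matrix (Fin d) (Fin d) ℝ} (hV : HeavyTail A C α V V' V'') :
    LevelMono (fun y : ℕ × Fin d => ENNReal.ofReal (V y.1)) :=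
  levelMono_comp (u := fun k => ENNReal.ofReal (V k)) fun a b hab =>
    ENNReal.ofReal_le_ofReal (hV.increasing.monotoneOn (mem_Ici.2 (Nat.cast_nonneg a))
      (mem_Ici.2 (Nat.cast_nonneg b)) (Nat.cast_le.2 hab))

/-- Monotonicity in the level reduces to a large level, where the free-walk formula holds: upward
jumps are summable by assumption, and only finitely many downward jumps have mass. -/
theorem HeavyTail.iterate_ne_top (hV : HeavyTail A (convPow (truncBelow A N) M) α V V' V'')
    (hP : IsStochastic (gig1 A B₀)) (hm : KMono (gig1 A B₀)) (hΨ : IsStochastic (blockTotal A))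
    (hN : 1 ≤ N) (k : ℕ) (i : Fin d) :
    (op (gig1 (truncBelow A N) B₀))^[M] (fun y => ENNReal.ofReal (V y.1)) (k, i) ≠ ⊤ := by
  obtain ⟨k', hk', hkk'⟩ := ((hV.tail_summable i).and (eventually_ge_atTop (max k (M * N)))).exists
  have hc0 := (((isJumpLaw_truncBelow hP hΨ N).convPow M).row i).1
  refine ne_top_of_le_ne_top ?_ ((kMono_gig1_truncBelow hP hm N).iterate M hV.levelMono i
    ((le_max_left _ _).trans hkk'))
  dsimp only
  rw [op_iterate_eq_convPow hP hΨ hN M (fun k => ENNReal.ofReal (V k)) k' i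
    ((le_max_right _ _).trans hkk'), tsum_int_split _ 0]
  refine ENNReal.add_ne_top.2 ⟨?_, ?_⟩
  · refine ne_of_eq_of_ne (tsum_congr fun m => ?_) hk'.tsum_ofReal_ne_top
    have : ((k' : ℤ) + (0 + (m : ℤ))).toNat = k' + m := by omega
    rw [this, zero_add, mul_comm, ← ENNReal.ofReal_mul (zero_le_one.trans (hV.one_le _ (by positivity)))]
    push_cast
    rfl
  · rw [tsum_eq_sum (s := Finset.range (M * N))]
    · exact ENNReal.sum_ne_top.2 fun m _ => ENNReal.mul_ne_top ENNReal.ofReal_ne_top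
        ENNReal.ofReal_ne_top
    · intro m hm
      rw [Finset.mem_range, not_lt] at hm
      rw [convPow_eq_zero (fun w hw => truncBelow_of_lt A hw) M _ (by omega)]
      simp

theorem HeavyTail.iterate_drift (hV : HeavyTail A (convPow (truncBelow A N) M) α V V' V'')
    (hP : IsStochastic (gig1 A B₀)) (hm : KMono (gig1 A B₀)) (hΨ : IsStochastic (blockTotal A))
    (hN : 1 ≤ N)
    (hM_drift : ∀ i, ∑' l : ℤ, (l : ℝ) * (convPow (truncBelow A N) M l *ᵥ 1) i < 0)
    {κ ε : ℝ} (hκ : 0 < κ)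
    (hκε : ∀ i,
      (1 - ε) * ∑' l : ℤ, (l : ℝ) * (convPow (truncBelow A N) M l *ᵥ 1) i
        + 2 * ε * ∑' l : ℕ, (l : ℝ) * (convPow (truncBelow A N) M (l : ℤ) *ᵥ 1) i ≤ -2 * κ)
    {δ₀ : ℝ} (hδ₀ : 0 < δ₀) {k : ℕ} (hk : M * N + 1 ≤ k)
    (hup : V' (k + δ₀ * (k : ℝ) ^ (1 - α)) ≤ (1 + ε) * V' k)
    (hdown : (1 - ε) * V' k ≤ V' ((k : ℝ) - ((M * N : ℕ) : ℝ)))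
    (htail : ∀ i, tailMoment (convPow (truncBelow A N) M) V α δ₀ k i / V' k ≤ κ) (i : Fin d) :
    (op (gig1 (truncBelow A N) B₀))^[M] (fun y => ENNReal.ofReal (V y.1)) (k, i)
      + ENNReal.ofReal (κ * V' k) ≤ ENNReal.ofReal (V k) := by
  obtain ⟨hc0, hc1⟩ := ((isJumpLaw_truncBelow hP hΨ N).convPow M).row i
  have hfin := hV.iterate_ne_top hP hm hΨ hN k i
  have heq := op_iterate_eq_convPow hP hΨ hN M (fun k => ENNReal.ofReal (V k)) k i (by omega)
  rw [heq] at hfin ⊢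
  refine hV.jump_drift hc0 hc1 (fun w hw => ?_) hκ hδ₀.le hk ?_ (hκε i) hup hdown ?_ ?_
  · rw [convPow_eq_zero (fun w hw => truncBelow_of_lt A hw) M _ hw]; simp
  -- A divergent first moment would make the sum 0 by convention, contradicting its negativity.
  · by_contra hns
    exact absurd (hM_drift i) (by rw [tsum_eq_zero_of_not_summable hns]; exact lt_irrefl 0)
  · rw [tsum_int_split _ 0] at hfin
    refine summable_of_tsum_ofReal_ne_top
      (fun l => mul_nonneg (zero_le_one.trans (hV.one_le _ (by positivity))) (hc0 _))
      (ne_of_eq_of_ne (tsum_congr fun m => ?_) (ENNReal.add_ne_top.1 hfin).1)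
    have : ((k : ℤ) + (0 + (m : ℤ))).toNat = k + m := by omega
    rw [this, zero_add, mul_comm, ENNReal.ofReal_mul (hc0 _)]
    push_cast
    rfl
  · have := htail i
    rwa [div_le_iff₀ (hV.deriv_pos (Nat.cast_nonneg k))] at this

/-- The truncation error bound under a drift condition for the `M`-step chain. -/
theorem tvDist_le_of_drift {P : Matrix (ℕ × Fin d) (ℕ × Fin d) ℝ} (hP : IsStochastic P)
    (hm : KMono P) {Ψ : Matrix (Fin d) (Fin d) ℝ} (hΨ : IsStochastic Ψ)
    (hirr : IsIrreducibleChain Ψ) (hph : HasPhase P Ψ) {C : ℤ → Matrix (Fin d) (Fin d) ℝ}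
    (hV : HeavyTail A C α V V' V'') {κ : ℝ} (hκ : 0 < κ) {φ : ℝ → ℝ} (hφ : IsRate κ V V' φ)
    {b : ℝ} (hb : 0 ≤ b) (hdrift : ∀ k i, op (matPow P M) (fun y => ENNReal.ofReal (V y.1)) (k, i)
      + ENNReal.ofReal (φ (V k)) ≤ ENNReal.ofReal (V k) + ENNReal.ofReal b)
    {v : ℕ → ℝ} (hv : ∀ k, 1 ≤ v k) (hvm : Monotone v) {c : ℝ} (hc : 0 < c)
    (hvdrift : ∀ k i, k ≠ 0 → op (matPow P M) (fun y => ENNReal.ofReal (v y.1)) (k, i)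
      + ENNReal.ofReal (c * φ (v k)) ≤ ENNReal.ofReal (v k))
    {π πn : ℕ × Fin d → ℝ} (hπ : IsStationary P π) {m n : ℕ} (hm1 : 1 ≤ m)
    (hπn : IsStationary (lcTrunc P n) πn) (hd : 0 < d) :
    tvDist πn π ≤ 8 * c⁻¹ / rateR φ (c * ((m : ℝ) - 1)) * v 1
      + 2 * m * M * b * d / (κ * V' n) := by
  have hr := hV.isConcaveRate hκ hφ
  have hQ := isStochastic_matPow hP M
  have hπQ := hπ.matPow hP M
  obtain ⟨hlim, hE⟩ := taboo_of_drift hQ (hm.matPow hP M) hπQ hr hv hvm hc hvdrift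
  have hVn := hV.deriv_pos (Nat.cast_nonneg n)
  have hκV : 0 < κ * V' n := mul_pos hκ hVn
  have hβ : ev π (fun x => if n < x.1 then 1 else 0) ≤ ENNReal.ofReal (b / (κ * V' n)) := by
    rw [ENNReal.ofReal_div_of_pos hκV, ENNReal.le_div_iff_mul_le
      (Or.inl (by simpa using hκV)) (Or.inl ENNReal.ofReal_ne_top), mul_comm, ← ev_const_mul]
    refine le_trans (ev_mono _ fun x => ?_) (ev_le_of_drift hQ hπQ
      (V := fun y => ENNReal.ofReal (V y.1)) (Φ := fun y => ENNReal.ofReal (φ (V y.1)))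
      (fun _ => ENNReal.ofReal_ne_top) fun x => hdrift x.1 x.2)
    split_ifs with h
    · rw [mul_one, hφ.eq_on_range _ (Nat.cast_nonneg _)]
      refine ENNReal.ofReal_le_ofReal (mul_le_mul_of_nonneg_left ?_ hκ.le)
      exact hV.deriv_monotoneOn (mem_Ici.2 (Nat.cast_nonneg _)) (mem_Ici.2 (Nat.cast_nonneg _))
        (Nat.cast_le.2 h.le)
    · simp
  have hm0 : (0 : ℝ) ≤ (m : ℝ) - 1 := by
    have : (1 : ℝ) ≤ m := by exact_mod_cast hm1
    linarith
  have hr1 : 0 < rateR φ (c * ((m : ℝ) - 1)) := hr.rateR_pos (by positivity)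
  have hr2 : 0 < rateR φ (c * m) := hr.rateR_pos (by positivity)
  have hrr : rateR φ (c * ((m : ℝ) - 1)) ≤ rateR φ (c * m) :=
    hr.rateR_mono (by positivity) (by gcongr; linarith)
  have hv1 : 0 < v 1 := zero_lt_one.trans_le (hv 1)
  have hmain := tvDist_lcTrunc_le hP hm hΨ hirr hph hπ hπn hlim m
    (by positivity) (div_nonneg hb hκV.le) (hE m) hβ
  refine hmain.trans (add_le_add ?_ ?_)
  -- The argument gives the factor 2 and the rate at `m`; the stated bound is weaker in both
  -- respects, and also carries the factor `d ≥ 1` in its second term.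
  · calc 2 * (v 1 / (c * rateR φ (c * m))) ≤ 8 * (v 1 / (c * rateR φ (c * ((m : ℝ) - 1)))) := by
          gcongr
          norm_num
      _ = _ := by field_simp
  · have hd1 : (1 : ℝ) ≤ d := by exact_mod_cast hd
    rw [← mul_div_assoc]
    exact div_le_div_of_nonneg_right (le_mul_of_one_le_right (by positivity) hd1) hκV.le

/-- Raising the Lyapunov function off level `0` absorbs the drift constant on the levels
`1, …, K`. -/
theorem shifted_drift {Q : Matrix (ℕ × Fin d) (ℕ × Fin d) ℝ} (hQ : IsStochastic Q) (hm : KMono Q)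
    {φ : ℝ → ℝ} (hφ : IsConcaveRate φ) {V : ℕ → ℝ} (hV : ∀ k, 1 ≤ V k) {b B : ℝ} (hB : 0 < B)
    {K : ℕ} (hle : ∀ k i, k ≤ K → op Q (fun y => ENNReal.ofReal (V y.1)) (k, i)
      + ENNReal.ofReal (φ (V k)) ≤ ENNReal.ofReal (V k) + ENNReal.ofReal b)
    (hgt : ∀ k i, K < k → op Q (fun y => ENNReal.ofReal (V y.1)) (k, i)
      + ENNReal.ofReal (φ (V k)) ≤ ENNReal.ofReal (V k))
    (hbB : ∀ i, b ≤ B * ∑ j, Q (K, i) (0, j)) {k : ℕ} (hk : k ≠ 0) (i : Fin d) :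
    op Q (fun y => ENNReal.ofReal (V y.1 + if y.1 = 0 then 0 else B)) (k, i)
      + ENNReal.ofReal (φ 1 / φ (B + 1) * φ (V k + if k = 0 then 0 else B))
      ≤ ENNReal.ofReal (V k + if k = 0 then 0 else B) := by
  set ind : ℕ × Fin d → ℝ≥0∞ := fun y => if y.1 = 0 then 0 else 1 with hind
  have hindm : LevelMono ind := by
    intro i a b hab
    simp only [hind]
    split_ifs <;> first | exact le_rfl | omega | simp
  have hV0 : ∀ k, 0 ≤ V k := fun k => zero_le_one.trans (hV k)
  have hsplit : (fun y : ℕ × Fin d => ENNReal.ofReal (V y.1 + if y.1 = 0 then 0 else B))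
      = fun y => ENNReal.ofReal (V y.1) + ENNReal.ofReal B * ind y := by
    ext y
    simp only [hind]
    split_ifs
    · simp
    · rw [mul_one, ENNReal.ofReal_add (hV0 _) hB.le]
  have hop : op Q (fun y => ENNReal.ofReal (V y.1 + if y.1 = 0 then 0 else B)) (k, i)
      = op Q (fun y => ENNReal.ofReal (V y.1)) (k, i) + ENNReal.ofReal B * op Q ind (k, i) := by
    rw [hsplit, op, ev_add, ev_const_mul]; rfl
  rw [hop, if_neg hk, ENNReal.ofReal_add (hV0 k) hB.le]
  have hshift : ENNReal.ofReal (φ 1 / φ (B + 1) * φ (V k + B)) ≤ ENNReal.ofReal (φ (V k)) :=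
    ENNReal.ofReal_le_ofReal (hφ.shift_le hB.le (hV k))
  rcases le_or_gt k K with hkK | hkK
  -- By monotonicity, a level `k ≤ K` returns to level 0 at least as often as `K` does. The expected
  -- loss of the added `B` is then at least `B` times the return probability from `K`, which covers
  -- `b`.
  · have hone : op Q ind (K, i) + ENNReal.ofReal (∑ j, Q (K, i) (0, j)) = 1 := by
      have h0 : ENNReal.ofReal (∑ j, Q (K, i) (0, j))
          = ev (Q (K, i)) fun y => if y.1 = 0 then 1 else 0 := by
        rw [ENNReal.ofReal_sum_of_nonneg fun j _ => hQ.1 _ _, ev, tsum_level]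
        refine Finset.sum_congr rfl fun j _ => ?_
        rw [tsum_eq_single 0 (by intro l hl; simp [hl])]
        simp
      rw [h0, op, ← ev_add, ← ev_const (hQ.isProb (K, i)) 1]
      congr 1
      ext y
      simp only [hind]
      rw [ev_const (hQ.isProb (K, i))]
      split_ifs <;> simp
    calc _ ≤ op Q (fun y => ENNReal.ofReal (V y.1)) (k, i) + ENNReal.ofReal B * op Q ind (K, i)
          + ENNReal.ofReal (φ (V k)) := by
          gcongr
          exact hm _ hindm i hkK
      _ = (op Q (fun y => ENNReal.ofReal (V y.1)) (k, i) + ENNReal.ofReal (φ (V k)))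
          + ENNReal.ofReal B * op Q ind (K, i) := by rw [add_right_comm]
      _ ≤ (ENNReal.ofReal (V k) + ENNReal.ofReal (B * ∑ j, Q (K, i) (0, j)))
          + ENNReal.ofReal B * op Q ind (K, i) := by
          exact add_le_add ((hle k i hkK).trans
            (add_le_add le_rfl (ENNReal.ofReal_le_ofReal (hbB i)))) le_rfl
      _ = ENNReal.ofReal (V k) + ENNReal.ofReal B
          * (op Q ind (K, i) + ENNReal.ofReal (∑ j, Q (K, i) (0, j))) := by
          rw [ENNReal.ofReal_mul hB.le, mul_add, add_assoc,
            add_comm (ENNReal.ofReal B * ENNReal.ofReal _)]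
      _ = _ := by rw [hone, mul_one]
  · calc _ ≤ op Q (fun y => ENNReal.ofReal (V y.1)) (k, i) + ENNReal.ofReal B * 1
          + ENNReal.ofReal (φ (V k)) := by
          gcongr
          exact ev_le_const (hQ.isProb _) fun y => by simp only [hind]; split_ifs <;> simp
      _ = (op Q (fun y => ENNReal.ofReal (V y.1)) (k, i) + ENNReal.ofReal (φ (V k)))
          + ENNReal.ofReal B := by rw [add_right_comm, mul_one]
      _ ≤ _ := by gcongr; exact hgt k i hkK

/-- A drift inequality in terms of `applyV`, in the extended nonnegative reals. -/
theorem op_add_le_of_applyV_le {Q : Matrix (ℕ × Fin d) (ℕ × Fin d) ℝ} (hQ : IsStochastic Q)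
    {V : ℝ → ℝ} (hV : ∀ x, 0 ≤ x → 0 ≤ V x) {k : ℕ} {i : Fin d}
    (hfin : op Q (fun y => ENNReal.ofReal (V y.1)) (k, i) ≠ ⊤) {f b : ℝ} (hf : 0 ≤ f) (hb : 0 ≤ b)
    (h : applyV Q V k i - V k + f ≤ b) :
    op Q (fun y => ENNReal.ofReal (V y.1)) (k, i) + ENNReal.ofReal f
      ≤ ENNReal.ofReal (V k) + ENNReal.ofReal b := by
  have hnn : 0 ≤ applyV Q V k i :=
    tsum_nonneg fun y => mul_nonneg (hQ.1 _ _) (hV _ (Nat.cast_nonneg _))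
  rw [← ofReal_applyV hQ hV hfin, ← ENNReal.ofReal_add hnn hf,
    ← ENNReal.ofReal_add (hV _ (Nat.cast_nonneg _)) hb]
  exact ENNReal.ofReal_le_ofReal (by linarith)

end Main

end BlockChain

end

/-! ### The theorem. -/

open BlockChain in
theorem theorem5p1 {d : ℕ} (hd : 0 < d)
    -- the block-monotone GI/G/1-type chain `gig1 A B₀`
    (A : ℤ → Matrix (Fin d) (Fin d) ℝ) (B₀ : ℕ → Matrix (Fin d) (Fin d) ℝ)
    (hP_stoch : IsStochastic (gig1 A B₀)) (hP_irr : IsIrreducibleChain (gig1 A B₀))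
    (hP_mono : BlockMonotone (gig1 A B₀))
    (hA_stoch : IsStochastic (blockTotal A)) (hA_irr : IsIrreducibleChain (blockTotal A))
    -- negative mean drift, also after truncation of the downward jumps at `-N`
    (ϖ : Fin d → ℝ) (hϖ : IsStationary (blockTotal A) ϖ) (hσ : meanDrift A ϖ < 0)
    (N M : ℕ) (hN : 1 ≤ N) (hM : 1 ≤ M) (hσN : meanDrift (truncBelow A N) ϖ < 0)
    (hM_drift : ∀ i, ∑' l : ℤ, (l : ℝ) * (convPow (truncBelow A N) M l *ᵥ 1) i < 0)
    -- the moment conditions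
    (α : ℝ) (V V' V'' : ℝ → ℝ)
    (hV : HeavyTail A (convPow (truncBelow A N) M) α V V' V'')
    -- the constants `κ`, `ε`, `δ₀`, `K₀` and `K`
    (κ ε : ℝ) (hκ : 0 < κ) (hε0 : 0 < ε) (hε1 : ε < 1)
    (hκε : ∀ i,
      (1 - ε) * ∑' l : ℤ, (l : ℝ) * (convPow (truncBelow A N) M l *ᵥ 1) i
        + 2 * ε * ∑' l : ℕ, (l : ℝ) * (convPow (truncBelow A N) M (l : ℤ) *ᵥ 1) i ≤ -2 * κ)
    (δ₀ : ℝ) (hδ₀ : 0 < δ₀) (K₀ : ℕ) (hK₀ : M * N ≤ K₀)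
    (hK₀_up : ∀ k : ℕ, K₀ + 1 ≤ k →
      V' (k + δ₀ * (k : ℝ) ^ (1 - α)) ≤ (1 + ε) * V' k)
    (hK₀_down : ∀ k : ℕ, K₀ + 1 ≤ k →
      (1 - ε) * V' k ≤ V' ((k : ℝ) - ((M * N : ℕ) : ℝ)))
    (K : ℕ) (hK : K₀ ≤ K)
    (hK_tail : ∀ k : ℕ, K + 1 ≤ k → ∀ i,
      tailMoment (convPow (truncBelow A N) M) V α δ₀ k i / V' k ≤ κ)
    -- the function `φ = κ V' ∘ V⁻¹`
    (φ : ℝ → ℝ) (hφ : IsRate κ V V' φ) :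
    -- the chain has a unique stationary probability vector
    (∃! π, IsStationary (gig1 A B₀) π) ∧
    -- the error bound in the general case
    ((∀ i, 0 < ∑ j, matPow (gig1 A B₀) M (K, i) (0, j)) →
      ∀ B : ℝ, 0 < B →
      (∀ i, driftConst (matPow (gig1 (truncBelow A N) B₀) M) V φ K
        ≤ B * ∑ j, matPow (gig1 A B₀) M (K, i) (0, j)) →
      ∀ π, IsStationary (gig1 A B₀) π →
      ∀ m n : ℕ, 1 ≤ m → 1 ≤ n →
      ∀ πn, IsStationary (lcTrunc (gig1 A B₀) n) πn →
      tvDist πn π ≤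
        8 * (rateC φ B 1)⁻¹ / rateR φ (rateC φ B ((m : ℝ) - 1)) * (V 1 + B)
        + 2 * m * M * driftConst (matPow (gig1 (truncBelow A N) B₀) M) V φ K * d
          / (κ * V' n)) ∧
    -- the simpler error bound, when the drift inequality holds with `0` in the place of `K`
    ((∀ k : ℕ, 1 ≤ k → ∀ i,
        applyV (matPow (gig1 (truncBelow A N) B₀) M) V k i - V k ≤ -κ * V' k) →
      ∀ π, IsStationary (gig1 A B₀) π →
      ∀ m n : ℕ, 1 ≤ m → 1 ≤ n →
      ∀ πn, IsStationary (lcTrunc (gig1 A B₀) n) πn →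
      tvDist πn π ≤
        8 / rateR φ ((m : ℝ) - 1) * V 1
        + 2 * m * M * driftConst (matPow (gig1 (truncBelow A N) B₀) M) V φ 0 * d
          / (κ * V' n)) := by
  set P := gig1 A B₀ with hPdef
  set PN := gig1 (truncBelow A N) B₀ with hPN
  have hm : KMono P := kMono_of_blockMonotone hP_stoch hP_mono
  have hNs : IsStochastic PN := isStochastic_gig1_truncBelow hP_stoch N
  have hNm : KMono PN := kMono_gig1_truncBelow hP_stoch hm N
  have hph : HasPhase P (blockTotal A) := hasPhase_gig1 hP_stoch hm
  have hr := hV.isConcaveRate hκ hφ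
  have hQ := isStochastic_matPow hP_stoch M
  have hQN := isStochastic_matPow hNs M
  have hV0 : ∀ x : ℝ, 0 ≤ x → 0 ≤ V x := fun x hx => zero_le_one.trans (hV.one_le x hx)
  have hV1 : ∀ k : ℕ, 1 ≤ V k := fun k => hV.one_le _ (Nat.cast_nonneg k)
  have hφV : ∀ k : ℕ, φ (V k) = κ * V' k := fun k => hφ.eq_on_range _ (Nat.cast_nonneg k)
  have hφ0 : ∀ k : ℕ, 0 ≤ φ (V k) := fun k => (hr.pos _ (hV1 k)).le
  have hfin : ∀ k i, op (matPow PN M) (fun y => ENNReal.ofReal (V y.1)) (k, i) ≠ ⊤ := by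
    intro k i
    rw [op_matPow hNs]
    exact hV.iterate_ne_top hP_stoch hm hA_stoch hN k i
  have hdom : ∀ k i, op (matPow P M) (fun y => ENNReal.ofReal (V y.1)) (k, i)
      ≤ op (matPow PN M) (fun y => ENNReal.ofReal (V y.1)) (k, i) := by
    intro k i
    rw [op_matPow hNs, op_matPow hP_stoch]
    exact op_iterate_le_of_dom hNm (gig1_truncBelow_dom hP_stoch N) M hV.levelMono _
  -- The drift is established for the cut chain, whose `M`-step law is explicit far from 0, and
  -- inherited by domination.
  have hfar : ∀ k i, K < k → op (matPow P M) (fun y => ENNReal.ofReal (V y.1)) (k, i)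
      + ENNReal.ofReal (φ (V k)) ≤ ENNReal.ofReal (V k) := by
    intro k i hk
    refine (add_le_add (hdom k i) le_rfl).trans ?_
    rw [op_matPow hNs, hφV]
    exact hV.iterate_drift hP_stoch hm hA_stoch hN hM_drift hκ hκε hδ₀ (by omega)
      (hK₀_up k (by omega)) (hK₀_down k (by omega)) (hK_tail k (by omega)) i
  have hnear : ∀ J k i, k ≤ J → op (matPow P M) (fun y => ENNReal.ofReal (V y.1)) (k, i)
      + ENNReal.ofReal (φ (V k))
      ≤ ENNReal.ofReal (V k) + ENNReal.ofReal (driftConst (matPow PN M) V φ J) := by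
    intro J k i hk
    obtain ⟨hb0, hb⟩ := driftConst_spec (matPow PN M) V φ J
    exact (add_le_add (hdom k i) le_rfl).trans
      (op_add_le_of_applyV_le hQN hV0 (hfin k i) (hφ0 k) hb0 (hb k hk i))
  have hall : ∀ k i, op (matPow P M) (fun y => ENNReal.ofReal (V y.1)) (k, i)
      + ENNReal.ofReal (φ (V k))
      ≤ ENNReal.ofReal (V k) + ENNReal.ofReal (driftConst (matPow PN M) V φ K) := by
    intro k i
    rcases le_or_gt k K with hk | hk
    · exact hnear K k i hk
    · exact (hfar k i hk).trans le_self_add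
  have hVmono : Monotone fun k : ℕ => V k := fun a b hab =>
    hV.increasing.monotoneOn (mem_Ici.2 (Nat.cast_nonneg a)) (mem_Ici.2 (Nat.cast_nonneg b))
      (Nat.cast_le.2 hab)
  refine ⟨?_, ?_, ?_⟩
  -- Since `V'` tends to infinity, `φ∘V` has finite sublevel sets; it serves as the tightness
  -- function for the `M`-step chain, and averaging over `M` steps then returns to `P`.
  · have hsub : ∀ c : ℕ, {x : ℕ × Fin d | ENNReal.ofReal (φ (V x.1)) ≤ c}.Finite := by
      intro c
      obtain ⟨k₀, hk₀⟩ := ((hV.deriv_atTop.comp tendsto_natCast_atTop_atTop).eventually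
        (eventually_gt_atTop ((c : ℝ) / κ))).exists_forall_of_atTop
      refine ((finite_Iio k₀).prod finite_univ).subset fun x hx => ⟨?_, mem_univ _⟩
      by_contra hk
      have h1 := hk₀ x.1 (not_lt.1 hk)
      rw [Function.comp, div_lt_iff₀' hκ, ← hφV] at h1
      have h2 : ENNReal.ofReal (φ (V x.1)) ≤ c := hx
      rw [← ENNReal.ofReal_natCast, ENNReal.ofReal_le_ofReal_iff (Nat.cast_nonneg c)] at h2
      exact absurd h1 (not_lt.2 h2)
    obtain ⟨η, hη⟩ := exists_isStationary_of_cesaro_le hQ (0, ⟨0, hd⟩) _ hsub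
      (ENNReal.add_ne_top.2 ⟨ENNReal.ofReal_ne_top, ENNReal.ofReal_ne_top⟩)
      fun T hT => cesaro_le_of_drift hQ (V := fun y => ENNReal.ofReal (V y.1))
        (fun x => hall x.1 x.2) _ hT
    obtain ⟨π, hπ⟩ := exists_isStationary_of_matPow hP_stoch (by omega) hη
    exact ⟨π, hπ, fun π' hπ' => isStationary_unique hP_stoch hP_irr hπ' hπ⟩
  · intro _ B hB hbB π hπ m n hm1 _ πn hπn
    have hc : 0 < φ 1 / φ (B + 1) := div_pos (hr.pos 1 le_rfl) (hr.pos _ (by linarith))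
    have hbP : ∀ i, driftConst (matPow PN M) V φ K ≤ B * ∑ j, matPow P M (K, i) (0, j) := hbB
    have h := tvDist_le_of_drift (M := M) hP_stoch hm hA_stoch hA_irr hph hV hκ hφ
      (driftConst_spec (matPow PN M) V φ K).1 hall
      -- The shift vanishes at level 0 and equals `B` from level 1 on, so `v 1` is `V 1 + B`, as in
      -- the bound.
      (v := fun k => V k + if k = 0 then 0 else B)
      (fun k => (hV1 k).trans (le_add_of_nonneg_right (by split_ifs <;> linarith)))
      (fun a b hab => add_le_add (hVmono hab) (by split_ifs <;> first | omega | linarith))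
      hc (fun k i hk => shifted_drift hQ (hm.matPow hP_stoch M) hr hV1 hB (hnear K)
        hfar hbP hk i) hπ hm1 hπn hd
    simpa [rateC] using h
  · intro hdrift π hπ m n hm1 _ πn hπn
    have hpos : ∀ k i, k ≠ 0 → op (matPow P M) (fun y => ENNReal.ofReal (V y.1)) (k, i)
        + ENNReal.ofReal (1 * φ (V k)) ≤ ENNReal.ofReal (V k) := by
      intro k i hk
      have h := op_add_le_of_applyV_le hQN hV0 (hfin k i) (hφ0 k) (le_refl 0)
        (by have := hdrift k (by omega) i; rw [hφV]; linarith)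
      rw [ENNReal.ofReal_zero, add_zero] at h
      rw [one_mul]
      exact (add_le_add (hdom k i) le_rfl).trans h
    have h := tvDist_le_of_drift (M := M) hP_stoch hm hA_stoch hA_irr hph hV hκ hφ
      (driftConst_spec (matPow PN M) V φ 0).1 (fun k i => ?_) (v := fun k => V k) hV1 hVmono
      one_pos hpos hπ hm1 hπn hd
    · simpa using h
    · rcases eq_or_ne k 0 with rfl | hk
      · exact hnear 0 0 i le_rfl
      · have := hpos k i hk
        rw [one_mul] at this
        exact this.trans le_self_add
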